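/- Let $\Gamma\subset SL(2,\mathbb{R})$ be a discrete subgroup and let $Y=\Gamma\backslash\mathbb{H}$ be the corresponding hyperbolic surface, where $\mathbb{H}$ is the upper half plane with the metric $y^{-2}(dx^2+dy^2)$. Assume that $Y$ is compact or of finite volume. Let $\gamma$ be either a fixed geodesic circle on $Y$ (the image in $Y$ of a circle $\{z\in\mathbb{H} : d(z,z_0)=r_0\}$, $r_0>0$) or a fixed closed horocycle on $Y$ (the image in $Y$ of $\{\sigma(x+iy_0): 0\le x\le 1\}$, where $y_0>0$ and $\sigma\in SL(2,\mathbb{R})$ is such that, up to sign, the elements of $\sigma^{-1}\Gamma\sigma$ fixing $\infty$ are exactly the matrices $\begin{pmatrix}1&n\\0&1\end{pmatrix}$, $n\in\mathbb{Z}$). Then there are constants $c>1$ and $C>0$, depending only on $Y$ and $\gamma$, such that the following holds for every $\tau>0$ and every real-valued $\phi\in L^2(Y)$ with $\|\phi\|_{L^2(Y)}=1$ and $$\triangle\phi=-\left(\tfrac14+\tau^2\right)\phi ,$$ where $\triangle=y^2(\partial_x^2+\partial_y^2)$ is the Laplace-Beltrami operator. Let $N(\phi)\subset Y$ be the zero set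 of $\phi$ and let $\|\phi\|_{L^2(\gamma)}$ be the $L^2$ norm of $\phi|_\gamma$ with respect to arc length, $\gamma$ being traversed once by the above parametrization (the circle $d(z,z_0)=r_0$, respectively $0\le x\le 1$). If $\|\phi\|_{L^2(\gamma)}\neq 0$, then $N(\phi)\cap\gamma$ is finite and $$|N(\phi)\cap\gamma| < C\,\log\frac{e^{c\tau}}{\|\phi\|_{L^2(\gamma)}} .$$ -/

import Mathlib

open scoped MatrixGroups

noncomputable section

namespace HypSurface

open UpperHalfPlane MeasureTheory

/-- The hyperbolic surface `Y = Γ \ ℍ`, with its quotient topology. -/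
abbrev Surface (Γ : Subgroup SL(2, ℝ)) : Type := MulAction.orbitRel.Quotient Γ ℍ

/-- The projection `ℍ → Γ \ ℍ`. -/
def proj (Γ : Subgroup SL(2, ℝ)) (z : ℍ) : Surface Γ := Quotient.mk'' z

/-- The function on `ℍ` that corresponds to a function on `Γ \ ℍ`. -/
def pullback {Γ : Subgroup SL(2, ℝ)} (φ : Surface Γ → ℝ) (z : ℍ) : ℝ := φ (proj Γ z)

/-- `F` is a fundamental domain, for the hyperbolic area measure `dx dy / y ^ 2`, of the group of
isometries of `ℍ` induced by `Γ` (passing to this group identifies `g` and `-g`). -/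
def IsFundDomain (Γ : Subgroup SL(2, ℝ)) (F : Set ℍ) : Prop :=
  IsFundamentalDomain (MulAction.toPermHom Γ ℍ).range F (volume : Measure ℍ)

/-- The Laplace-Beltrami operator `y ^ 2 (∂² / ∂x² + ∂² / ∂y²)` of `ℍ`. -/
def hypLaplacian (f : ℍ → ℝ) (z : ℍ) : ℝ :=
  z.im ^ 2 * Laplacian.laplacian (fun w : ℂ => f (ofComplex w)) (z : ℂ)

/-- `φ` is a real (classical) Laplace eigenfunction on `Γ \ ℍ` of eigenvalue `-(1/4 + τ ^ 2)`. -/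
structure IsEigenfunction {Γ : Subgroup SL(2, ℝ)} (φ : Surface Γ → ℝ) (τ : ℝ) : Prop where
  contDiffOn : ContDiffOn ℝ 2 (fun w : ℂ => pullback φ (ofComplex w)) {w : ℂ | 0 < w.im}
  eigen : ∀ z : ℍ, hypLaplacian (pullback φ) z = -(1 / 4 + τ ^ 2) * pullback φ z

/-- The norm of `L²(Γ \ ℍ)`, computed on a fundamental domain `F`. -/
def l2Norm {Γ : Subgroup SL(2, ℝ)} (F : Set ℍ) (φ : Surface Γ → ℝ) : ENNReal :=
  eLpNorm (pullback φ) 2 ((volume : Measure ℍ).restrict F)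

/-- The zero set `N(φ)` on `Γ \ ℍ`. -/
def zeroSet {Γ : Subgroup SL(2, ℝ)} (φ : Surface Γ → ℝ) : Set (Surface Γ) := {p | φ p = 0}

/-! A closed curve on `Γ \ ℍ` is given by a lift `α : ℝ → ℍ`, taken over `0 ≤ t ≤ 1`. -/

/-- The curve in `Γ \ ℍ` with lift `α`. -/
def trace (Γ : Subgroup SL(2, ℝ)) (α : ℝ → ℍ) : Set (Surface Γ) :=
  (fun t => proj Γ (α t)) '' Set.Icc 0 1

/-- The hyperbolic speed `|α'(t)| / Im α(t)`, so that `ds = hypSpeed α t dt` is arc length. -/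
def hypSpeed (α : ℝ → ℍ) (t : ℝ) : ℝ := ‖deriv (fun s => (α s : ℂ)) t‖ / (α t).im

/-- The norm of `L²(γ, ds)`, with `ds` the arc length, of the restriction of `φ` to the curve `γ`
with lift `α`. -/
def curveL2Norm {Γ : Subgroup SL(2, ℝ)} (α : ℝ → ℍ) (φ : Surface Γ → ℝ) : ℝ :=
  Real.sqrt (∫ t in (0 : ℝ)..1, pullback φ (α t) ^ 2 * hypSpeed α t)

lemma norm_polar (r θ : ℝ) :
    ‖((Real.tanh (r / 2) : ℝ) : ℂ) * Complex.exp (θ * Complex.I)‖ = |Real.tanh (r / 2)| := by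
  rw [norm_mul, Complex.norm_exp_ofReal_mul_I, Complex.norm_real, mul_one, Real.norm_eq_abs]

lemma polar_im (z₀ : ℍ) {q : ℂ} (hq : ‖q‖ < 1) :
    0 < ((z₀.re : ℂ) + z₀.im * (Complex.I * ((1 + q) / (1 - q)))).im := by
  have h1 : (1 - q) ≠ 0 := by
    intro h
    rw [← sub_eq_zero.mp h] at hq
    simp at hq
  have h2 : 0 < Complex.normSq (1 - q) := Complex.normSq_pos.mpr h1
  have h3 : Complex.normSq q < 1 := by
    rw [Complex.normSq_eq_norm_sq]
    nlinarith [norm_nonneg q]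
  have h4 : ((z₀.re : ℂ) + z₀.im * (Complex.I * ((1 + q) / (1 - q)))).im =
      z₀.im * ((1 - Complex.normSq q) / Complex.normSq (1 - q)) := by
    simp only [Complex.add_im, Complex.ofReal_im, Complex.mul_im, Complex.ofReal_re,
      Complex.I_re, Complex.I_im, Complex.div_re, Complex.add_re, Complex.sub_re, Complex.sub_im,
      Complex.one_re, Complex.one_im, Complex.normSq_apply q]
    ring
  rw [h4]
  exact mul_pos z₀.im_pos (div_pos (by linarith) h2)

/-- The point of `ℍ` with geodesic polar coordinates `(r, θ)` centered at `z₀`: in the disc model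
centered at `z₀` it is the point `q = tanh (r / 2) e ^ {iθ}`. -/
def geodesicPolar (z₀ : ℍ) (r θ : ℝ) : ℍ :=
  let q : ℂ := ((Real.tanh (r / 2) : ℝ) : ℂ) * Complex.exp (θ * Complex.I)
  ⟨(z₀.re : ℂ) + z₀.im * (Complex.I * ((1 + q) / (1 - q))), polar_im z₀ (by
    rw [norm_polar]; exact Real.abs_tanh_lt_one _)⟩

/-- `α` runs once around a geodesic circle (of positive radius). -/
def IsGeodesicCircle (α : ℝ → ℍ) : Prop :=
  ∃ (z₀ : ℍ) (r₀ : ℝ), 0 < r₀ ∧ ∀ t, α t = geodesicPolar z₀ r₀ (2 * Real.pi * t)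

/-- The parabolic matrix `(1 n; 0 1)`. -/
def translation (n : ℤ) : SL(2, ℝ) := ⟨!![1, (n : ℝ); 0, 1], by simp⟩

/-- `σ⁻¹ Γ σ` is reduced at `∞`: up to sign, its elements that fix `∞` are exactly the matrices
`(1 n; 0 1)` with `n` an integer. In particular `σ ∞` is a cusp of `Γ`. -/
def IsReducedAtInfty (Γ : Subgroup SL(2, ℝ)) (σ : SL(2, ℝ)) : Prop :=
  ∀ g : SL(2, ℝ), g 1 0 = 0 →
    ((σ * g * σ⁻¹ ∈ Γ ∨ -(σ * g * σ⁻¹) ∈ Γ) ↔ ∃ n : ℤ, g = translation n ∨ g = -translation n)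

/-- `α` runs once along a closed horocycle `{σ (x + i y₀)}` of `Γ \ ℍ`. -/
def IsClosedHorocycle (Γ : Subgroup SL(2, ℝ)) (α : ℝ → ℍ) : Prop :=
  ∃ (σ : SL(2, ℝ)) (y₀ : ℝ) (hy₀ : 0 < y₀), IsReducedAtInfty Γ σ ∧
    ∀ t : ℝ, α t = σ • (⟨(t : ℂ) + y₀ * Complex.I, by simpa using hy₀⟩ : ℍ)

end HypSurface

end

/-!
The number of zeros of an eigenfunction on the curve is bounded by Jensen's inequality, applied to
a holomorphic continuation of the restriction of the eigenfunction to the curve. The bound must be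
logarithmic in `e ^ {cτ} / ‖φ‖`, so the continuation has to exist on a strip whose width does not
depend on `τ`, and to be bounded there by a constant times `e ^ {cτ}`.

*Continuation.* Closed horocycles and geodesic circles are both horizontal lines in a holomorphic
coordinate of period `1`: the coordinate `z` itself, or the logarithm of the disc coordinate about
the center of the circle (`exists_isPeriodicCoord`). By conformal invariance of the Laplacian, a
Fourier mode of frequency `2πn` on the line of height `y` satisfies
`a'' = (4π²n² - Λ V(y)) a`, with `Λ = 1/4 + τ²` and `V` the density of the metric. For
`n² ≥ Λ max V` the factor is at least `n²`, and comparison with `cosh` shows that the mode is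
smaller by a factor of order `e ^ {-|n|η}` at height `s` than at the heights `s ± η`
(`abs_le_exp_of_deriv2`). For the other `n` this holds at the cost of a factor `e ^ {O(τ)}`. So the
Fourier series on the line converges in a fixed strip and is bounded there by `e ^ {O(τ)}` times
the maximum of the eigenfunction on a fixed compact set (`exists_continuation`).

*Sup bound.* The integral of an eigenfunction `u` over a disc of radius `r` about `z` is
`H(r, Λ) u(z)`, and `H` is not small for `r` of order `Λ ^ {-1/2}`. By Cauchy–Schwarz `|u(z)|` is
bounded by the `L²` norm of `u` on the disc, up to a power of `Λ`, and that norm is bounded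
by the norm on the surface because a compact set of `ℍ` is met by each orbit a bounded number of
times (`exists_abs_le_exp`).

*Small eigenvalues.* Jensen's inequality bounds the number of zeros by
`c₁ + c₂ τ - log ‖φ‖`, up to a factor, and the constant `c₁` has to be absorbed although `τ` may be
small. For `τ` bounded below, enlarging `c₂` does it. For one fixed small radius `r`, the averaging
operator over discs is symmetric by unfolding, and its factor `H(r, Λ)` is strictly decreasing in
`Λ`, so eigenfunctions of different small eigenvalues are orthogonal. Bessel's inequality then
bounds the sum of the squares of their values at a point (`exists_sum_sq_le`), whence only finitely
many `τ < 1` admit a normalized eigenfunction with `‖φ‖ ≥ 1/2` on the curve. Below all of them, the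
term `-log ‖φ‖ ≥ log 2` absorbs `c₁` (`exists_absorbing_constants`).
-/

noncomputable section

namespace HypSurface

open UpperHalfPlane MeasureTheory Filter Topology

section

/-! ### Conformal invariance of the Laplacian -/

/-- Along a holomorphic map the chain rule for the second derivative has a second order term
`Df (Ψ'' v v)`, whose trace over `v = 1, i` vanishes, and a first order term which only rotates and
scales the directions. -/
lemma laplacian_comp_of_analyticAt {f : ℂ → ℝ} {Ψ : ℂ → ℂ} {ζ : ℂ}
    (hf : ContDiffAt ℝ 2 f (Ψ ζ)) (hΨ : AnalyticAt ℂ Ψ ζ) :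
    Laplacian.laplacian (f ∘ Ψ) ζ = ‖deriv Ψ ζ‖ ^ 2 * Laplacian.laplacian f (Ψ ζ) := by
  have hcont : ContinuousAt Ψ ζ := hΨ.continuousAt
  have hf1 : ∀ᶠ w in 𝓝 (Ψ ζ), DifferentiableAt ℝ f w := by
    filter_upwards [hf.eventually (by simp)] with w hw using hw.differentiableAt (by simp)
  have hfirst : ∀ w : ℂ, (fun z => fderiv ℝ (f ∘ Ψ) z w) =ᶠ[𝓝 ζ]
      fun z => fderiv ℝ f (Ψ z) (deriv Ψ z * w) := by
    intro w
    filter_upwards [hcont.eventually hf1, hΨ.eventually_analyticAt] with z hz hz2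
    have h1 : HasFDerivAt Ψ ((ContinuousLinearMap.toSpanSingleton ℂ (deriv Ψ z)).restrictScalars ℝ)
        z := hz2.differentiableAt.hasDerivAt.hasFDerivAt.restrictScalars ℝ
    have h2 := (hz.hasFDerivAt.comp z h1).fderiv
    rw [h2]
    simp [mul_comm]
  have hff : HasFDerivAt (fderiv ℝ f) (fderiv ℝ (fderiv ℝ f) (Ψ ζ)) (Ψ ζ) :=
    ((hf.fderiv_right (m := 1) (by norm_num)).differentiableAt (by simp)).hasFDerivAt
  have hΨ1 : HasFDerivAt Ψ ((ContinuousLinearMap.toSpanSingleton ℂ (deriv Ψ ζ)).restrictScalars ℝ)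
      ζ := hΨ.differentiableAt.hasDerivAt.hasFDerivAt.restrictScalars ℝ
  have hΨ2 : HasFDerivAt (deriv Ψ)
      ((ContinuousLinearMap.toSpanSingleton ℂ (deriv (deriv Ψ) ζ)).restrictScalars ℝ) ζ :=
    hΨ.deriv.differentiableAt.hasDerivAt.hasFDerivAt.restrictScalars ℝ
  have hcomp2 : ContDiffAt ℝ 2 (f ∘ Ψ) ζ :=
    hf.comp ζ (hΨ.contDiffAt.restrict_scalars ℝ)
  have hD : DifferentiableAt ℝ (fderiv ℝ (f ∘ Ψ)) ζ :=
    (hcomp2.fderiv_right (m := 1) (by norm_num)).differentiableAt (by simp)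
  have hsecond : ∀ w v : ℂ, fderiv ℝ (fderiv ℝ (f ∘ Ψ)) ζ v w =
      fderiv ℝ (fderiv ℝ f) (Ψ ζ) (deriv Ψ ζ * v) (deriv Ψ ζ * w)
        + fderiv ℝ f (Ψ ζ) (deriv (deriv Ψ) ζ * v * w) := by
    intro w v
    have h1 : HasFDerivAt (fun z => fderiv ℝ (f ∘ Ψ) z w) _ ζ :=
      hD.hasFDerivAt.clm_apply (hasFDerivAt_const w ζ)
    have h2 : HasFDerivAt (fun z => fderiv ℝ f (Ψ z) (deriv Ψ z * w)) _ ζ :=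
      (hff.comp ζ hΨ1).clm_apply (hΨ2.mul_const w)
    have h3 := congrArg (fun L => L v) ((h1.congr_of_eventuallyEq (hfirst w).symm).unique h2)
    simp only [add_apply, ContinuousLinearMap.comp_apply,
      ContinuousLinearMap.flip_apply, zero_apply, map_zero, zero_add] at h3
    rw [show fderiv ℝ (fderiv ℝ (f ∘ Ψ)) ζ v w = _ from by simpa using h3]
    simp [add_comm, mul_comm]
  rw [InnerProductSpace.laplacian_eq_iteratedFDeriv_complexPlane,
    InnerProductSpace.laplacian_eq_iteratedFDeriv_complexPlane]
  simp only [iteratedFDeriv_two_apply, Matrix.cons_val_zero, Matrix.cons_val_one]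
  rw [hsecond, hsecond]
  set D := fderiv ℝ (fderiv ℝ f) (Ψ ζ)
  set a := deriv Ψ ζ
  have ha : a = a.re • (1 : ℂ) + a.im • Complex.I := by
    simp
  have hb : a * Complex.I = (-a.im) • (1 : ℂ) + a.re • Complex.I := by
    apply Complex.ext <;> simp
  rw [mul_one, hb]
  have hcancel : deriv (deriv Ψ) ζ * Complex.I * Complex.I = -(deriv (deriv Ψ) ζ * 1 * 1) := by
    rw [mul_assoc, Complex.I_mul_I]; ring
  rw [hcancel, map_neg]
  have hn : ‖a‖ ^ 2 = a.re ^ 2 + a.im ^ 2 := by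
    rw [← Complex.normSq_eq_norm_sq, Complex.normSq_apply]; ring
  rw [hn]
  have h3 : D a a = a.re ^ 2 * D 1 1 + a.re * a.im * D 1 Complex.I + a.re * a.im * D Complex.I 1
      + a.im ^ 2 * D Complex.I Complex.I := by
    conv_lhs => rw [ha]
    simp only [map_add, map_smul, add_apply, smul_apply,
      smul_eq_mul]
    ring
  rw [h3]
  simp only [map_add, map_smul, add_apply, smul_apply,
      smul_eq_mul]
  ring

/-- `u` is a `C²` function on `ℍ` with `y² Δ u = -Λ u`, not assumed to be invariant under any
group. -/
structure IsLaplaceEigen (u : ℍ → ℝ) (Λ : ℝ) : Prop where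
  contDiffOn : ContDiffOn ℝ 2 (fun w : ℂ => u (ofComplex w)) {w : ℂ | 0 < w.im}
  eigen : ∀ z : ℍ, hypLaplacian u z = -Λ * u z

lemma isOpen_im_pos : IsOpen {w : ℂ | 0 < w.im} := isOpen_lt continuous_const Complex.continuous_im

lemma IsEigenfunction.isLaplaceEigen {Γ : Subgroup SL(2, ℝ)} {φ : Surface Γ → ℝ} {τ : ℝ}
    (h : IsEigenfunction φ τ) : IsLaplaceEigen (pullback φ) (1 / 4 + τ ^ 2) :=
  ⟨h.contDiffOn, h.eigen⟩

lemma IsLaplaceEigen.continuous {u : ℍ → ℝ} {Λ : ℝ} (h : IsLaplaceEigen u Λ) : Continuous u := by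
  have h1 : Continuous (fun z : ℍ => u (ofComplex (z : ℂ))) :=
    h.contDiffOn.continuousOn.comp_continuous continuous_coe (fun z => z.im_pos)
  simpa using h1

lemma IsLaplaceEigen.sub_smul {u v : ℍ → ℝ} {Λ : ℝ} (hu : IsLaplaceEigen u Λ)
    (hv : IsLaplaceEigen v Λ) (c : ℝ) : IsLaplaceEigen (fun z => u z - c * v z) Λ := by
  have hv' : ContDiffOn ℝ 2 (c • fun w : ℂ => v (ofComplex w)) {w : ℂ | 0 < w.im} :=
    contDiffOn_const.smul hv.contDiffOn
  refine ⟨hu.contDiffOn.sub hv', fun z => ?_⟩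
  have h1 := hu.eigen z
  have h2 := hv.eigen z
  have hz : {w : ℂ | 0 < w.im} ∈ 𝓝 (z : ℂ) := isOpen_im_pos.mem_nhds z.im_pos
  have h3 := (hu.contDiffOn.contDiffAt hz).laplacian_sub (hv'.contDiffAt hz)
  have h4 := InnerProductSpace.laplacian_smul c (hv.contDiffOn.contDiffAt hz)
  have h5 : Laplacian.laplacian (fun w : ℂ => u (ofComplex w) - c * v (ofComplex w)) (z : ℂ) =
      Laplacian.laplacian (fun w : ℂ => u (ofComplex w)) (z : ℂ) -
        c * Laplacian.laplacian (fun w : ℂ => v (ofComplex w)) (z : ℂ) := by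
    rw [← smul_eq_mul, ← h4]; exact h3
  simp only [hypLaplacian] at *
  rw [h5]
  linear_combination h1 - c * h2

lemma IsLaplaceEigen.const_mul {v : ℍ → ℝ} {Λ : ℝ}
    (hv : IsLaplaceEigen v Λ) (c : ℝ) : IsLaplaceEigen (fun z => c * v z) Λ := by
  have h := hv.sub_smul hv (1 - c)
  have h2 : (fun z => v z - (1 - c) * v z) = fun z => c * v z := by
    funext z; ring
  rwa [h2] at h

/-- In a conformal coordinate `Ψ` the eigenvalue equation involves the hyperbolic density
`|Ψ'|² / (Im Ψ)²`. -/
lemma IsLaplaceEigen.comp_conformal {u : ℍ → ℝ} {Λ : ℝ} (hu : IsLaplaceEigen u Λ) {Ψ : ℂ → ℂ}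
    (hΨ : DifferentiableOn ℂ Ψ {w : ℂ | 0 < w.im}) (hpos : ∀ w : ℂ, 0 < w.im → 0 < (Ψ w).im) :
    ContDiffOn ℝ 2 (fun w => u (ofComplex (Ψ w))) {w : ℂ | 0 < w.im} ∧
      ∀ w : ℂ, 0 < w.im → Laplacian.laplacian (fun w => u (ofComplex (Ψ w))) w =
        -Λ * (‖deriv Ψ w‖ / (Ψ w).im) ^ 2 * u (ofComplex (Ψ w)) := by
  have han : ∀ w : ℂ, 0 < w.im → AnalyticAt ℂ Ψ w := fun w hw =>
    hΨ.analyticAt (isOpen_im_pos.mem_nhds hw)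
  constructor
  · refine hu.contDiffOn.comp (t := {w : ℂ | 0 < w.im}) (fun w hw => ?_) hpos
    exact ((han w hw).contDiffAt.restrict_scalars ℝ).contDiffWithinAt
  · intro w hw
    have h1 := laplacian_comp_of_analyticAt
      (hu.contDiffOn.contDiffAt (isOpen_im_pos.mem_nhds (hpos w hw))) (han w hw)
    have h2 := hu.eigen ⟨Ψ w, hpos w hw⟩
    simp only [hypLaplacian, mk_im] at h2
    rw [ofComplex_apply_of_im_pos (hpos w hw)]
    have h3 : Laplacian.laplacian (fun w => u (ofComplex (Ψ w))) w = _ := h1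
    rw [h3]
    have h4 : (Ψ w).im ≠ 0 := (hpos w hw).ne'
    rw [div_pow]
    field_simp
    linear_combination ‖deriv Ψ w‖ ^ 2 * h2

lemma coe_SL_smul (g : SL(2, ℝ)) (z : ℍ) :
    ((g • z : ℍ) : ℂ) = ((g 0 0 : ℂ) * z + g 0 1) / ((g 1 0 : ℂ) * z + g 1 1) := by
  simpa using coe_specialLinearGroup_apply g z

lemma SL_denom_ne_zero (g : SL(2, ℝ)) {w : ℂ} (hw : 0 < w.im) : (g 1 0 : ℂ) * w + g 1 1 ≠ 0 := by
  refine linear_ne_zero_of_im (cd := ![g 1 0, g 1 1]) hw.ne' fun H => ?_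
  have h1 : g 1 0 = 0 := by simpa using congrFun H 0
  have h2 : g 1 1 = 0 := by simpa using congrFun H 1
  have := g.det_coe
  rw [Matrix.det_fin_two] at this
  simp [h1, h2] at this

/-- The isometries `z ↦ g z` preserve the eigenvalue equation. -/
lemma IsLaplaceEigen.comp_smul {u : ℍ → ℝ} {Λ : ℝ} (hu : IsLaplaceEigen u Λ) (g : SL(2, ℝ)) :
    IsLaplaceEigen (fun z => u (g • z)) Λ := by
  set Ψ : ℂ → ℂ := fun w => ((g 0 0 : ℂ) * w + g 0 1) / ((g 1 0 : ℂ) * w + g 1 1) with hΨ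
  have hcoe : ∀ w : ℂ, ∀ hw : 0 < w.im, Ψ w = ((g • (⟨w, hw⟩ : ℍ) : ℍ) : ℂ) := fun w hw => by
    rw [coe_SL_smul]
  have hpos : ∀ w : ℂ, 0 < w.im → 0 < (Ψ w).im := fun w hw => by
    rw [hcoe w hw]; exact (g • (⟨w, hw⟩ : ℍ)).im_pos
  have hdet : (g 0 0 : ℂ) * g 1 1 - g 0 1 * g 1 0 = 1 := by
    have := g.det_coe
    rw [Matrix.det_fin_two] at this
    exact_mod_cast this
  have hder : ∀ w : ℂ, 0 < w.im → HasDerivAt Ψ (1 / ((g 1 0 : ℂ) * w + g 1 1) ^ 2) w := by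
    intro w hw
    have h1 : HasDerivAt (fun w : ℂ => (g 0 0 : ℂ) * w + g 0 1) (g 0 0 : ℂ) w := by
      simpa using ((hasDerivAt_id w).const_mul (g 0 0 : ℂ)).add_const (g 0 1 : ℂ)
    have h2 : HasDerivAt (fun w : ℂ => (g 1 0 : ℂ) * w + g 1 1) (g 1 0 : ℂ) w := by
      simpa using ((hasDerivAt_id w).const_mul (g 1 0 : ℂ)).add_const (g 1 1 : ℂ)
    refine (h1.div h2 (SL_denom_ne_zero g hw)).congr_deriv ?_
    congr 1
    linear_combination hdet
  have key := hu.comp_conformal (Ψ := Ψ)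
    (fun w hw => (hder w hw).differentiableAt.differentiableWithinAt) hpos
  have heq : Set.EqOn (fun w => u (g • ofComplex w)) (fun w => u (ofComplex (Ψ w)))
      {w : ℂ | 0 < w.im} := by
    intro w hw
    have hw' : 0 < w.im := hw
    simp only
    rw [hcoe w hw', ofComplex_apply, ofComplex_apply_of_im_pos hw']
  refine ⟨key.1.congr heq, fun z => ?_⟩
  have h1 : (fun w => u (g • ofComplex w)) =ᶠ[𝓝 (z : ℂ)] (fun w => u (ofComplex (Ψ w))) :=
    heq.eventuallyEq_of_mem (isOpen_im_pos.mem_nhds z.im_pos)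
  have h2 := (InnerProductSpace.laplacian_congr_nhds h1).eq_of_nhds
  have h3 := key.2 z z.im_pos
  simp only [hypLaplacian]
  rw [h2, h3]
  have h4 : Ψ z = ((g • z : ℍ) : ℂ) := hcoe z z.im_pos
  have h5 : (‖deriv Ψ z‖ / (Ψ z).im) = 1 / z.im := by
    rw [(hder z z.im_pos).deriv, h4, coe_im]
    have h6 : (g • z).im = z.im / Complex.normSq ((g 1 0 : ℂ) * z + g 1 1) := by
      rw [← coe_im, coe_SL_smul]
      have := congrArg Complex.im (show ((g 0 0 : ℂ) * z + g 0 1) / ((g 1 0 : ℂ) * z + g 1 1) =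
        ((g 0 0 : ℂ) * z + g 0 1) * (starRingEnd ℂ) ((g 1 0 : ℂ) * z + g 1 1) /
          (Complex.normSq ((g 1 0 : ℂ) * z + g 1 1) : ℂ) by
          rw [← Complex.mul_conj]
          have hne := SL_denom_ne_zero g z.im_pos
          exact (mul_div_mul_right _ _ ((map_ne_zero (starRingEnd ℂ)).2 hne)).symm)
      rw [this, Complex.div_ofReal_im]
      congr 1
      have hd : g 0 0 * g 1 1 - g 0 1 * g 1 0 = 1 := by exact_mod_cast hdet
      simp
      linear_combination z.im * hd
    rw [h6, Complex.normSq_eq_norm_sq, norm_div, norm_one, norm_pow]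
    have hne := norm_ne_zero_iff.2 (SL_denom_ne_zero g z.im_pos)
    have := z.im_pos.ne'
    field_simp
  rw [h5, h4, ofComplex_apply]
  have := z.im_pos.ne'
  field_simp

end

section

/-! ### Fourier modes of eigenfunctions in a periodic conformal coordinate -/

/-- A `1`-periodic `C²` function on the upper half-plane satisfying the eigenvalue equation of a
conformal metric whose density `V` depends only on the height. -/
structure IsStripEigen (G : ℂ → ℝ) (Λ : ℝ) (V : ℝ → ℝ) : Prop where
  contDiffOn : ContDiffOn ℝ 2 G {w : ℂ | 0 < w.im}
  periodic : ∀ w : ℂ, 0 < w.im → G (w + 1) = G w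
  eigen : ∀ w : ℂ, 0 < w.im → Laplacian.laplacian G w = -Λ * V w.im * G w

/-- The mean of `G h` over the horizontal segment `[0, 1] + i y`. -/
def horizontalMean (G : ℂ → ℝ) (h : ℝ → ℝ) (y : ℝ) : ℝ :=
  ∫ x in (0 : ℝ)..1, G (x + y * Complex.I) * h x

lemma im_add_mul_I (x y : ℝ) : ((x : ℂ) + y * Complex.I).im = y := by simp

lemma continuousOn_horizontal {K : ℂ → ℝ} (hK : ContinuousOn K {w : ℂ | 0 < w.im}) {y : ℝ}
    (hy : 0 < y) : Continuous fun x : ℝ => K (x + y * Complex.I) :=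
  hK.comp_continuous (by fun_prop) (fun x => by simpa using hy)

lemma hasDerivAt_horizontalMean {K K' : ℂ → ℝ} {h : ℝ → ℝ} (hh : Continuous h)
    (hK : ContinuousOn K {w : ℂ | 0 < w.im}) (hK' : ContinuousOn K' {w : ℂ | 0 < w.im})
    (hd : ∀ x y : ℝ, 0 < y →
      HasDerivAt (fun t : ℝ => K (x + t * Complex.I)) (K' (x + y * Complex.I)) y)
    {y : ℝ} (hy : 0 < y) :
    HasDerivAt (horizontalMean K h) (horizontalMean K' h y) y := by
  have hcpt : IsCompact (Set.uIcc (0 : ℝ) 1 ×ˢ Set.Icc (y / 2) (2 * y)) :=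
    isCompact_uIcc.prod isCompact_Icc
  have hcont : ContinuousOn (fun p : ℝ × ℝ => K' (p.1 + p.2 * Complex.I) * h p.1)
      (Set.uIcc (0 : ℝ) 1 ×ˢ Set.Icc (y / 2) (2 * y)) := by
    refine ContinuousOn.mul (hK'.comp (by fun_prop) ?_) (by fun_prop)
    intro p hp
    have := hp.2.1
    simp only [Set.mem_ofPred_eq, im_add_mul_I]
    linarith
  obtain ⟨C, hC⟩ := hcpt.exists_bound_of_continuousOn hcont
  have hs : Set.Ioo (y / 2) (2 * y) ∈ 𝓝 y := Ioo_mem_nhds (by linarith) (by linarith)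
  refine (intervalIntegral.hasDerivAt_integral_of_dominated_loc_of_deriv_le
    (𝕜 := ℝ) (F := fun (t : ℝ) x => K (x + t * Complex.I) * h x)
    (F' := fun (t : ℝ) x => K' (x + t * Complex.I) * h x) (bound := fun _ => C)
    hs ?_ ?_ ?_ ?_ ?_ ?_).2
  · filter_upwards [hs] with t ht
    have ht0 : 0 < t := by linarith [ht.1]
    exact ((continuousOn_horizontal hK ht0).mul hh).aestronglyMeasurable
  · exact ((continuousOn_horizontal hK hy).mul hh).intervalIntegrable _ _
  · exact ((continuousOn_horizontal hK' hy).mul hh).aestronglyMeasurable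
  · refine ae_of_all _ fun x hx t ht => hC (x, t) ⟨Set.uIoc_subset_uIcc hx, ht.1.le, ht.2.le⟩
  · simp
  · refine ae_of_all _ fun x _ t ht => ?_
    exact (hd x t (by linarith [ht.1])).mul_const (h x)

variable {G : ℂ → ℝ} {Λ : ℝ} {V : ℝ → ℝ}

lemma IsStripEigen.differentiableAt (hG : IsStripEigen G Λ V) {w : ℂ} (hw : 0 < w.im) :
    DifferentiableAt ℝ G w :=
  (hG.contDiffOn.contDiffAt (isOpen_im_pos.mem_nhds hw)).differentiableAt (by simp)

lemma IsStripEigen.contDiffOn_fderiv (hG : IsStripEigen G Λ V) :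
    ContDiffOn ℝ 1 (fderiv ℝ G) {w : ℂ | 0 < w.im} := by
  intro w hw
  exact ((hG.contDiffOn.contDiffAt (isOpen_im_pos.mem_nhds hw)).fderiv_right
    (m := 1) (by norm_num)).contDiffWithinAt

lemma IsStripEigen.differentiableAt_fderiv (hG : IsStripEigen G Λ V) {w : ℂ} (hw : 0 < w.im) :
    DifferentiableAt ℝ (fderiv ℝ G) w :=
  (hG.contDiffOn_fderiv.contDiffAt (isOpen_im_pos.mem_nhds hw)).differentiableAt (by simp)

lemma IsStripEigen.continuousOn_fderiv2 (hG : IsStripEigen G Λ V) (v w : ℂ) :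
    ContinuousOn (fun z => fderiv ℝ (fderiv ℝ G) z v w) {w : ℂ | 0 < w.im} := by
  have h1 : ContinuousOn (fderiv ℝ (fderiv ℝ G)) {w : ℂ | 0 < w.im} := by
    intro z hz
    exact ((hG.contDiffOn_fderiv.contDiffAt (isOpen_im_pos.mem_nhds hz)).fderiv_right
      (m := 0) (by norm_num)).continuousAt.continuousWithinAt
  exact (h1.clm_apply continuousOn_const).clm_apply continuousOn_const

lemma hasDerivAt_vertical (x y : ℝ) :
    HasDerivAt (fun t : ℝ => (x : ℂ) + t * Complex.I) Complex.I y := by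
  simpa using ((Complex.ofRealCLM.hasDerivAt (x := y)).mul_const Complex.I).const_add (x : ℂ)

lemma hasDerivAt_horizontal (x y : ℝ) :
    HasDerivAt (fun t : ℝ => (t : ℂ) + y * Complex.I) 1 x := by
  simpa using (Complex.ofRealCLM.hasDerivAt (x := x)).add_const ((y : ℂ) * Complex.I)

lemma IsStripEigen.fderiv_periodic (hG : IsStripEigen G Λ V) {w : ℂ} (hw : 0 < w.im) :
    fderiv ℝ G (w + 1) = fderiv ℝ G w := by
  rw [← fderiv_comp_add_right]
  refine Filter.EventuallyEq.fderiv_eq ?_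
  filter_upwards [isOpen_im_pos.mem_nhds hw] with z hz using hG.periodic z hz

/-- The derivative of a Fourier mode with respect to the height. -/
lemma IsStripEigen.hasDerivAt_mean (hG : IsStripEigen G Λ V) {h : ℝ → ℝ} (hh : Continuous h)
    {y : ℝ} (hy : 0 < y) :
    HasDerivAt (horizontalMean G h) (horizontalMean (fun z => fderiv ℝ G z Complex.I) h y) y := by
  refine hasDerivAt_horizontalMean hh hG.contDiffOn.continuousOn
    (hG.contDiffOn_fderiv.continuousOn.clm_apply continuousOn_const) (fun x y hy => ?_) hy
  exact (hG.differentiableAt (w := x + y * Complex.I)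
    (by simpa using hy)).hasFDerivAt.comp_hasDerivAt y (hasDerivAt_vertical x y)

/-- Separation of variables: the Fourier mode of frequency `ω` solves `A'' = (ω² - Λ V) A`. The
horizontal second derivative is moved to `h` by two integrations by parts, whose boundary terms
cancel by periodicity. -/
lemma IsStripEigen.hasDerivAt_mean_deriv (hG : IsStripEigen G Λ V) {h h1 : ℝ → ℝ} {ω : ℝ}
    (hh : ∀ x, HasDerivAt h (h1 x) x) (hh1 : ∀ x, HasDerivAt h1 (-ω ^ 2 * h x) x)
    (h01 : h 1 = h 0) (h101 : h1 1 = h1 0) {y : ℝ} (hy : 0 < y) :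
    HasDerivAt (horizontalMean (fun z => fderiv ℝ G z Complex.I) h)
      ((ω ^ 2 - Λ * V y) * horizontalMean G h y) y := by
  have hhc : Continuous h := continuous_iff_continuousAt.2 fun x => (hh x).continuousAt
  have hh1c : Continuous h1 := continuous_iff_continuousAt.2 fun x => (hh1 x).continuousAt
  have hmem : ∀ x : ℝ, 0 < ((x : ℂ) + y * Complex.I).im := fun x => by simpa using hy
  have hd := hasDerivAt_horizontalMean (K := fun z => fderiv ℝ G z Complex.I)
    (K' := fun z => fderiv ℝ (fderiv ℝ G) z Complex.I Complex.I) hhc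
    (hG.contDiffOn_fderiv.continuousOn.clm_apply continuousOn_const)
    (hG.continuousOn_fderiv2 _ _) (fun x y hy => by
      have h2 := (hG.differentiableAt_fderiv (w := x + y * Complex.I)
        (by simpa using hy)).hasFDerivAt.comp_hasDerivAt y (hasDerivAt_vertical x y)
      simpa using h2.clm_apply (hasDerivAt_const y Complex.I)) hy
  refine hd.congr_deriv ?_
  have hGx : ∀ x : ℝ, HasDerivAt (fun t : ℝ => G (t + y * Complex.I))
      (fderiv ℝ G (x + y * Complex.I) 1) x := fun x =>
    (hG.differentiableAt (hmem x)).hasFDerivAt.comp_hasDerivAt x (hasDerivAt_horizontal x y)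
  have hGxx : ∀ x : ℝ, HasDerivAt (fun t : ℝ => fderiv ℝ G (t + y * Complex.I) 1)
      (fderiv ℝ (fderiv ℝ G) (x + y * Complex.I) 1 1) x := fun x => by
    have h2 := (hG.differentiableAt_fderiv (hmem x)).hasFDerivAt.comp_hasDerivAt x
      (hasDerivAt_horizontal x y)
    simpa using h2.clm_apply (hasDerivAt_const x (1 : ℂ))
  have hGc := continuousOn_horizontal hG.contDiffOn.continuousOn hy
  have hGxc := continuousOn_horizontal
    (hG.contDiffOn_fderiv.continuousOn.clm_apply (continuousOn_const (c := (1 : ℂ)))) hy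
  have hGxxc := continuousOn_horizontal (hG.continuousOn_fderiv2 1 1) hy
  have hp0 : G (((1 : ℝ) : ℂ) + y * Complex.I) = G (((0 : ℝ) : ℂ) + y * Complex.I) := by
    rw [← hG.periodic _ (hmem 0)]
    congr 1
    push_cast; ring
  have hp1 : fderiv ℝ G (((1 : ℝ) : ℂ) + y * Complex.I) =
      fderiv ℝ G (((0 : ℝ) : ℂ) + y * Complex.I) := by
    rw [← hG.fderiv_periodic (hmem 0)]
    congr 1
    push_cast; ring
  have i1 := intervalIntegral.integral_mul_deriv_eq_deriv_mul (a := 0) (b := 1)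
    (fun x _ => hh x) (fun x _ => hGxx x) (hh1c.intervalIntegrable _ _)
    (hGxxc.intervalIntegrable _ _)
  have i2 := intervalIntegral.integral_mul_deriv_eq_deriv_mul (a := 0) (b := 1)
    (fun x _ => hh1 x) (fun x _ => hGx x)
    ((continuous_const.mul hhc).intervalIntegrable _ _) (hGxc.intervalIntegrable _ _)
  rw [hp1, h01, sub_self, zero_sub] at i1
  rw [hp0, h101, sub_self, zero_sub] at i2
  have hxx : ∫ x in (0 : ℝ)..1, h x * fderiv ℝ (fderiv ℝ G) (x + y * Complex.I) 1 1 =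
      -ω ^ 2 * horizontalMean G h y := by
    rw [i1, i2, neg_neg, horizontalMean, ← intervalIntegral.integral_const_mul]
    congr 1
    funext x
    ring
  have hlap : ∀ x : ℝ, fderiv ℝ (fderiv ℝ G) (x + y * Complex.I) Complex.I Complex.I * h x =
      (-Λ * V y) * (G (x + y * Complex.I) * h x) -
        h x * fderiv ℝ (fderiv ℝ G) (x + y * Complex.I) 1 1 := by
    intro x
    have := hG.eigen _ (hmem x)
    rw [InnerProductSpace.laplacian_eq_iteratedFDeriv_complexPlane, im_add_mul_I] at this
    simp only [iteratedFDeriv_two_apply, Matrix.cons_val_zero, Matrix.cons_val_one] at this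
    linear_combination h x * this
  rw [horizontalMean]
  simp_rw [hlap]
  rw [intervalIntegral.integral_sub, hxx, intervalIntegral.integral_const_mul, horizontalMean]
  · ring
  · exact (continuous_const.mul (hGc.mul hhc)).intervalIntegrable _ _
  · exact (hhc.mul hGxxc).intervalIntegrable _ _

end

section

/-! ### Two comparison principles for second order linear equations -/

/-- At an interior minimum the second derivative is nonnegative. -/
lemma not_isLocalMin_of_deriv_neg {v v1 : ℝ → ℝ} {m d : ℝ}
    (hv : ∀ᶠ y in 𝓝 m, HasDerivAt v (v1 y) y) (hv1 : HasDerivAt v1 d m) (hd : d < 0) :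
    ¬ IsLocalMin v m := by
  intro hmin
  have h1 : v1 =ᶠ[𝓝 m] deriv v := by
    filter_upwards [hv] with y hy using hy.deriv.symm
  have h0 : deriv v m = 0 := hmin.deriv_eq_zero
  have h2 : deriv (deriv v) m = d := by rw [← h1.deriv_eq]; exact hv1.deriv
  have hmax := isLocalMax_of_deriv_deriv_neg (f := v) (x₀ := m) (by rw [h2]; exact hd) h0
    hv.self_of_nhds.continuousAt
  -- A local maximum that is also a local minimum is locally constant, so `d = 0`.
  have hconst : v =ᶠ[𝓝 m] fun _ => v m := by
    filter_upwards [hmin, hmax] with y h3 h4 using le_antisymm h4 h3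
  have h3 : deriv v =ᶠ[𝓝 m] fun _ => 0 := by
    have := hconst.deriv
    simpa using this
  have h4 : deriv (deriv v) m = 0 := by rw [h3.deriv_eq]; simp
  linarith

/-- Comparison with the solution of `S'' = κ² S` that takes the value `B` at both ends: `S - a` has
no negative minimum. -/
lemma le_cosh_comparison {a a1 q : ℝ → ℝ} {s η κ B : ℝ} (hη : 0 < η) (hκ : 0 < κ)
    (ha : ∀ y ∈ Set.Icc (s - η) (s + η), HasDerivAt a (a1 y) y)
    (ha1 : ∀ y ∈ Set.Icc (s - η) (s + η), HasDerivAt a1 (q y * a y) y)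
    (hq : ∀ y ∈ Set.Icc (s - η) (s + η), κ ^ 2 ≤ q y) (hB : 0 < B)
    (hl : a (s - η) ≤ B) (hr : a (s + η) ≤ B) :
    a s ≤ B / Real.cosh (κ * η) := by
  by_contra hcon
  push Not at hcon
  set S : ℝ → ℝ := fun y => B / Real.cosh (κ * η) * Real.cosh (κ * (y - s)) with hS
  set S1 : ℝ → ℝ := fun y => B / Real.cosh (κ * η) * (Real.sinh (κ * (y - s)) * κ) with hS1
  have hlin : ∀ y, HasDerivAt (fun y => κ * (y - s)) κ y := fun y => by
    simpa using ((hasDerivAt_id y).sub_const s).const_mul κ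
  have hSd : ∀ y, HasDerivAt S (S1 y) y := fun y =>
    ((Real.hasDerivAt_cosh _).comp y (hlin y)).const_mul _
  have hS1d : ∀ y, HasDerivAt S1 (κ ^ 2 * S y) y := fun y => by
    refine ((((Real.hasDerivAt_sinh _).comp y (hlin y)).mul_const κ).const_mul
      (B / Real.cosh (κ * η))).congr_deriv ?_
    simp only [hS]
    ring
  have hcosh : 0 < Real.cosh (κ * η) := Real.cosh_pos _
  have hSpos : ∀ y, 0 < S y := fun y => by
    have := Real.cosh_pos (κ * (y - s))
    positivity
  set I := Set.Icc (s - η) (s + η)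
  have hcont : ContinuousOn (fun y => S y - a y) I := fun y hy =>
    ((hSd y).continuousAt.sub (ha y hy).continuousAt).continuousWithinAt
  obtain ⟨m, hm, hmin⟩ := isCompact_Icc.exists_isMinOn ⟨s, by constructor <;> linarith⟩ hcont
  have hSs : S s = B / Real.cosh (κ * η) := by simp [hS]
  have hneg : S m - a m < 0 := by
    have := hmin (show s ∈ I by constructor <;> linarith)
    simp only [Set.mem_ofPred_eq, hSs] at this
    linarith
  have hSl : S (s - η) = B := by
    simp only [hS]
    rw [show κ * (s - η - s) = -(κ * η) by ring, Real.cosh_neg]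
    field_simp
  have hSr : S (s + η) = B := by
    simp only [hS]
    rw [show κ * (s + η - s) = κ * η by ring]
    field_simp
  have hm1 : m ≠ s - η := by rintro rfl; linarith
  have hm2 : m ≠ s + η := by rintro rfl; linarith
  have hnhds : I ∈ 𝓝 m := Icc_mem_nhds (lt_of_le_of_ne hm.1 hm1.symm) (lt_of_le_of_ne hm.2 hm2)
  refine not_isLocalMin_of_deriv_neg (v := fun y => S y - a y) (v1 := fun y => S1 y - a1 y)
    (d := κ ^ 2 * S m - q m * a m) ?_ ((hS1d m).sub (ha1 m hm)) ?_ (hmin.isLocalMin hnhds)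
  · filter_upwards [hnhds] with y hy using (hSd y).sub (ha y hy)
  · have h1 := hSpos m
    have h2 := hq m hm
    have h3 : κ ^ 2 * a m ≤ q m * a m := mul_le_mul_of_nonneg_right h2 (by linarith)
    have h4 : κ ^ 2 * S m < κ ^ 2 * a m := mul_lt_mul_of_pos_left (by linarith) (by positivity)
    linarith

/-- A solution of `a'' = q a` with `q ≥ κ²` on an interval of length `2 η` is smaller in the middle
than at the ends by a factor `2 e^{-κ η}`. -/
lemma abs_le_exp_of_deriv2 {a a1 q : ℝ → ℝ} {s η κ B : ℝ} (hη : 0 < η) (hκ : 0 < κ)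
    (ha : ∀ y ∈ Set.Icc (s - η) (s + η), HasDerivAt a (a1 y) y)
    (ha1 : ∀ y ∈ Set.Icc (s - η) (s + η), HasDerivAt a1 (q y * a y) y)
    (hq : ∀ y ∈ Set.Icc (s - η) (s + η), κ ^ 2 ≤ q y) (hB : 0 < B)
    (hl : |a (s - η)| ≤ B) (hr : |a (s + η)| ≤ B) :
    |a s| ≤ 2 * B * Real.exp (-(κ * η)) := by
  have h1 := le_cosh_comparison hη hκ ha ha1 hq hB (le_of_abs_le hl) (le_of_abs_le hr)
  have h2 := le_cosh_comparison (a := fun y => -a y) (a1 := fun y => -a1 y) hη hκ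
    (fun y hy => (ha y hy).neg) (fun y hy => (ha1 y hy).neg.congr_deriv (mul_neg _ _).symm) hq hB
    (by linarith [neg_le_of_abs_le hl]) (by linarith [neg_le_of_abs_le hr])
  refine (abs_le.2 ⟨by linarith, h1⟩).trans ?_
  rw [div_le_iff₀ (Real.cosh_pos _), Real.cosh_eq]
  have h3 : Real.exp (-(κ * η)) * Real.exp (κ * η) = 1 := by rw [← Real.exp_add]; simp
  have h4 : 0 ≤ Real.exp (-(κ * η)) ^ 2 := by positivity
  nlinarith

/-- A convex function on a half-line lies above its limit at infinity. -/
lemma le_of_convex_tendsto {f f1 f2 : ℝ → ℝ} {s L : ℝ}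
    (hf : ∀ y, s ≤ y → HasDerivAt f (f1 y) y) (hf1 : ∀ y, s ≤ y → HasDerivAt f1 (f2 y) y)
    (h2 : ∀ y, s ≤ y → 0 ≤ f2 y) (hlim : Tendsto f atTop (𝓝 L)) {y : ℝ} (hy : s ≤ y) :
    L ≤ f y := by
  by_contra hcon
  push Not at hcon
  obtain ⟨z, hz1, hz2⟩ := ((hlim.eventually (lt_mem_nhds hcon)).and (eventually_gt_atTop y)).exists
  have hmono : MonotoneOn f1 (Set.Ici s) := by
    refine monotoneOn_of_deriv_nonneg (convex_Ici s)
      (fun w hw => (hf1 w hw).continuousAt.continuousWithinAt)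
      (fun w hw => ?_) (fun w hw => ?_)
    · exact (hf1 w (interior_subset hw)).differentiableAt.differentiableWithinAt
    · rw [(hf1 w (interior_subset hw)).deriv]; exact h2 w (interior_subset hw)
  obtain ⟨c, hc, hc2⟩ := exists_hasDerivAt_eq_slope f f1 hz2
    (fun w hw => (hf w (hy.trans hw.1)).continuousAt.continuousWithinAt)
    (fun w hw => hf w (hy.trans hw.1.le))
  have hcpos : 0 < f1 c := by
    rw [hc2]; exact div_pos (by linarith) (by linarith)
  -- The graph stays above a line of positive slope, so `f` is unbounded.
  have hgrow : ∀ w, c < w → f c + f1 c * (w - c) ≤ f w := by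
    intro w hw
    obtain ⟨e, he, he2⟩ := exists_hasDerivAt_eq_slope f f1 hw
      (fun u hu => (hf u (hy.trans (hc.1.le.trans hu.1))).continuousAt.continuousWithinAt)
      (fun u hu => hf u (hy.trans (hc.1.le.trans hu.1.le)))
    have h3 := hmono (show s ≤ c from hy.trans hc.1.le) (show s ≤ e from
      hy.trans (hc.1.le.trans he.1.le)) he.1.le
    rw [he2, le_div_iff₀ (by linarith)] at h3
    linarith
  have htop : Tendsto (fun w => f c + f1 c * (w - c)) atTop atTop :=
    tendsto_atTop_add_const_left _ _
      ((tendsto_atTop_add_const_right _ _ tendsto_id).const_mul_atTop hcpos)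
  have := tendsto_atTop_mono' atTop ((eventually_gt_atTop c).mono hgrow) htop
  exact not_tendsto_nhds_of_tendsto_atTop this L hlim

/-- If `|f''| ≤ E · 32 π² e^{-4πy}` and `f → L`, then `|f - L| ≤ 2 E e^{-4πy}`: adding or
subtracting the right-hand side makes `f` convex or concave. -/
lemma abs_sub_le_of_deriv2_le {f f1 f2 : ℝ → ℝ} {s L E : ℝ}
    (hf : ∀ y, s ≤ y → HasDerivAt f (f1 y) y) (hf1 : ∀ y, s ≤ y → HasDerivAt f1 (f2 y) y)
    (h2 : ∀ y, s ≤ y → |f2 y| ≤ E * (32 * Real.pi ^ 2 * Real.exp (-4 * Real.pi * y)))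
    (hlim : Tendsto f atTop (𝓝 L)) {y : ℝ} (hy : s ≤ y) :
    |f y - L| ≤ 2 * E * Real.exp (-4 * Real.pi * y) := by
  have hlin : ∀ y, HasDerivAt (fun y => -4 * Real.pi * y) (-4 * Real.pi) y := fun y => by
    simpa using (hasDerivAt_id y).const_mul (-4 * Real.pi)
  have he : ∀ y, HasDerivAt (fun y => 2 * E * Real.exp (-4 * Real.pi * y))
      (2 * E * (Real.exp (-4 * Real.pi * y) * (-4 * Real.pi))) y := fun y =>
    ((Real.hasDerivAt_exp _).comp y (hlin y)).const_mul _
  have he1 : ∀ y, HasDerivAt (fun y => 2 * E * (Real.exp (-4 * Real.pi * y) * (-4 * Real.pi)))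
      (E * (32 * Real.pi ^ 2 * Real.exp (-4 * Real.pi * y))) y := fun y => by
    refine ((((Real.hasDerivAt_exp _).comp y (hlin y)).mul_const (-4 * Real.pi)).const_mul
      (2 * E)).congr_deriv ?_
    ring
  have hel : Tendsto (fun y => 2 * E * Real.exp (-4 * Real.pi * y)) atTop (𝓝 0) := by
    have h3 : Tendsto (fun y => -4 * Real.pi * y) atTop atBot :=
      tendsto_id.const_mul_atTop_of_neg (by linarith [Real.pi_pos])
    simpa using (Real.tendsto_exp_atBot.comp h3).const_mul (2 * E)
  have hup := le_of_convex_tendsto (fun y hy => (he y).add (hf y hy))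
    (fun y hy => (he1 y).add (hf1 y hy))
    (fun y hy => by linarith [neg_le_of_abs_le (h2 y hy)]) (hel.add hlim) hy
  have hdown := le_of_convex_tendsto (fun y hy => (he y).sub (hf y hy))
    (fun y hy => (he1 y).sub (hf1 y hy))
    (fun y hy => by linarith [le_of_abs_le (h2 y hy)]) (hel.sub hlim) hy
  rw [abs_le]
  constructor
  · simp only [zero_add] at hup
    change L ≤ 2 * E * Real.exp (-4 * Real.pi * y) + f y at hup
    linarith
  · simp only [zero_sub] at hdown
    change -L ≤ 2 * E * Real.exp (-4 * Real.pi * y) - f y at hdown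
    linarith

end

section

/-! ### Geodesic polar coordinates as a periodic conformal coordinate -/

/-- The disc coordinate `q = e^{2πiζ}` on the upper half-plane of the variable `ζ`. -/
def nome (ζ : ℂ) : ℂ := Complex.exp (2 * Real.pi * Complex.I * ζ)

/-- The holomorphic covering of `ℍ ∖ {i}` by the upper half-plane: horizontal lines go to geodesic
circles centered at `i`, and `i∞` goes to `i`. -/
def diskParam (ζ : ℂ) : ℂ := Complex.I * ((1 + nome ζ) / (1 - nome ζ))

/-- The hyperbolic density of the coordinate `diskParam` at height `y`. -/
def diskDensity (y : ℝ) : ℝ :=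
  (4 * Real.pi * Real.exp (-(2 * Real.pi * y)) / (1 - Real.exp (-(2 * Real.pi * y)) ^ 2)) ^ 2

lemma norm_nome (ζ : ℂ) : ‖nome ζ‖ = Real.exp (-(2 * Real.pi * ζ.im)) := by
  rw [nome, Complex.norm_exp]
  congr 1
  simp

lemma norm_nome_lt_one {ζ : ℂ} (h : 0 < ζ.im) : ‖nome ζ‖ < 1 := by
  rw [norm_nome, Real.exp_lt_one_iff]
  have := Real.pi_pos
  have : 0 < 2 * Real.pi * ζ.im := by positivity
  linarith

lemma one_sub_nome_ne_zero {ζ : ℂ} (h : 0 < ζ.im) : 1 - nome ζ ≠ 0 := by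
  intro h1
  have := norm_nome_lt_one h
  rw [← sub_eq_zero.mp h1] at this
  simp at this

lemma diskParam_im (ζ : ℂ) :
    (diskParam ζ).im = (1 - ‖nome ζ‖ ^ 2) / ‖1 - nome ζ‖ ^ 2 := by
  rw [← Complex.normSq_eq_norm_sq, ← Complex.normSq_eq_norm_sq, diskParam]
  simp only [Complex.mul_im, Complex.I_re, Complex.I_im, Complex.div_re, Complex.add_re,
    Complex.sub_re, Complex.add_im, Complex.sub_im, Complex.one_re, Complex.one_im,
    Complex.normSq_apply (nome ζ)]
  ring

lemma diskParam_im_pos {ζ : ℂ} (h : 0 < ζ.im) : 0 < (diskParam ζ).im := by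
  rw [diskParam_im]
  have h1 := norm_nome_lt_one h
  have h2 := norm_pos_iff.2 (one_sub_nome_ne_zero h)
  have h3 := norm_nonneg (nome ζ)
  refine div_pos ?_ (by positivity)
  nlinarith

lemma hasDerivAt_diskParam {ζ : ℂ} (h : 0 < ζ.im) :
    HasDerivAt diskParam (-(4 * Real.pi) * nome ζ / (1 - nome ζ) ^ 2) ζ := by
  have h1 : HasDerivAt nome (nome ζ * (2 * Real.pi * Complex.I)) ζ := by
    have h2 : HasDerivAt (fun ζ : ℂ => 2 * Real.pi * Complex.I * ζ)
        (2 * Real.pi * Complex.I) ζ := by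
      simpa using (hasDerivAt_id ζ).const_mul (2 * Real.pi * Complex.I)
    exact h2.cexp
  refine (((h1.const_add 1).div (h1.const_sub 1) (one_sub_nome_ne_zero h)).const_mul
    Complex.I).congr_deriv ?_
  rw [← mul_div_assoc]
  congr 1
  linear_combination (4 * Real.pi * nome ζ) * Complex.I_mul_I

lemma diskParam_add_one (ζ : ℂ) : diskParam (ζ + 1) = diskParam ζ := by
  have : nome (ζ + 1) = nome ζ := by
    rw [nome, nome, mul_add, mul_one]
    exact Complex.exp_periodic _
  rw [diskParam, diskParam, this]

lemma sq_norm_deriv_diskParam_div_im {ζ : ℂ} (h : 0 < ζ.im) :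
    (‖deriv diskParam ζ‖ / (diskParam ζ).im) ^ 2 = diskDensity ζ.im := by
  have h2 := norm_ne_zero_iff.2 (one_sub_nome_ne_zero h)
  rw [(hasDerivAt_diskParam h).deriv, diskParam_im, diskDensity, ← norm_nome, norm_div, norm_pow,
    norm_mul, norm_neg]
  have h3 : ‖(4 * Real.pi : ℂ)‖ = 4 * Real.pi := by
    simp [abs_of_pos Real.pi_pos]
  rw [h3]
  congr 1
  field_simp

/-- An eigenfunction in geodesic polar coordinates centered at `i`. -/
lemma IsLaplaceEigen.isStripEigen_disk {u : ℍ → ℝ} {Λ : ℝ} (hu : IsLaplaceEigen u Λ) :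
    IsStripEigen (fun w => u (ofComplex (diskParam w))) Λ diskDensity := by
  have key := hu.comp_conformal (Ψ := diskParam)
    (fun w hw => (hasDerivAt_diskParam hw).differentiableAt.differentiableWithinAt)
    (fun w hw => diskParam_im_pos hw)
  refine ⟨key.1, fun w hw => by rw [diskParam_add_one], fun w hw => ?_⟩
  rw [key.2 w hw, sq_norm_deriv_diskParam_div_im hw]

/-- An eigenfunction invariant under `z ↦ z + 1`, in the coordinate `z` itself. -/
lemma IsLaplaceEigen.isStripEigen_id {u : ℍ → ℝ} {Λ : ℝ} (hu : IsLaplaceEigen u Λ)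
    (hper : ∀ z : ℍ, u ((1 : ℝ) +ᵥ z) = u z) :
    IsStripEigen (fun w => u (ofComplex w)) Λ (fun y => (1 / y) ^ 2) := by
  have key := hu.comp_conformal (Ψ := fun w => w) differentiableOn_id (fun w hw => hw)
  refine ⟨key.1, fun w hw => ?_, fun w hw => ?_⟩
  · have h1 : 0 < (w + 1).im := by simpa using hw
    rw [ofComplex_apply_of_im_pos h1, ofComplex_apply_of_im_pos hw, ← hper ⟨w, hw⟩]
    congr 1
    ext
    simp [add_comm]
  · rw [key.2 w hw]
    simp

/-- The point of `ℍ` with coordinate `ζ`. -/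
def diskPoint (ζ : ℂ) (h : 0 < ζ.im) : ℍ := ⟨diskParam ζ, diskParam_im_pos h⟩

lemma ofComplex_diskParam {ζ : ℂ} (h : 0 < ζ.im) : ofComplex (diskParam ζ) = diskPoint ζ h :=
  ofComplex_apply_of_im_pos _

lemma tanh_half_dist_diskPoint {ζ : ℂ} (h : 0 < ζ.im) :
    Real.tanh (dist (diskPoint ζ h) I / 2) = Real.exp (-(2 * Real.pi * ζ.im)) := by
  rw [tanh_half_dist, ← norm_nome, dist_eq_norm, dist_eq_norm, coe_I, Complex.conj_I]
  have h1 := one_sub_nome_ne_zero h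
  have h2 : ((diskPoint ζ h : ℍ) : ℂ) = Complex.I * ((1 + nome ζ) / (1 - nome ζ)) := rfl
  have h3 : Complex.I * ((1 + nome ζ) / (1 - nome ζ)) - Complex.I =
      nome ζ * (Complex.I * (2 / (1 - nome ζ))) := by
    field_simp; ring
  have h4 : Complex.I * ((1 + nome ζ) / (1 - nome ζ)) - -Complex.I =
      Complex.I * (2 / (1 - nome ζ)) := by
    field_simp; ring
  have h5 : Complex.I * (2 / (1 - nome ζ)) ≠ 0 :=
    mul_ne_zero Complex.I_ne_zero (div_ne_zero two_ne_zero h1)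
  rw [h2, h3, h4, norm_mul, mul_div_assoc, div_self (norm_ne_zero_iff.2 h5), mul_one]

/-- Every point other than the center has polar coordinates. -/
lemma exists_diskPoint {w : ℍ} (hw : w ≠ I) : ∃ (ζ : ℂ) (h : 0 < ζ.im), diskPoint ζ h = w := by
  have h1 : (w : ℂ) + Complex.I ≠ 0 := by
    intro h
    have := congrArg Complex.im h
    simp at this
    linarith [w.im_pos]
  have h2 : (w : ℂ) - Complex.I ≠ 0 := by
    intro h
    apply hw
    ext
    rw [sub_eq_zero.1 h, coe_I]
  set q : ℂ := ((w : ℂ) - Complex.I) / (w + Complex.I) with hq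
  have hq0 : q ≠ 0 := div_ne_zero h2 h1
  set ζ : ℂ := Complex.log q / (2 * Real.pi * Complex.I) with hζ
  have hpi : (2 * Real.pi * Complex.I : ℂ) ≠ 0 := by
    simp [Real.pi_ne_zero]
  have hnome : nome ζ = q := by
    rw [nome, hζ, mul_div_cancel₀ _ hpi, Complex.exp_log hq0]
  have hnorm : ‖q‖ < 1 := by
    rw [hq, norm_div, div_lt_one (norm_pos_iff.2 h1)]
    refine lt_of_pow_lt_pow_left₀ 2 (norm_nonneg _) ?_
    rw [← Complex.normSq_eq_norm_sq, ← Complex.normSq_eq_norm_sq, Complex.normSq_apply,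
      Complex.normSq_apply]
    simp
    nlinarith [w.im_pos]
  have him : 0 < ζ.im := by
    rw [← hnome, norm_nome, Real.exp_lt_one_iff] at hnorm
    have := Real.pi_pos
    by_contra hcon
    push Not at hcon
    have : 2 * Real.pi * ζ.im ≤ 0 := mul_nonpos_of_nonneg_of_nonpos (by positivity) hcon
    linarith
  refine ⟨ζ, him, ?_⟩
  ext
  change diskParam ζ = w
  have h3 : 1 - nome ζ ≠ 0 := one_sub_nome_ne_zero him
  rw [diskParam, hnome] at *
  have h4 : (1 - q) * (w + Complex.I) = 2 * Complex.I := by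
    rw [hq]; field_simp; ring
  have h5 : (1 + q) * (w + Complex.I) = 2 * w := by
    rw [hq]; field_simp; ring
  rw [← mul_div_assoc, div_eq_iff h3]
  apply mul_right_cancel₀ h1
  linear_combination Complex.I * h5 - w * h4

/-- The rotation of `ℍ` about `i` by the angle `2πθ`. -/
def rotation (θ : ℝ) : SL(2, ℝ) :=
  ⟨!![Real.cos (Real.pi * θ), Real.sin (Real.pi * θ);
    -Real.sin (Real.pi * θ), Real.cos (Real.pi * θ)], by
    rw [Matrix.det_fin_two_of]
    linear_combination Real.cos_sq_add_sin_sq (Real.pi * θ)⟩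

lemma continuous_rotation : Continuous rotation := by
  refine continuous_induced_rng.2 ?_
  refine continuous_matrix fun i j => ?_
  fin_cases i <;> fin_cases j <;> simp <;>
    fun_prop

lemma coe_rotation_smul (θ : ℝ) (z : ℍ) : ((rotation θ • z : ℍ) : ℂ) =
    (Complex.cos (Real.pi * θ) * z + Complex.sin (Real.pi * θ)) /
      (-Complex.sin (Real.pi * θ) * z + Complex.cos (Real.pi * θ)) := by
  rw [coe_SL_smul]
  simp [rotation]

lemma rotation_smul_I (θ : ℝ) : rotation θ • I = I := by
  have h := SL_denom_ne_zero (rotation θ) I.im_pos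
  ext
  rw [coe_rotation_smul, coe_I]
  have h' : -Complex.sin (Real.pi * θ) * Complex.I + Complex.cos (Real.pi * θ) ≠ 0 := by
    simpa [rotation] using h
  rw [div_eq_iff h']
  linear_combination (Complex.sin (Real.pi * θ)) * Complex.I_mul_I

lemma rotation_smul_diskPoint (θ : ℝ) {ζ : ℂ} (h : 0 < ζ.im) (h' : 0 < (ζ + θ).im) :
    rotation θ • diskPoint ζ h = diskPoint (ζ + θ) h' := by
  have h0 := SL_denom_ne_zero (rotation θ) (diskPoint ζ h).im_pos
  have h1 := one_sub_nome_ne_zero h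
  have h2 := one_sub_nome_ne_zero h'
  ext
  rw [coe_rotation_smul]
  have h3 : -Complex.sin (Real.pi * θ) * (diskPoint ζ h : ℂ) + Complex.cos (Real.pi * θ) ≠ 0 := by
    simpa [rotation] using h0
  rw [div_eq_iff h3]
  have hA : (diskPoint ζ h : ℂ) = Complex.I * ((1 + nome ζ) / (1 - nome ζ)) := rfl
  have hB : (diskPoint (ζ + θ) h' : ℂ) =
    Complex.I * ((1 + nome (ζ + θ)) / (1 - nome (ζ + θ))) := rfl
  have e1 : Complex.exp (Real.pi * θ * Complex.I) =
      Complex.cos (Real.pi * θ) + Complex.sin (Real.pi * θ) * Complex.I := Complex.exp_mul_I _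
  have e2 : Complex.cos (Real.pi * θ) ^ 2 + Complex.sin (Real.pi * θ) ^ 2 = 1 :=
    Complex.cos_sq_add_sin_sq _
  have hn : nome (ζ + θ) = nome ζ * Complex.exp (Real.pi * θ * Complex.I) ^ 2 := by
    rw [nome, nome, ← Complex.exp_nat_mul, ← Complex.exp_add]
    congr 1
    push_cast
    ring
  rw [e1] at hn
  rw [hA, hB]
  generalize Complex.cos (Real.pi * θ) = c at *
  generalize Complex.sin (Real.pi * θ) = s at *
  rw [hn] at h2 ⊢
  generalize nome ζ = q at *
  have hI := Complex.I_sq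
  generalize Complex.I = i at *
  rw [mul_comm s i] at h2
  field_simp
  linear_combination (-2 * q * s + 2 * q * (c + i * s) * i * s ^ 2 - 2 * q * (c + i * s) ^ 2 * s +
    (1 + q * (c + i * s) ^ 2) * s * (1 + q)) * hI - 2 * i * q * (c + i * s) * e2

end

section

/-! ### The mean value property -/

/-- The mean of `u` over the rotations of `w` about `i`. -/
def rotationMean (u : ℍ → ℝ) (w : ℍ) : ℝ := ∫ θ in (0 : ℝ)..1, u (rotation θ • w)

lemma continuous_rotation_smul {u : ℍ → ℝ} (hu : Continuous u) :
    Continuous fun p : ℍ × ℝ => u (rotation p.2 • p.1) :=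
  hu.comp ((continuous_rotation.comp continuous_snd).smul continuous_fst)

lemma continuous_rotationMean {u : ℍ → ℝ} (hu : Continuous u) : Continuous (rotationMean u) :=
  intervalIntegral.continuous_parametric_intervalIntegral_of_continuous'
    (f := fun w θ => u (rotation θ • w)) (continuous_rotation_smul hu) 0 1

lemma rotationMean_I (u : ℍ → ℝ) : rotationMean u I = u I := by
  simp [rotationMean, rotation_smul_I]

lemma rotationMean_diskPoint (u : ℍ → ℝ) {ζ : ℂ} (h : 0 < ζ.im) :
    rotationMean u (diskPoint ζ h) =
      horizontalMean (fun w => u (ofComplex (diskParam w))) (fun _ => 1) ζ.im := by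
  have hper : Function.Periodic
      (fun x : ℝ => u (ofComplex (diskParam ((x : ℂ) + ζ.im * Complex.I)))) 1 := by
    intro x
    simp only
    rw [← diskParam_add_one ((x : ℂ) + ζ.im * Complex.I)]
    congr 3
    push_cast
    ring
  have h1 : rotationMean u (diskPoint ζ h) =
      ∫ θ in (0 : ℝ)..1, u (ofComplex (diskParam (((θ + ζ.re : ℝ) : ℂ) + ζ.im * Complex.I))) := by
    refine intervalIntegral.integral_congr fun θ _ => ?_
    have h2 : 0 < (ζ + θ).im := by simpa using h
    rw [rotation_smul_diskPoint θ h h2, ← ofComplex_diskParam h2]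
    congr 3
    conv_lhs => rw [← Complex.re_add_im ζ]
    push_cast
    ring
  rw [h1, horizontalMean, intervalIntegral.integral_comp_add_right
    (fun x : ℝ => u (ofComplex (diskParam ((x : ℂ) + ζ.im * Complex.I))))]
  have h3 := hper.intervalIntegral_add_eq (0 + ζ.re) 0
  rw [zero_add, add_comm] at h3
  simpa [add_comm] using h3

lemma diskDensity_le {y : ℝ} (hy : 1 / 4 ≤ y) :
    diskDensity y ≤ 32 * Real.pi ^ 2 * Real.exp (-4 * Real.pi * y) := by
  have h3 := Real.pi_gt_three
  have he : Real.exp (-(2 * Real.pi * y)) ^ 2 = Real.exp (-4 * Real.pi * y) := by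
    rw [← Real.exp_nat_mul]; congr 1; push_cast; ring
  rw [diskDensity, div_pow, mul_pow, he]
  set t := Real.exp (-4 * Real.pi * y)
  have ht : t ≤ 1 / 4 := by
    have h1 : -4 * Real.pi * y ≤ -3 := by nlinarith
    have h2 : (4 : ℝ) ≤ Real.exp 3 := by linarith [Real.add_one_le_exp (3 : ℝ)]
    calc t ≤ Real.exp (-3) := Real.exp_le_exp.2 h1
      _ = 1 / Real.exp 3 := by rw [Real.exp_neg, one_div]
      _ ≤ 1 / 4 := one_div_le_one_div_of_le (by norm_num) h2
  have ht0 : 0 < t := Real.exp_pos _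
  rw [div_le_iff₀ (by nlinarith)]
  have h4 : 1 / 2 ≤ (1 - t) ^ 2 := by nlinarith
  have h5 : 0 < 32 * Real.pi ^ 2 * t := by positivity
  nlinarith

lemma le_diskDensity {y : ℝ} (hy : 0 < y) :
    16 * Real.pi ^ 2 * Real.exp (-4 * Real.pi * y) ≤ diskDensity y := by
  have h3 := Real.pi_pos
  have he : Real.exp (-(2 * Real.pi * y)) ^ 2 = Real.exp (-4 * Real.pi * y) := by
    rw [← Real.exp_nat_mul]; congr 1; push_cast; ring
  rw [diskDensity, div_pow, mul_pow, he]
  set t := Real.exp (-4 * Real.pi * y)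
  have ht0 : 0 < t := Real.exp_pos _
  have ht : t < 1 := by
    refine Real.exp_lt_one_iff.2 ?_
    have : 0 < 4 * Real.pi * y := by positivity
    linarith
  rw [le_div_iff₀ (by nlinarith [sq_pos_of_pos (sub_pos.2 ht)])]
  have h4 : (1 - t) ^ 2 ≤ 1 := by nlinarith
  have h5 : 0 < 16 * Real.pi ^ 2 * t := by positivity
  nlinarith

lemma diskDensity_nonneg (y : ℝ) : 0 ≤ diskDensity y := sq_nonneg _

/-- A bounded function whose every upper bound `D` improves to `A + D / 4` is bounded by
`4 A / 3`. -/
lemma le_of_self_improving {f : ℝ → ℝ} {S : Set ℝ} {A : ℝ} (hb : ∃ C, ∀ y ∈ S, f y ≤ C)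
    (himp : ∀ D, (∀ y ∈ S, f y ≤ D) → ∀ y ∈ S, f y ≤ A + D / 4) {y : ℝ} (hy : y ∈ S) :
    f y ≤ 4 / 3 * A := by
  obtain ⟨C, hC⟩ := hb
  have hbdd : BddAbove (f '' S) := ⟨C, by rintro _ ⟨z, hz, rfl⟩; exact hC z hz⟩
  have h1 : ∀ z ∈ S, f z ≤ sSup (f '' S) := fun z hz => le_csSup hbdd ⟨z, hz, rfl⟩
  have h2 : sSup (f '' S) ≤ A + sSup (f '' S) / 4 :=
    csSup_le ⟨f y, y, hy, rfl⟩ (by rintro _ ⟨z, hz, rfl⟩; exact himp _ h1 z hz)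
  linarith [h1 y hy]

/-- The circle mean of `u` about `i` as a function of the height in polar coordinates. -/
def circleMean (u : ℍ → ℝ) (y : ℝ) : ℝ :=
  horizontalMean (fun w => u (ofComplex (diskParam w))) (fun _ => 1) y

lemma strictMono_tanh : StrictMono Real.tanh := fun x y h => by
  have hx : ∀ x, Real.tanh x ∈ Set.Ioo (-1 : ℝ) 1 := fun x => Real.tanh_bijOn.mapsTo trivial
  rw [← Real.artanh_lt_artanh_iff (hx x) (hx y), Real.artanh_tanh, Real.artanh_tanh]
  exact h

/-- The height in polar coordinates corresponding to the radius `r`. -/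
lemma exists_radius {s : ℝ} (hs : 0 < s) :
    ∃ r : ℝ, 0 < r ∧ Real.tanh (r / 2) = Real.exp (-(2 * Real.pi * s)) := by
  have hI : 0 < ((s : ℂ) * Complex.I).im := by simpa using hs
  refine ⟨dist (diskPoint (s * Complex.I) hI) I, ?_, ?_⟩
  · have h1 := tanh_half_dist_diskPoint hI
    refine dist_pos.2 fun h => ?_
    rw [h, dist_self, zero_div, Real.tanh_zero] at h1
    exact (Real.exp_pos _).ne h1
  · simpa using tanh_half_dist_diskPoint hI

lemma dist_diskPoint_lt_iff {s r : ℝ} (hr : Real.tanh (r / 2) = Real.exp (-(2 * Real.pi * s)))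
    {ζ : ℂ} (h : 0 < ζ.im) : dist (diskPoint ζ h) I < r ↔ s < ζ.im := by
  have hpi := Real.pi_pos
  have h1 := tanh_half_dist_diskPoint h
  have h2 : dist (diskPoint ζ h) I < r ↔
      Real.tanh (dist (diskPoint ζ h) I / 2) < Real.tanh (r / 2) := by
    rw [strictMono_tanh.lt_iff_lt]
    constructor <;> intro h <;> linarith
  rw [h2, h1, hr, Real.exp_lt_exp]
  constructor
  · intro h
    nlinarith
  · intro h
    have := mul_lt_mul_of_pos_left h (show 0 < 2 * Real.pi by positivity)
    linarith

lemma tendsto_circleMean {u : ℍ → ℝ} (hu : Continuous u) :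
    Tendsto (circleMean u) atTop (𝓝 (u I)) := by
  -- The circle mean at height `y` is the rotation mean at the point `diskPoint (i y) → i`.
  have h1 : Tendsto (fun y : ℝ => ofComplex (diskParam (y * Complex.I))) atTop (𝓝 I) := by
    rw [Metric.tendsto_nhds]
    intro ε hε
    have h2 : Tendsto (fun y : ℝ => Real.exp (-(2 * Real.pi * y))) atTop (𝓝 0) := by
      refine Real.tendsto_exp_neg_atTop_nhds_zero.comp ?_
      exact tendsto_id.const_mul_atTop (by linarith [Real.pi_pos])
    have h3 : 0 < Real.tanh (ε / 2) := by
      rw [← Real.tanh_zero]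
      exact strictMono_tanh (by linarith)
    filter_upwards [h2.eventually (gt_mem_nhds h3), eventually_gt_atTop 0] with y hy hy0
    have hI : 0 < ((y : ℂ) * Complex.I).im := by simpa using hy0
    rw [ofComplex_diskParam hI]
    have h4 := tanh_half_dist_diskPoint hI
    have h5 : ((y : ℂ) * Complex.I).im = y := by simp
    rw [h5] at h4
    rw [← h4] at hy
    have := strictMono_tanh.lt_iff_lt.1 hy
    linarith
  have h2 := (continuous_rotationMean hu).continuousAt.tendsto.comp h1
  rw [rotationMean_I] at h2
  refine h2.congr' ?_
  filter_upwards [eventually_gt_atTop 0] with y hy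
  have hI : 0 < ((y : ℂ) * Complex.I).im := by simpa using hy
  simp only [Function.comp]
  rw [ofComplex_diskParam hI, rotationMean_diskPoint u hI, circleMean]
  simp

lemma bounded_of_tendsto {f : ℝ → ℝ} {s L : ℝ} (hf : ∀ y, s ≤ y → ContinuousAt f y)
    (hlim : Tendsto f atTop (𝓝 L)) : ∃ C, ∀ y ∈ Set.Ici s, |f y| ≤ C := by
  obtain ⟨N, hN⟩ := eventually_atTop.1 (hlim.abs.eventually (gt_mem_nhds (lt_add_one |L|)))
  obtain ⟨C, hC⟩ := (isCompact_Icc (a := s) (b := N)).exists_bound_of_continuousOn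
    (fun y hy => (hf y hy.1).continuousWithinAt)
  refine ⟨max C (|L| + 1), fun y hy => ?_⟩
  rcases le_total y N with h | h
  · exact (hC y ⟨hy, h⟩).trans (le_max_left _ _)
  · exact (hN y h).le.trans (le_max_right _ _)

variable {u v : ℍ → ℝ} {Λ Λ' : ℝ}

/-- The radial differential equation. -/
lemma IsLaplaceEigen.exists_circleMean_deriv (hu : IsLaplaceEigen u Λ) :
    ∃ f1 : ℝ → ℝ, (∀ y, 0 < y → HasDerivAt (circleMean u) (f1 y) y) ∧
      ∀ y, 0 < y → HasDerivAt f1 (-(Λ * diskDensity y) * circleMean u y) y := by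
  refine ⟨_, fun y hy => hu.isStripEigen_disk.hasDerivAt_mean continuous_const hy, fun y hy => ?_⟩
  have := hu.isStripEigen_disk.hasDerivAt_mean_deriv (h := fun _ => 1) (h1 := fun _ => 0) (ω := 0)
    (fun x => hasDerivAt_const _ _) (fun x => by simpa using hasDerivAt_const x (0 : ℝ)) rfl rfl hy
  refine this.congr_deriv ?_
  rw [circleMean]
  ring

lemma exp_bound_mono {s y : ℝ} (hy : s ≤ y) :
    Real.exp (-4 * Real.pi * y) ≤ Real.exp (-4 * Real.pi * s) := by
  refine Real.exp_le_exp.2 ?_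
  nlinarith [Real.pi_pos]

/-- Close to `i` the circle means stay close to the value at `i`. -/
lemma IsLaplaceEigen.abs_circleMean_sub_le (hu : IsLaplaceEigen u Λ) (hΛ : 0 ≤ Λ) {s : ℝ}
    (hs : 1 / 4 ≤ s) (hΛs : 2 * Λ * Real.exp (-4 * Real.pi * s) ≤ 1 / 4) {y : ℝ} (hy : s ≤ y) :
    |circleMean u y - u I| ≤ 1 / 3 * |u I| := by
  obtain ⟨f1, hf1, hf2⟩ := hu.exists_circleMean_deriv
  have hlim := tendsto_circleMean hu.continuous
  have hpos : ∀ y, s ≤ y → 0 < y := fun y hy => by linarith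
  have hstep : ∀ D, (∀ y ∈ Set.Ici s, |circleMean u y| ≤ D) → ∀ y ∈ Set.Ici s,
      |circleMean u y - u I| ≤ D / 4 := by
    intro D hD y hy
    have hD0 : 0 ≤ D := (abs_nonneg _).trans (hD y hy)
    have h1 := abs_sub_le_of_deriv2_le (E := Λ * D) (fun y hy => hf1 y (hpos y hy))
      (fun y hy => hf2 y (hpos y hy)) (fun y hy => by
        rw [abs_mul, abs_neg, abs_mul, abs_of_nonneg hΛ, abs_of_nonneg (diskDensity_nonneg y)]
        have h2 := diskDensity_le (hs.trans hy)
        have h3 := hD y hy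
        have h4 := diskDensity_nonneg y
        calc Λ * diskDensity y * |circleMean u y| ≤ Λ * diskDensity y * D := by gcongr
          _ ≤ Λ * (32 * Real.pi ^ 2 * Real.exp (-4 * Real.pi * y)) * D := by gcongr
          _ = _ := by ring) hlim (Set.mem_Ici.1 hy)
    have h2 := exp_bound_mono (Set.mem_Ici.1 hy)
    calc |circleMean u y - u I| ≤ 2 * (Λ * D) * Real.exp (-4 * Real.pi * y) := h1
      _ ≤ 2 * (Λ * D) * Real.exp (-4 * Real.pi * s) := by gcongr
      _ = 2 * Λ * Real.exp (-4 * Real.pi * s) * D := by ring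
      _ ≤ 1 / 4 * D := by gcongr
      _ = D / 4 := by ring
  have hbd : ∀ y ∈ Set.Ici s, |circleMean u y| ≤ 4 / 3 * |u I| := fun y hy =>
    le_of_self_improving (f := fun y => |circleMean u y|)
      (bounded_of_tendsto (fun y hy => (hf1 y (hpos y hy)).continuousAt) hlim)
      (fun D hD y hy => by
        have h1 := hstep D hD y hy
        have h2 := abs_sub_abs_le_abs_sub (circleMean u y) (u I)
        linarith) hy
  have := hstep _ hbd y hy
  linarith

/-- Circle means of normalized eigenfunctions are strictly decreasing in the eigenvalue. -/
lemma IsLaplaceEigen.circleMean_lt (hu : IsLaplaceEigen u Λ) (hv : IsLaplaceEigen v Λ')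
    (hΛ : 0 ≤ Λ) (hlt : Λ < Λ') (hu1 : u I = 1) (hv1 : v I = 1) {s : ℝ}
    (hs : 1 / 4 ≤ s) (hΛs : 2 * Λ' * Real.exp (-4 * Real.pi * s) ≤ 1 / 4) {y : ℝ} (hy : s ≤ y) :
    circleMean v y < circleMean u y := by
  obtain ⟨f1, hf1, hf2⟩ := hu.exists_circleMean_deriv
  obtain ⟨g1, hg1, hg2⟩ := hv.exists_circleMean_deriv
  have hlim := (tendsto_circleMean hu.continuous).sub (tendsto_circleMean hv.continuous)
  rw [hu1, hv1, sub_self] at hlim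
  have hpos : ∀ y, s ≤ y → 0 < y := fun y hy => by linarith
  have hvb : ∀ y, s ≤ y → |circleMean v y - 1| ≤ 1 / 3 := fun y hy => by
    simpa [hv1] using hv.abs_circleMean_sub_le (by linarith) hs hΛs hy
  set d : ℝ → ℝ := fun y => circleMean u y - circleMean v y with hd
  set δ := Λ' - Λ with hδ
  have hδ0 : 0 < δ := sub_pos.2 hlt
  set es := Real.exp (-4 * Real.pi * s) with hes
  have hes0 : 0 < es := Real.exp_pos _
  have hd1 : ∀ y, s ≤ y → HasDerivAt d (f1 y - g1 y) y := fun y hy =>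
    (hf1 y (hpos y hy)).sub (hg1 y (hpos y hy))
  have hd2 : ∀ y, s ≤ y → HasDerivAt (fun y => f1 y - g1 y)
      (diskDensity y * (δ * circleMean v y - Λ * d y)) y := fun y hy =>
    ((hf2 y (hpos y hy)).sub (hg2 y (hpos y hy))).congr_deriv (by
      simp only [hd, hδ]; ring)
  have hΛe : Λ * es ≤ 1 / 8 := by nlinarith
  have hbd : ∀ y ∈ Set.Ici s, |d y| ≤ 4 / 3 * (8 / 3 * δ * es) := fun y hy =>
    le_of_self_improving (f := fun y => |d y|)
      (bounded_of_tendsto (fun y hy => (hd1 y hy).continuousAt) hlim)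
      (fun D hD y hy => by
        have hD0 : 0 ≤ D := (abs_nonneg _).trans (hD y hy)
        have h1 := abs_sub_le_of_deriv2_le (E := 4 / 3 * δ + Λ * D) hd1 hd2 (fun y hy => by
          rw [abs_mul, abs_of_nonneg (diskDensity_nonneg y), mul_comm]
          have h2 := diskDensity_le (hs.trans hy)
          have h3 := abs_le.1 (hvb y hy)
          have h4 := abs_le.1 (hD y hy)
          have h5 := diskDensity_nonneg y
          have h6 : |δ * circleMean v y - Λ * d y| ≤ 4 / 3 * δ + Λ * D := by
            rw [abs_le]
            constructor <;> nlinarith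
          exact mul_le_mul h6 h2 h5 (by positivity)) hlim (Set.mem_Ici.1 hy)
        rw [sub_zero] at h1
        have h2 := exp_bound_mono (Set.mem_Ici.1 hy)
        calc |d y| ≤ 2 * (4 / 3 * δ + Λ * D) * Real.exp (-4 * Real.pi * y) := h1
          _ ≤ 2 * (4 / 3 * δ + Λ * D) * es := by gcongr
          _ = 8 / 3 * δ * es + 2 * (Λ * es) * D := by ring
          _ ≤ 8 / 3 * δ * es + 2 * (1 / 8) * D := by gcongr
          _ = 8 / 3 * δ * es + D / 4 := by ring) hy
  -- Hence `d''` exceeds the second derivative of `(2 / 9) δ e^{-4πy}`.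
  have hconv : ∀ y, s ≤ y → 2 / 9 * δ * (16 * Real.pi ^ 2 * Real.exp (-4 * Real.pi * y)) ≤
      diskDensity y * (δ * circleMean v y - Λ * d y) := by
    intro y hy
    have h1 := abs_le.1 (hvb y hy)
    have h2 := abs_le.1 (hbd y hy)
    have h3 := le_diskDensity (hpos y hy)
    have h4 : Λ * d y ≤ 4 / 9 * δ := by
      calc Λ * d y ≤ Λ * (4 / 3 * (8 / 3 * δ * es)) := by gcongr; exact h2.2
        _ = 32 / 9 * δ * (Λ * es) := by ring
        _ ≤ 32 / 9 * δ * (1 / 8) := by gcongr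
        _ = 4 / 9 * δ := by ring
    have h5 : 2 / 9 * δ ≤ δ * circleMean v y - Λ * d y := by nlinarith
    calc 2 / 9 * δ * (16 * Real.pi ^ 2 * Real.exp (-4 * Real.pi * y))
        ≤ (δ * circleMean v y - Λ * d y) * diskDensity y :=
          mul_le_mul h5 h3 (by positivity) (by linarith)
      _ = _ := by ring
  have hlin : ∀ y, HasDerivAt (fun y => -4 * Real.pi * y) (-4 * Real.pi) y := fun y => by
    simpa using (hasDerivAt_id y).const_mul (-4 * Real.pi)
  have he : ∀ y, HasDerivAt (fun y => 2 / 9 * δ * Real.exp (-4 * Real.pi * y))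
      (2 / 9 * δ * (Real.exp (-4 * Real.pi * y) * (-4 * Real.pi))) y := fun y =>
    ((Real.hasDerivAt_exp _).comp y (hlin y)).const_mul _
  have he1 : ∀ y, HasDerivAt (fun y => 2 / 9 * δ * (Real.exp (-4 * Real.pi * y) * (-4 * Real.pi)))
      (2 / 9 * δ * (16 * Real.pi ^ 2 * Real.exp (-4 * Real.pi * y))) y := fun y => by
    refine ((((Real.hasDerivAt_exp _).comp y (hlin y)).mul_const (-4 * Real.pi)).const_mul
      (2 / 9 * δ)).congr_deriv ?_
    ring
  have hel : Tendsto (fun y => 2 / 9 * δ * Real.exp (-4 * Real.pi * y)) atTop (𝓝 0) := by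
    have h3 : Tendsto (fun y => -4 * Real.pi * y) atTop atBot :=
      tendsto_id.const_mul_atTop_of_neg (by linarith [Real.pi_pos])
    simpa using (Real.tendsto_exp_atBot.comp h3).const_mul (2 / 9 * δ)
  have hfin := le_of_convex_tendsto (fun y hy => (hd1 y hy).sub (he y))
    (fun y hy => (hd2 y hy).sub (he1 y)) (fun y hy => sub_nonneg.2 (hconv y hy))
    (hlim.sub hel) hy
  rw [sub_zero] at hfin
  have hfin' : 0 ≤ d y - 2 / 9 * δ * Real.exp (-4 * Real.pi * y) := hfin
  have : 0 < 2 / 9 * δ * Real.exp (-4 * Real.pi * y) := by positivity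
  simp only [hd] at hfin'
  linarith

end

section

lemma measurePreserving_SL_smul (g : SL(2, ℝ)) :
    MeasurePreserving (fun z : ℍ => g • z) volume volume :=
  measurePreserving_smul (Matrix.SpecialLinearGroup.mapGL ℝ g : GL (Fin 2) ℝ) (volume : Measure ℍ)

lemma measurableEmbedding_SL_smul (g : SL(2, ℝ)) : MeasurableEmbedding (fun z : ℍ => g • z) :=
  (Homeomorph.smul g).measurableEmbedding

lemma preimage_smul_ball (g : SL(2, ℝ)) (z : ℍ) (r : ℝ) :
    (fun w : ℍ => g • w) ⁻¹' Metric.ball (g • z) r = Metric.ball z r := by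
  ext w
  simp

lemma setIntegral_ball_smul (u : ℍ → ℝ) (g : SL(2, ℝ)) (z : ℍ) (r : ℝ) :
    ∫ w in Metric.ball (g • z) r, u w = ∫ w in Metric.ball z r, u (g • w) := by
  rw [← preimage_smul_ball g z r]
  exact ((measurePreserving_SL_smul g).setIntegral_preimage_emb
    (measurableEmbedding_SL_smul g) u _).symm

lemma volume_ball_smul (g : SL(2, ℝ)) (z : ℍ) (r : ℝ) :
    volume (Metric.ball (g • z) r) = volume (Metric.ball z r) := by
  rw [← preimage_smul_ball g z r]
  exact ((measurePreserving_SL_smul g).measure_preimage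
    Metric.isOpen_ball.measurableSet.nullMeasurableSet).symm

lemma volume_ball_lt_top (z : ℍ) (r : ℝ) : volume (Metric.ball z r) < ⊤ :=
  Metric.isBounded_ball.measure_lt_top

lemma integrableOn_ball {u : ℍ → ℝ} (hu : Continuous u) (z : ℍ) (r : ℝ) :
    IntegrableOn u (Metric.ball z r) :=
  (hu.continuousOn.integrableOn_compact (isCompact_closedBall z r)).mono_set
    Metric.ball_subset_closedBall

/-- On a disc about `i` the integral does not change when `u` is averaged over rotations. -/
lemma integral_ball_rotationMean {u : ℍ → ℝ} (hu : Continuous u) (r : ℝ) :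
    ∫ w in Metric.ball I r, rotationMean u w = ∫ w in Metric.ball I r, u w := by
  have hint : Integrable (Function.uncurry fun (w : ℍ) (θ : ℝ) => u (rotation θ • w))
      ((volume.restrict (Metric.ball I r)).prod (volume.restrict (Set.Ioc (0 : ℝ) 1))) := by
    rw [Measure.prod_restrict]
    refine IntegrableOn.mono_set (t := Metric.closedBall I r ×ˢ Set.Icc (0 : ℝ) 1) ?_
      (Set.prod_mono Metric.ball_subset_closedBall Set.Ioc_subset_Icc_self)
    exact (continuous_rotation_smul hu).continuousOn.integrableOn_compact
      ((isCompact_closedBall I r).prod isCompact_Icc)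
  have hswap := integral_integral_swap hint
  simp only [rotationMean, intervalIntegral.integral_of_le zero_le_one]
  rw [hswap]
  have hrot : ∀ θ : ℝ, ∫ w in Metric.ball I r, u (rotation θ • w) =
      ∫ w in Metric.ball I r, u w := fun θ => by
    have := setIntegral_ball_smul u (rotation θ) I r
    rw [rotation_smul_I] at this
    exact this.symm
  simp_rw [hrot]
  simp

/-- The disc of radius `r` about `i` is the set of heights greater than `s` in the coordinate
`diskParam`, and both it and `Λ` times its area are so small that the circle means of an
eigenfunction of eigenvalue `Λ` about `i` stay close to its value there. -/
structure IsMeanRadius (Λ s r : ℝ) : Prop where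
  quarter_le : 1 / 4 ≤ s
  small : 2 * Λ * Real.exp (-4 * Real.pi * s) ≤ 1 / 4
  pos : 0 < r
  tanh_eq : Real.tanh (r / 2) = Real.exp (-(2 * Real.pi * s))

variable {u v : ℍ → ℝ} {Λ Λ' s r : ℝ}

lemma rotationMean_eq_circleMean (u : ℍ → ℝ) (hr : IsMeanRadius Λ s r) {w : ℍ}
    (hw : w ∈ Metric.ball I r) (hwI : w ≠ I) :
    ∃ y, s ≤ y ∧ rotationMean u w = circleMean u y ∧ rotationMean v w = circleMean v y := by
  obtain ⟨ζ, hζ, rfl⟩ := exists_diskPoint hwI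
  exact ⟨ζ.im, ((dist_diskPoint_lt_iff hr.tanh_eq hζ).1 hw).le, rotationMean_diskPoint u hζ,
    rotationMean_diskPoint v hζ⟩

lemma IsLaplaceEigen.abs_rotationMean_sub_le (hu : IsLaplaceEigen u Λ) (hΛ : 0 ≤ Λ)
    (hr : IsMeanRadius Λ s r) {w : ℍ} (hw : w ∈ Metric.ball I r) :
    |rotationMean u w - u I| ≤ 1 / 3 * |u I| := by
  by_cases hwI : w = I
  · rw [hwI, rotationMean_I, sub_self, abs_zero]
    positivity
  · obtain ⟨y, hy, h1, -⟩ := rotationMean_eq_circleMean (v := u) u hr hw hwI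
    rw [h1]
    exact hu.abs_circleMean_sub_le hΛ hr.quarter_le hr.small hy

lemma IsLaplaceEigen.le_integral_ball (hu : IsLaplaceEigen u Λ) (hΛ : 0 ≤ Λ)
    (hr : IsMeanRadius Λ s r) (h1 : u I = 1) :
    2 / 3 * volume.real (Metric.ball I r) ≤ ∫ w in Metric.ball I r, u w := by
  rw [← integral_ball_rotationMean hu.continuous]
  have h2 : ∫ w in Metric.ball I r, (2 / 3 : ℝ) ≤ ∫ w in Metric.ball I r, rotationMean u w := by
    refine setIntegral_mono_on (integrableOn_const (volume_ball_lt_top I r).ne)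
      (integrableOn_ball (continuous_rotationMean hu.continuous) I r)
      Metric.isOpen_ball.measurableSet fun w hw => ?_
    have h3 := hu.abs_rotationMean_sub_le hΛ hr hw
    rw [h1, abs_one] at h3
    linarith [(abs_le.1 h3).1]
  rw [setIntegral_const, smul_eq_mul] at h2
  linarith

/-- Mean value property: the integral over a small disc is a multiple of the value at the center,
the factor being the same for all centers and all eigenfunctions with the same eigenvalue. -/
lemma IsLaplaceEigen.integral_ball_eq (hu : IsLaplaceEigen u Λ) (hv : IsLaplaceEigen v Λ)
    (hΛ : 0 ≤ Λ) (hr : IsMeanRadius Λ s r) (h1 : v I = 1) (z : ℍ) :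
    ∫ w in Metric.ball z r, u w = (∫ w in Metric.ball I r, v w) * u z := by
  obtain ⟨g, rfl⟩ : ∃ g : SL(2, ℝ), g • I = z := ⟨_, toSL2R_smul_I z⟩
  rw [setIntegral_ball_smul]
  have hw := (hu.comp_smul g).sub_smul hv (u (g • I))
  have h0 : ∫ w in Metric.ball I r, (u (g • w) - u (g • I) * v w) = 0 := by
    rw [← integral_ball_rotationMean hw.continuous]
    refine (setIntegral_congr_fun Metric.isOpen_ball.measurableSet
      (g := fun _ => (0 : ℝ)) fun w hw' => ?_).trans (by simp)
    have h3 := hw.abs_rotationMean_sub_le hΛ hr hw'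
    simp only [h1, mul_one, sub_self, abs_zero, mul_zero, sub_zero] at h3
    exact abs_nonpos_iff.1 h3
  rw [integral_sub (integrableOn_ball (hu.comp_smul g).continuous I r)
    ((integrableOn_ball hv.continuous I r).const_mul _), integral_const_mul] at h0
  linarith

lemma volume_singleton_I : volume ({I} : Set ℍ) = 0 := by
  rw [volume_eq_lintegral, Set.image_singleton, Measure.restrict_singleton]
  simp

/-- The disc of radius `r` contains a Euclidean disc of radius `tanh (r / 2)`, on which the
density is at least `1 / 4`. -/
lemma le_volume_ball (hr : 0 < r) :
    Real.tanh (r / 2) ^ 2 / 2 ≤ volume.real (Metric.ball I r) := by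
  set ρ := Real.tanh (r / 2) with hρ
  have hρ0 : 0 < ρ := by
    rw [hρ, ← Real.tanh_zero]
    exact strictMono_tanh (by linarith)
  have hρ1 : ρ < 1 := Real.tanh_lt_one _
  have him : ∀ w ∈ Metric.ball Complex.I ρ, 0 < w.im ∧ w.im < 2 := by
    intro w hw
    rw [Metric.mem_ball, dist_eq_norm] at hw
    have h1 := (Complex.abs_im_le_norm (w - Complex.I)).trans_lt (hw.trans hρ1)
    rw [Complex.sub_im, Complex.I_im, abs_lt] at h1
    constructor <;> linarith
  have hsub : Metric.ball Complex.I ρ ⊆ UpperHalfPlane.coe '' Metric.ball I r := by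
    intro w hw
    refine ⟨⟨w, (him w hw).1⟩, ?_, rfl⟩
    rw [Metric.mem_ball]
    have h1 : Real.tanh (dist (⟨w, (him w hw).1⟩ : ℍ) I / 2) < Real.tanh (r / 2) := by
      rw [tanh_half_dist, ← hρ, coe_I, Complex.conj_I, coe_mk]
      have h2 : 1 ≤ dist w (-Complex.I) := by
        have h3 := Complex.abs_im_le_norm (w - -Complex.I)
        rw [dist_eq_norm]
        refine le_trans ?_ h3
        simp only [Complex.sub_im, Complex.neg_im, Complex.I_im]
        rw [abs_of_pos] <;> linarith [(him w hw).1]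
      rw [Metric.mem_ball] at hw
      rw [div_lt_iff₀ (by linarith)]
      nlinarith
    have := strictMono_tanh.lt_iff_lt.1 h1
    linarith
  have hlow : ENNReal.ofReal (ρ ^ 2 / 2) ≤ volume (Metric.ball I r) := by
    rw [volume_eq_lintegral]
    calc ENNReal.ofReal (ρ ^ 2 / 2)
        ≤ ENNReal.ofReal (1 / 4) * volume (Metric.ball Complex.I ρ) := by
          rw [Complex.volume_ball, ← ENNReal.ofReal_pow hρ0.le]
          have h4 : (NNReal.pi : ENNReal) = ENNReal.ofReal Real.pi := by
            rw [← NNReal.coe_real_pi, ENNReal.ofReal_coe_nnreal]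
          rw [h4, ← ENNReal.ofReal_mul (by positivity), ← ENNReal.ofReal_mul (by positivity)]
          refine ENNReal.ofReal_le_ofReal ?_
          have := Real.pi_gt_three
          have h5 : 0 < ρ ^ 2 := by positivity
          nlinarith
      _ = ∫⁻ _ in Metric.ball Complex.I ρ, ENNReal.ofReal (1 / 4) := by
          rw [setLIntegral_const]
      _ ≤ ∫⁻ w in Metric.ball Complex.I ρ, ↑((1 / ‖w.im‖₊) ^ 2 : NNReal) := by
          refine setLIntegral_mono' Metric.isOpen_ball.measurableSet fun w hw => ?_
          rw [← ENNReal.ofReal_coe_nnreal]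
          refine ENNReal.ofReal_le_ofReal ?_
          have h6 := him w hw
          push_cast
          rw [Real.norm_of_nonneg h6.1.le, div_pow, one_pow]
          refine one_div_le_one_div_of_le (by nlinarith) (by nlinarith)
      _ ≤ _ := lintegral_mono_set hsub
  rw [Measure.real]
  exact (ENNReal.ofReal_le_iff_le_toReal (volume_ball_lt_top I r).ne).1 hlow

lemma volume_real_ball_pos (hr : 0 < r) : 0 < volume.real (Metric.ball I r) := by
  refine lt_of_lt_of_le ?_ (le_volume_ball hr)
  have : 0 < Real.tanh (r / 2) := by
    rw [← Real.tanh_zero]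
    exact strictMono_tanh (by linarith)
  positivity

/-- The factor in the mean value property is strictly decreasing in the eigenvalue. -/
lemma IsLaplaceEigen.integral_ball_lt (hu : IsLaplaceEigen u Λ) (hv : IsLaplaceEigen v Λ')
    (hΛ : 0 ≤ Λ) (hlt : Λ < Λ') (hr : IsMeanRadius Λ' s r) (hu1 : u I = 1) (hv1 : v I = 1) :
    ∫ w in Metric.ball I r, v w < ∫ w in Metric.ball I r, u w := by
  rw [← integral_ball_rotationMean hu.continuous, ← integral_ball_rotationMean hv.continuous,
    ← sub_pos]
  have hcu := continuous_rotationMean hu.continuous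
  have hcv := continuous_rotationMean hv.continuous
  rw [← integral_sub (integrableOn_ball hcu I r) (integrableOn_ball hcv I r)]
  have hpos : ∀ w ∈ Metric.ball I r, w ≠ I → 0 < rotationMean u w - rotationMean v w := by
    intro w hw hwI
    obtain ⟨y, hy, h1, h2⟩ := rotationMean_eq_circleMean (v := v) u hr hw hwI
    rw [h1, h2, sub_pos]
    exact hu.circleMean_lt hv hΛ hlt hu1 hv1 hr.quarter_le hr.small hy
  refine (setIntegral_pos_iff_support_of_nonneg_ae ?_
    (integrableOn_ball (hcu.sub hcv) I r)).2 ?_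
  · refine (ae_restrict_iff' Metric.isOpen_ball.measurableSet).2 (ae_of_all _ fun w hw => ?_)
    by_cases hwI : w = I
    · simp [hwI, rotationMean_I, hu1, hv1]
    · exact (hpos w hw hwI).le
  · have h1 : Metric.ball I r \ {I} ⊆
        Function.support (fun w => rotationMean u w - rotationMean v w) ∩ Metric.ball I r :=
      fun w hw => ⟨(hpos w hw.1 hw.2).ne', hw.1⟩
    refine lt_of_lt_of_le ?_ (measure_mono h1)
    rw [measure_sdiff_null volume_singleton_I]
    have := volume_real_ball_pos hr.pos
    exact (ENNReal.toReal_pos_iff.1 this).1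

/-- A nonzero eigenfunction can be normalized at `i` by a translation and a scaling. -/
lemma IsLaplaceEigen.exists_normalized (hu : IsLaplaceEigen u Λ) {z : ℍ} (hz : u z ≠ 0) :
    ∃ v : ℍ → ℝ, IsLaplaceEigen v Λ ∧ v I = 1 := by
  refine ⟨fun w => (u z)⁻¹ * u (z.toSL2R • w), (hu.comp_smul _).const_mul _, ?_⟩
  simp only [toSL2R_smul_I]
  exact inv_mul_cancel₀ hz

/-- For every bound `L` of the eigenvalues there is a radius for which the mean value property
holds and whose disc has area at least of the order of `1 / L`. -/
lemma exists_isMeanRadius {L : ℝ} (hL : 0 ≤ L) :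
    ∃ s r : ℝ, (∀ Λ, Λ ≤ L → IsMeanRadius Λ s r) ∧ r ≤ 2 ∧
      1 / (64 * (1 + L)) ≤ volume.real (Metric.ball I r) := by
  have hpi := Real.pi_gt_three
  set s := Real.log (32 * (1 + L)) / (4 * Real.pi) with hs
  have hexp : Real.exp (-4 * Real.pi * s) = 1 / (32 * (1 + L)) := by
    rw [hs, show -4 * Real.pi * (Real.log (32 * (1 + L)) / (4 * Real.pi)) =
      -Real.log (32 * (1 + L)) by field_simp, Real.exp_neg, Real.exp_log (by linarith), one_div]
  have hs4 : 1 / 4 ≤ s := by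
    rw [hs, le_div_iff₀ (by positivity), Real.le_log_iff_exp_le (by linarith)]
    have h1 : Real.exp Real.pi < 32 := by
      have h2 : Real.pi < 3.2 := by linarith [Real.pi_lt_d2]
      have h3 := Real.exp_one_lt_d9
      calc Real.exp Real.pi < Real.exp (3.2 : ℝ) := Real.exp_lt_exp.2 h2
        _ = (Real.exp 1 ^ 16) ^ (1 / 5 : ℝ) := by
            rw [← Real.exp_nat_mul, ← Real.exp_mul]; norm_num
        _ ≤ ((2.7182818286 : ℝ) ^ 16) ^ (1 / 5 : ℝ) := by gcongr
        _ ≤ ((32 : ℝ) ^ 5) ^ (1 / 5 : ℝ) := by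
            refine Real.rpow_le_rpow (by norm_num) (by norm_num) (by norm_num)
        _ = 32 := by
            rw [← Real.rpow_natCast, ← Real.rpow_mul (by norm_num)]; norm_num
    rw [show 1 / 4 * (4 * Real.pi) = Real.pi by ring]
    linarith
  obtain ⟨r, hr0, hr⟩ := exists_radius (s := s) (by linarith)
  have hsq : Real.tanh (r / 2) ^ 2 = 1 / (32 * (1 + L)) := by
    rw [hr, ← Real.exp_nat_mul, ← hexp]; congr 1; push_cast; ring
  refine ⟨s, r, fun Λ hΛ => ⟨hs4, ?_, hr0, hr⟩, ?_, ?_⟩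
  · rw [hexp, mul_one_div, div_le_iff₀ (by linarith)]
    linarith
  · by_contra hcon
    push Not at hcon
    have h1 : Real.tanh 1 < Real.tanh (r / 2) := strictMono_tanh (by linarith)
    have h2 : (1 / 2 : ℝ) ≤ Real.tanh 1 := by
      rw [Real.tanh_eq_sinh_div_cosh, le_div_iff₀ (Real.cosh_pos _), Real.cosh_eq, Real.sinh_eq]
      have h3 := Real.exp_one_gt_d9
      have h4 : Real.exp (-1) * Real.exp 1 = 1 := by rw [← Real.exp_add]; simp
      have h5 := Real.exp_pos (-1)
      nlinarith
    have h6 : 1 / (32 * (1 + L)) ≤ 1 / 32 := one_div_le_one_div_of_le (by norm_num) (by linarith)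
    nlinarith
  · refine le_trans (le_of_eq ?_) (le_volume_ball hr0)
    rw [hsq]
    field_simp
    norm_num

end

section

/-! ### Unfolding over a fundamental domain -/

/-- The group of isometries of `ℍ` induced by `Γ`. -/
abbrev isometryGroup (Γ : Subgroup SL(2, ℝ)) : Subgroup (Equiv.Perm ℍ) :=
  (MulAction.toPermHom Γ ℍ).range

variable {Γ : Subgroup SL(2, ℝ)}

lemma exists_smul_eq_of_isometryGroup (g : isometryGroup Γ) :
    ∃ γ : SL(2, ℝ), γ ∈ Γ ∧ ∀ z : ℍ, g • z = γ • z := by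
  obtain ⟨g, γ, rfl⟩ := g
  exact ⟨γ, γ.2, fun z => rfl⟩

instance : MeasurableConstSMul (isometryGroup Γ) ℍ where
  measurable_const_smul g := by
    obtain ⟨γ, -, hγ⟩ := exists_smul_eq_of_isometryGroup g
    have : (fun z : ℍ => g • z) = fun z => γ • z := funext hγ
    change Measurable (fun z : ℍ => g • z)
    rw [this]
    exact (measurableEmbedding_SL_smul γ).measurable

instance : SMulInvariantMeasure (isometryGroup Γ) ℍ volume where
  measure_preimage_smul g s hs := by
    obtain ⟨γ, -, hγ⟩ := exists_smul_eq_of_isometryGroup g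
    have : (fun z : ℍ => g • z) = fun z => γ • z := funext hγ
    rw [this]
    exact (measurePreserving_SL_smul γ).measure_preimage hs.nullMeasurableSet

lemma countable_isometryGroup (hΓ : DiscreteTopology Γ) : Countable (isometryGroup Γ) := by
  have : SecondCountableTopology (Matrix (Fin 2) (Fin 2) ℝ) :=
    inferInstanceAs (SecondCountableTopology (Fin 2 → Fin 2 → ℝ))
  have : SecondCountableTopology SL(2, ℝ) :=
    Topology.IsEmbedding.subtypeVal.secondCountableTopology
  have : Countable Γ := TopologicalSpace.separableSpace_iff_countable.1 inferInstance
  exact (MulAction.toPermHom Γ ℍ).rangeRestrict_surjective.countable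

/-- A function on `ℍ` invariant under `Γ`. -/
def IsInvariant {β : Type*} (Γ : Subgroup SL(2, ℝ)) (f : ℍ → β) : Prop :=
  ∀ γ ∈ Γ, ∀ z : ℍ, f (γ • z) = f z

lemma isInvariant_pullback (φ : Surface Γ → ℝ) : IsInvariant Γ (pullback φ) := by
  intro γ hγ z
  unfold pullback proj
  congr 1
  exact Quotient.sound ⟨⟨γ, hγ⟩, rfl⟩

/-- The tiles of a fundamental domain cover a compact set a bounded number of times. -/
lemma exists_setLIntegral_le (hΓ : DiscreteTopology Γ) {F : Set ℍ} (hF : IsFundDomain Γ F)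
    {K : Set ℍ} (hK : IsCompact K) : ∃ N : ℕ, ∀ W : ℍ → ENNReal, Measurable W →
      IsInvariant Γ W → ∫⁻ z in K, W z ≤ N * ∫⁻ z in F, W z := by
  have := countable_isometryGroup hΓ
  have hfin : {g : isometryGroup Γ | ∃ z ∈ K, g • z ∈ K}.Finite := by
    have h1 := finite_disjoint_inter_image (Γ := Γ) hK hK
    refine (h1.image (MulAction.toPermHom Γ ℍ).rangeRestrict).subset ?_
    rintro ⟨g, γ, rfl⟩ ⟨z, hz, hz2⟩
    refine ⟨γ, ?_, rfl⟩
    exact ⟨_, Set.mem_image_of_mem _ hz, hz2⟩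
  classical
  refine ⟨hfin.toFinset.card, fun W hW hinv => ?_⟩
  have hinv' : ∀ (g : isometryGroup Γ) (z : ℍ), W (g • z) = W z := fun g z => by
    obtain ⟨γ, hγ, h⟩ := exists_smul_eq_of_isometryGroup g
    rw [h, hinv γ hγ]
  rw [← lintegral_indicator hK.measurableSet, hF.lintegral_eq_tsum'']
  have hmeas : ∀ g : isometryGroup Γ, Measurable fun z : ℍ => K.indicator W (g • z) := fun g =>
    (hW.indicator hK.measurableSet).comp (measurable_const_smul g)
  rw [← lintegral_tsum fun g => (hmeas g).aemeasurable,
    ← lintegral_const_mul _ hW]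
  refine lintegral_mono fun z => ?_
  by_cases hex : ∃ g : isometryGroup Γ, g • z ∈ K
  · obtain ⟨g0, hg0⟩ := hex
    rw [tsum_eq_sum (s := hfin.toFinset.image (fun g : isometryGroup Γ => g * g0))]
    · calc ∑ g ∈ hfin.toFinset.image (fun g : isometryGroup Γ => g * g0), K.indicator W (g • z)
          ≤ ∑ g ∈ hfin.toFinset.image (fun g : isometryGroup Γ => g * g0), W z := by
            refine Finset.sum_le_sum fun g _ => ?_
            refine (Set.indicator_le_self _ _ _).trans (hinv' g z).le
        _ ≤ hfin.toFinset.card * W z := by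
            rw [Finset.sum_const, nsmul_eq_mul]
            refine mul_le_mul_left (Nat.cast_le.2 ?_) _
            exact Finset.card_image_le (s := hfin.toFinset)
              (f := fun g : isometryGroup Γ => g * g0)
    · intro g hg
      refine Set.indicator_of_notMem (fun hmem => hg ?_) _
      rw [Finset.mem_image]
      refine ⟨g * g0⁻¹, ?_, by simp⟩
      rw [Set.Finite.mem_toFinset]
      exact ⟨g0 • z, hg0, by rw [smul_smul]; simpa using hmem⟩
  · push Not at hex
    have : ∀ g : isometryGroup Γ, K.indicator W (g • z) = 0 := fun g =>
      Set.indicator_of_notMem (hex g) _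
    simp [this]

/-- Unfolding: a kernel invariant under the diagonal action can be integrated over `F × ℍ` or over
`ℍ × F`. -/
lemma lintegral_lintegral_unfold (hΓ : DiscreteTopology Γ) {F : Set ℍ} (hF : IsFundDomain Γ F)
    {Φ : ℍ → ℍ → ENNReal} (hm : Measurable (Function.uncurry Φ))
    (hinv : ∀ γ ∈ Γ, ∀ z w : ℍ, Φ (γ • z) (γ • w) = Φ z w) :
    ∫⁻ z in F, ∫⁻ w, Φ z w = ∫⁻ z in F, ∫⁻ w, Φ w z := by
  have := countable_isometryGroup hΓ
  have hinv' : ∀ (g : isometryGroup Γ) (z w : ℍ), Φ (g • z) w = Φ z (g⁻¹ • w) := fun g z w => by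
    obtain ⟨γ, hγ, h⟩ := exists_smul_eq_of_isometryGroup g
    have h2 : w = γ • (g⁻¹ • w) := by rw [← h, smul_inv_smul]
    conv_lhs => rw [h, h2]
    exact hinv γ hγ _ _
  have hm1 : ∀ g : isometryGroup Γ, Measurable (Function.uncurry fun z w => Φ z (g⁻¹ • w)) :=
    fun g => hm.comp (measurable_fst.prodMk ((measurable_const_smul g⁻¹).comp measurable_snd))
  have hL : ∫⁻ z in F, ∫⁻ w, Φ z w =
      ∑' g : isometryGroup Γ, ∫⁻ z in F, ∫⁻ w in F, Φ z (g⁻¹ • w) := by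
    rw [← lintegral_tsum (f := fun g z => ∫⁻ w in F, Φ z (g⁻¹ • w))
      fun g => (hm1 g).lintegral_prod_right'.aemeasurable]
    refine lintegral_congr fun z => ?_
    exact hF.lintegral_eq_tsum' _
  have hR : ∫⁻ z in F, ∫⁻ w, Φ w z =
      ∑' g : isometryGroup Γ, ∫⁻ z in F, ∫⁻ w in F, Φ w (g⁻¹ • z) := by
    have hm2 : ∀ g : isometryGroup Γ, Measurable (Function.uncurry fun z w => Φ w (g⁻¹ • z)) :=
      fun g => (hm1 g).comp measurable_swap
    rw [← lintegral_tsum (f := fun g z => ∫⁻ w in F, Φ w (g⁻¹ • z))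
      fun g => (hm2 g).lintegral_prod_right'.aemeasurable]
    refine lintegral_congr fun z => ?_
    rw [hF.lintegral_eq_tsum'']
    simp_rw [hinv']
  rw [hL, hR]
  congr 1
  funext g
  exact lintegral_lintegral_swap (hm1 g).aemeasurable

/-- Real-valued version of `lintegral_lintegral_unfold`. -/
lemma integral_integral_unfold (hΓ : DiscreteTopology Γ) {F : Set ℍ} (hF : IsFundDomain Γ F)
    {Φ : ℍ → ℍ → ℝ} (hm : Measurable (Function.uncurry Φ))
    (hinv : ∀ γ ∈ Γ, ∀ z w : ℍ, Φ (γ • z) (γ • w) = Φ z w)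
    (hfin : ∫⁻ z in F, ∫⁻ w, ‖Φ z w‖ₑ ≠ ⊤) :
    ∫ z in F, ∫ w, Φ z w = ∫ z in F, ∫ w, Φ w z := by
  have hm' : Measurable (Function.uncurry fun z w => Φ w z) := hm.comp measurable_swap
  have hi1 : Integrable (Function.uncurry Φ) ((volume.restrict F).prod volume) := by
    refine ⟨hm.aestronglyMeasurable, ?_⟩
    rw [HasFiniteIntegral, lintegral_prod _ hm.enorm.aemeasurable]
    exact hfin.lt_top
  have hi2 : Integrable (Function.uncurry fun z w => Φ w z) ((volume.restrict F).prod volume) := by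
    refine ⟨hm'.aestronglyMeasurable, ?_⟩
    rw [HasFiniteIntegral, lintegral_prod _ hm'.enorm.aemeasurable]
    have := lintegral_lintegral_unfold hΓ hF (Φ := fun z w => ‖Φ z w‖ₑ) hm.enorm
      (fun γ hγ z w => by rw [hinv γ hγ])
    exact (this ▸ hfin).lt_top
  have e1 : ∫ z in F, ∫ w, Φ z w = ∫ p, Function.uncurry Φ p ∂((volume.restrict F).prod volume) :=
    (integral_prod _ hi1).symm
  have e2 : ∫ z in F, ∫ w, Φ w z =
      ∫ p, Function.uncurry (fun z w => Φ w z) p ∂((volume.restrict F).prod volume) :=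
    (integral_prod _ hi2).symm
  rw [e1, e2, integral_eq_lintegral_pos_part_sub_lintegral_neg_part hi1,
    integral_eq_lintegral_pos_part_sub_lintegral_neg_part hi2,
    lintegral_prod _ hm.ennreal_ofReal.aemeasurable,
    lintegral_prod (fun p => ENNReal.ofReal (-Function.uncurry Φ p))
      hm.neg.ennreal_ofReal.aemeasurable,
    lintegral_prod _ hm'.ennreal_ofReal.aemeasurable,
    lintegral_prod (fun p => ENNReal.ofReal (-Function.uncurry (fun z w => Φ w z) p))
      hm'.neg.ennreal_ofReal.aemeasurable]
  have h1 := lintegral_lintegral_unfold hΓ hF (Φ := fun z w => ENNReal.ofReal (Φ z w))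
    hm.ennreal_ofReal (fun γ hγ z w => by rw [hinv γ hγ])
  have h2 := lintegral_lintegral_unfold hΓ hF (Φ := fun z w => ENNReal.ofReal (-Φ z w))
    hm.neg.ennreal_ofReal (fun γ hγ z w => by rw [hinv γ hγ])
  simp only [Function.uncurry_apply_pair]
  rw [h1, h2]

end

section

/-! ### Sup bounds, orthogonality and Bessel's inequality -/

/-- The lift to `ℍ` of a normalized eigenfunction on `Γ \ ℍ`. -/
structure IsUnitEigen (Γ : Subgroup SL(2, ℝ)) (F : Set ℍ) (u : ℍ → ℝ) (Λ : ℝ) : Prop where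
  isLaplaceEigen : IsLaplaceEigen u Λ
  isInvariant : IsInvariant Γ u
  lintegral_sq : ∫⁻ z in F, ‖u z‖ₑ ^ 2 = 1

variable {Γ : Subgroup SL(2, ℝ)} {F : Set ℍ} {u v : ℍ → ℝ} {Λ Λ' s r : ℝ}

lemma IsEigenfunction.isUnitEigen {φ : Surface Γ → ℝ} {τ : ℝ} (h : IsEigenfunction φ τ)
    (hφ : l2Norm F φ = 1) : IsUnitEigen Γ F (pullback φ) (1 / 4 + τ ^ 2) := by
  refine ⟨h.isLaplaceEigen, isInvariant_pullback φ, ?_⟩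
  have h1 := eLpNorm_nnreal_pow_eq_lintegral (f := pullback φ) (μ := volume.restrict F)
    (p := 2) two_ne_zero
  have h2 : eLpNorm (pullback φ) ((2 : NNReal) : ENNReal) (volume.restrict F) = 1 := by
    simpa [l2Norm] using hφ
  rw [h2] at h1
  simpa using h1.symm

lemma IsUnitEigen.continuous (h : IsUnitEigen Γ F u Λ) : Continuous u :=
  h.isLaplaceEigen.continuous

lemma IsUnitEigen.memLp (h : IsUnitEigen Γ F u Λ) : MemLp u 2 (volume.restrict F) := by
  refine ⟨h.continuous.aestronglyMeasurable, ?_⟩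
  have h1 := eLpNorm_nnreal_pow_eq_lintegral (f := u) (μ := volume.restrict F)
    (p := 2) two_ne_zero
  have h2 : eLpNorm u ((2 : NNReal) : ENNReal) (volume.restrict F) ^ ((2 : NNReal) : ℝ) = 1 := by
    rw [h1]
    simpa using h.lintegral_sq
  by_contra hcon
  have h3 : eLpNorm u ((2 : NNReal) : ENNReal) (volume.restrict F) = ⊤ := by
    simpa using hcon
  rw [h3] at h2
  simp at h2

lemma enorm_sq_eq_ofReal (x : ℝ) : ‖x‖ₑ ^ 2 = ENNReal.ofReal (x ^ 2) := by
  rw [Real.enorm_eq_ofReal_abs, ← ENNReal.ofReal_pow (abs_nonneg _), sq_abs]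

lemma IsUnitEigen.integral_sq (h : IsUnitEigen Γ F u Λ) : ∫ z in F, u z * u z = 1 := by
  have h1 := h.lintegral_sq
  simp_rw [enorm_sq_eq_ofReal] at h1
  rw [integral_eq_lintegral_of_nonneg_ae (ae_of_all _ fun z => mul_self_nonneg (u z))
    (h.continuous.mul h.continuous).aestronglyMeasurable]
  simp_rw [← sq, h1]
  simp

lemma IsUnitEigen.exists_ne_zero (h : IsUnitEigen Γ F u Λ) : ∃ z, u z ≠ 0 := by
  by_contra hcon
  push Not at hcon
  have h1 := h.lintegral_sq
  simp [hcon] at h1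

/-- The Cauchy–Schwarz inequality on a ball, the square being integrated over `F`. -/
lemma sq_setIntegral_ball_le {K : Set ℍ} {N : ℕ}
    (hN : ∀ W : ℍ → ENNReal, Measurable W → IsInvariant Γ W →
      ∫⁻ z in K, W z ≤ N * ∫⁻ z in F, W z)
    {f : ℍ → ℝ} (hf : Continuous f) (hinv : IsInvariant Γ f) {M : ℝ} (hM : 0 ≤ M)
    (hfM : ∫⁻ z in F, ENNReal.ofReal (f z ^ 2) ≤ ENNReal.ofReal M) {z : ℍ} (hr : 0 < r)
    (hball : Metric.ball z r ⊆ K) :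
    (∫ w in Metric.ball z r, f w) ^ 2 ≤ volume.real (Metric.ball I r) * (N * M) := by
  have hvol : volume.real (Metric.ball z r) = volume.real (Metric.ball I r) := by
    rw [← toSL2R_smul_I z, Measure.real, volume_ball_smul]; rfl
  have hV := volume_real_ball_pos hr
  set V := volume.real (Metric.ball I r)
  have hsq : ∫ w in Metric.ball z r, f w ^ 2 ≤ N * M := by
    rw [integral_eq_lintegral_of_nonneg_ae (ae_of_all _ fun z => sq_nonneg (f z))
      (hf.pow 2).aestronglyMeasurable]
    refine ENNReal.toReal_le_of_le_ofReal (by positivity) ?_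
    calc ∫⁻ w in Metric.ball z r, ENNReal.ofReal (f w ^ 2)
        ≤ ∫⁻ w in K, ENNReal.ofReal (f w ^ 2) := lintegral_mono_set hball
      _ ≤ N * ∫⁻ w in F, ENNReal.ofReal (f w ^ 2) :=
          hN _ (hf.pow 2).measurable.ennreal_ofReal (fun γ hγ z => by rw [hinv γ hγ])
      _ ≤ N * ENNReal.ofReal M := by gcongr
      _ = ENNReal.ofReal (N * M) := by
          rw [ENNReal.ofReal_mul (by positivity), ENNReal.ofReal_natCast]
  set J := ∫ w in Metric.ball z r, f w with hJ
  have hi := integrableOn_ball hf z r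
  have hi2 : IntegrableOn (fun w => f w ^ 2) (Metric.ball z r) :=
    integrableOn_ball (hf.pow 2) z r
  have hic : ∀ c : ℝ, IntegrableOn (fun _ : ℍ => c) (Metric.ball z r) := fun c =>
    integrableOn_const (volume_ball_lt_top z r).ne
  have hvar : 0 ≤ ∫ w in Metric.ball z r, (f w - J / V) ^ 2 :=
    integral_nonneg fun w => sq_nonneg _
  have hexp : ∀ w, (f w - J / V) ^ 2 = f w ^ 2 - 2 * (J / V) * f w + (J / V) ^ 2 := fun w => by
    ring
  simp_rw [hexp] at hvar
  have hi3 : Integrable (fun w => f w ^ 2 - 2 * (J / V) * f w)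
      (volume.restrict (Metric.ball z r)) := hi2.sub (hi.const_mul _)
  rw [integral_add hi3 (hic _), integral_sub hi2 (hi.const_mul _), integral_const_mul,
    setIntegral_const, hvol, smul_eq_mul, ← hJ] at hvar
  have h1 : V * (J / V) ^ 2 = J ^ 2 / V := by field_simp
  have h2 : 2 * (J / V) * J = 2 * (J ^ 2 / V) := by ring
  have h3 : J ^ 2 / V ≤ N * M := by linarith
  rw [div_le_iff₀ hV] at h3
  linarith

/-- The averaging operator over discs of radius `r` multiplies `u` by a factor `H`. -/
lemma IsUnitEigen.exists_multiplier (h : IsUnitEigen Γ F u Λ) (hΛ : 0 ≤ Λ)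
    (hr : IsMeanRadius Λ s r) : ∃ H : ℝ, 2 / 3 * volume.real (Metric.ball I r) ≤ H ∧
      ∀ z, ∫ w in Metric.ball z r, u w = H * u z := by
  obtain ⟨z, hz⟩ := h.exists_ne_zero
  obtain ⟨v, hv, hv1⟩ := h.isLaplaceEigen.exists_normalized hz
  exact ⟨_, hv.le_integral_ball hΛ hr hv1, h.isLaplaceEigen.integral_ball_eq hv hΛ hr hv1⟩

lemma IsUnitEigen.multiplier_lt (hu : IsUnitEigen Γ F u Λ) (hv : IsUnitEigen Γ F v Λ')
    (hΛ : 0 ≤ Λ) (hlt : Λ < Λ') (hr : IsMeanRadius Λ s r) (hr' : IsMeanRadius Λ' s r) {H H' : ℝ}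
    (hH : ∀ z, ∫ w in Metric.ball z r, u w = H * u z)
    (hH' : ∀ z, ∫ w in Metric.ball z r, v w = H' * v z) : H' < H := by
  obtain ⟨z, hz⟩ := hu.exists_ne_zero
  obtain ⟨z', hz'⟩ := hv.exists_ne_zero
  obtain ⟨u1, hu1, hu1I⟩ := hu.isLaplaceEigen.exists_normalized hz
  obtain ⟨v1, hv1, hv1I⟩ := hv.isLaplaceEigen.exists_normalized hz'
  have h1 := hu.isLaplaceEigen.integral_ball_eq hu1 hΛ hr hu1I z
  have h2 := hv.isLaplaceEigen.integral_ball_eq hv1 (hΛ.trans hlt.le) hr' hv1I z'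
  rw [hH] at h1
  rw [hH'] at h2
  rw [mul_right_cancel₀ hz h1, mul_right_cancel₀ hz' h2]
  exact hu1.integral_ball_lt hv1 hΛ hlt hr' hu1I hv1I

/-- Eigenfunctions are at most of exponential size in the spectral parameter on compact sets. -/
lemma exists_abs_le_exp (hΓ : DiscreteTopology Γ) (hF : IsFundDomain Γ F) {K : Set ℍ}
    (hK : IsCompact K) : ∃ A : ℝ, 0 < A ∧ ∀ (u : ℍ → ℝ) (τ : ℝ), 0 < τ →
      IsUnitEigen Γ F u (1 / 4 + τ ^ 2) → ∀ z ∈ K, |u z| ≤ A * Real.exp τ := by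
  obtain ⟨N, hN⟩ := exists_setLIntegral_le hΓ hF (hK.cthickening (r := 2))
  refine ⟨Real.sqrt (288 * N) + 1, by positivity, fun u τ hτ hu z hz => ?_⟩
  set Λ := 1 / 4 + τ ^ 2 with hΛ
  have hΛ0 : 0 ≤ Λ := by positivity
  obtain ⟨s, r, hr, hr2, hvol⟩ := exists_isMeanRadius hΛ0
  have hr' := hr Λ le_rfl
  obtain ⟨H, hH, hHu⟩ := hu.exists_multiplier hΛ0 hr'
  have hV := volume_real_ball_pos hr'.pos
  have h1 := sq_setIntegral_ball_le hN hu.continuous hu.isInvariant zero_le_one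
    (by simpa [enorm_sq_eq_ofReal] using hu.lintegral_sq.le) hr'.pos (z := z)
    ((Metric.ball_subset_ball hr2).trans (Metric.ball_subset_closedBall.trans
      (Metric.closedBall_subset_cthickening hz 2)))
  rw [hHu, mul_one] at h1
  set V := volume.real (Metric.ball I r)
  have h2 : (2 / 3 * V) ^ 2 * u z ^ 2 ≤ V * N := by
    refine le_trans ?_ h1
    rw [mul_pow H]
    exact mul_le_mul_of_nonneg_right (pow_le_pow_left₀ (by positivity) hH 2) (sq_nonneg _)
  have h3 : V * u z ^ 2 ≤ 9 / 4 * N := by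
    have : V * (V * u z ^ 2) ≤ V * (9 / 4 * N) := by nlinarith
    exact le_of_mul_le_mul_left this hV
  have h4 : u z ^ 2 ≤ 144 * N * (1 + Λ) := by
    have h5 : 1 / (64 * (1 + Λ)) * u z ^ 2 ≤ 9 / 4 * N :=
      (mul_le_mul_of_nonneg_right hvol (sq_nonneg _)).trans h3
    rw [one_div, inv_mul_le_iff₀ (by positivity)] at h5
    linarith
  have h6 : 1 + Λ ≤ 2 * Real.exp τ ^ 2 := by
    have h7 := Real.quadratic_le_exp_of_nonneg hτ.le
    have h8 : 1 + τ ≤ Real.exp τ := by nlinarith [sq_nonneg τ]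
    rw [hΛ]
    nlinarith [sq_nonneg τ]
  have h9 : u z ^ 2 ≤ (Real.sqrt (288 * N) * Real.exp τ) ^ 2 := by
    rw [mul_pow, Real.sq_sqrt (by positivity)]
    calc u z ^ 2 ≤ 144 * N * (1 + Λ) := h4
      _ ≤ 144 * N * (2 * Real.exp τ ^ 2) := by gcongr
      _ = _ := by ring
  have h10 := abs_le_of_sq_le_sq h9 (by positivity)
  exact h10.trans (mul_le_mul_of_nonneg_right (by linarith) (Real.exp_pos τ).le)

/-- The kernel `(z, w) ↦ v z * u w` on pairs at distance less than `r` is absolutely integrable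
because `|u v| ≤ u² + v²`. -/
lemma lintegral_ball_enorm_mul_ne_top (hΓ : DiscreteTopology Γ) (hF : IsFundDomain Γ F)
    (hu : IsUnitEigen Γ F u Λ) (hv : IsUnitEigen Γ F v Λ') (r : ℝ) :
    ∫⁻ z in F, ∫⁻ w in Metric.ball z r, ‖v z * u w‖ₑ ≠ ⊤ := by
  have hB : MeasurableSet {p : ℍ × ℍ | dist p.1 p.2 < r} :=
    (isOpen_lt continuous_dist continuous_const).measurableSet
  have hvolz : ∀ z : ℍ, volume (Metric.ball z r) = volume (Metric.ball I r) := fun z => by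
    conv_lhs => rw [← toSL2R_smul_I z]
    exact volume_ball_smul _ _ _
  set P : ℍ × ℍ → ENNReal := {p : ℍ × ℍ | dist p.1 p.2 < r}.indicator
      (fun p => ‖u p.2‖ₑ ^ 2) with hP
  have hPm : Measurable P := Measurable.indicator
    ((hu.continuous.measurable.comp measurable_snd).enorm.pow_const 2) hB
  have hPinv : ∀ γ ∈ Γ, ∀ z w : ℍ, P (γ • z, γ • w) = P (z, w) := by
    intro γ hγ z w
    simp only [hP, Set.indicator, Set.mem_ofPred_eq, dist_smul, hu.isInvariant γ hγ]
  have hPswap := lintegral_lintegral_unfold (Φ := fun z w => P (z, w)) hΓ hF hPm hPinv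
  have hP1 : ∀ z w, P (z, w) = (Metric.ball z r).indicator (fun w => ‖u w‖ₑ ^ 2) w := by
    intro z w
    simp only [hP, Set.indicator, Set.mem_ofPred_eq, Metric.mem_ball, dist_comm w z]
  have hP2 : ∀ z w, P (w, z) = (Metric.ball z r).indicator (fun _ => ‖u z‖ₑ ^ 2) w := by
    intro z w
    simp only [hP, Set.indicator, Set.mem_ofPred_eq, Metric.mem_ball]
  have hl : ∀ z, ∫⁻ w, P (z, w) = ∫⁻ w in Metric.ball z r, ‖u w‖ₑ ^ 2 := fun z => by
    simp_rw [hP1, lintegral_indicator Metric.isOpen_ball.measurableSet]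
  rw [lintegral_congr hl] at hPswap
  simp_rw [hP2, lintegral_indicator Metric.isOpen_ball.measurableSet, setLIntegral_const,
    hvolz] at hPswap
  rw [lintegral_mul_const _ (hu.continuous.measurable.enorm.pow_const 2), hu.lintegral_sq,
    one_mul] at hPswap
  have hle : ∀ z w, ‖v z * u w‖ₑ ≤ ‖u w‖ₑ ^ 2 + ‖v z‖ₑ ^ 2 := by
    intro z w
    rw [enorm_sq_eq_ofReal, enorm_sq_eq_ofReal, ← ENNReal.ofReal_add (sq_nonneg _) (sq_nonneg _),
      Real.enorm_eq_ofReal_abs]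
    refine ENNReal.ofReal_le_ofReal ?_
    rw [abs_mul, ← sq_abs (u w), ← sq_abs (v z)]
    nlinarith [sq_nonneg (|u w| - |v z|), sq_nonneg |u w|, sq_nonneg |v z|]
  refine ne_top_of_le_ne_top ?_ (lintegral_mono fun z => lintegral_mono fun w => hle z w)
  have h3 : ∀ z, ∫⁻ w in Metric.ball z r, (‖u w‖ₑ ^ 2 + ‖v z‖ₑ ^ 2) =
      (∫⁻ w in Metric.ball z r, ‖u w‖ₑ ^ 2) + ‖v z‖ₑ ^ 2 * volume (Metric.ball I r) := fun z => by
    rw [lintegral_add_right _ measurable_const, setLIntegral_const, hvolz]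
  simp_rw [h3]
  rw [lintegral_add_right _ ((hv.continuous.measurable.enorm.pow_const 2).mul_const _), hPswap,
    lintegral_mul_const _ (hv.continuous.measurable.enorm.pow_const 2), hv.lintegral_sq, one_mul]
  exact (ENNReal.add_lt_top.2 ⟨volume_ball_lt_top _ _, volume_ball_lt_top _ _⟩).ne

/-- Eigenfunctions of different small eigenvalues are orthogonal: they are eigenfunctions, with
different factors, of the averaging operator over discs, which unfolding shows to be symmetric. -/
lemma IsUnitEigen.integral_mul_eq_zero (hΓ : DiscreteTopology Γ) (hF : IsFundDomain Γ F)
    (hu : IsUnitEigen Γ F u Λ) (hv : IsUnitEigen Γ F v Λ') (hΛ : 0 ≤ Λ) (hlt : Λ < Λ')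
    (hr : IsMeanRadius Λ s r) (hr' : IsMeanRadius Λ' s r) : ∫ z in F, u z * v z = 0 := by
  obtain ⟨H, -, hH⟩ := hu.exists_multiplier hΛ hr
  obtain ⟨H', -, hH'⟩ := hv.exists_multiplier (hΛ.trans hlt.le) hr'
  have hne := (hu.multiplier_lt hv hΛ hlt hr hr' hH hH').ne'
  have hB : MeasurableSet {p : ℍ × ℍ | dist p.1 p.2 < r} :=
    (isOpen_lt continuous_dist continuous_const).measurableSet
  set Φ : ℍ → ℍ → ℝ := fun z w => {p : ℍ × ℍ | dist p.1 p.2 < r}.indicator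
    (fun p => u p.2 * v p.1) (z, w) with hΦ
  have hm : Measurable (Function.uncurry Φ) := by
    have : Function.uncurry Φ = {p : ℍ × ℍ | dist p.1 p.2 < r}.indicator
      (fun p => u p.2 * v p.1) := rfl
    rw [this]
    exact Measurable.indicator ((hu.continuous.measurable.comp measurable_snd).mul
      (hv.continuous.measurable.comp measurable_fst)) hB
  have hinv : ∀ γ ∈ Γ, ∀ z w : ℍ, Φ (γ • z) (γ • w) = Φ z w := by
    intro γ hγ z w
    simp only [hΦ, Set.indicator, Set.mem_ofPred_eq, dist_smul, hu.isInvariant γ hγ,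
      hv.isInvariant γ hγ]
  have hslice1 : ∀ z w, Φ z w = (Metric.ball z r).indicator (fun w => v z * u w) w := by
    intro z w
    simp only [hΦ, Set.indicator, Set.mem_ofPred_eq, Metric.mem_ball, dist_comm w z, mul_comm]
  have hslice2 : ∀ z w, Φ w z = (Metric.ball z r).indicator (fun w => u z * v w) w := by
    intro z w
    simp only [hΦ, Set.indicator, Set.mem_ofPred_eq, Metric.mem_ball]
  have hfin : ∫⁻ z in F, ∫⁻ w, ‖Φ z w‖ₑ ≠ ⊤ := by
    have hslice : ∀ z, ∫⁻ w, ‖Φ z w‖ₑ = ∫⁻ w in Metric.ball z r, ‖v z * u w‖ₑ := fun z => by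
      rw [← lintegral_indicator Metric.isOpen_ball.measurableSet]
      refine lintegral_congr fun w => ?_
      rw [hslice1, enorm_indicator_eq_indicator_enorm]
    simp_rw [hslice]
    exact lintegral_ball_enorm_mul_ne_top hΓ hF hu hv r
  have key := integral_integral_unfold hΓ hF hm hinv hfin
  have hl : ∀ z, ∫ w, Φ z w = v z * (H * u z) := fun z => by
    simp_rw [hslice1, integral_indicator Metric.isOpen_ball.measurableSet, integral_const_mul, hH]
  have hr : ∀ z, ∫ w, Φ w z = u z * (H' * v z) := fun z => by
    simp_rw [hslice2, integral_indicator Metric.isOpen_ball.measurableSet, integral_const_mul, hH']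
  simp_rw [hl, hr] at key
  have e1 : ∀ z, v z * (H * u z) = H * (u z * v z) := fun z => by ring
  have e2 : ∀ z, u z * (H' * v z) = H' * (u z * v z) := fun z => by ring
  simp_rw [e1, e2, integral_const_mul] at key
  have h0 : (H - H') * ∫ z in F, u z * v z = 0 := by linarith
  exact (mul_eq_zero.1 h0).resolve_left (sub_ne_zero.2 hne)

/-- Bessel's inequality for the functions `w ↦ 1_{d(z, w) < r}`: only finitely many normalized
eigenfunctions of bounded eigenvalue can be large at a given place. -/
lemma exists_sum_sq_le (hΓ : DiscreteTopology Γ) (hF : IsFundDomain Γ F) {K : Set ℍ}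
    (hK : IsCompact K) : ∃ C : ℝ, ∀ (t : Finset ℝ) (u : ℝ → ℍ → ℝ),
      (∀ τ ∈ t, 0 < τ ∧ τ < 1 ∧ IsUnitEigen Γ F (u τ) (1 / 4 + τ ^ 2)) →
        ∀ z ∈ K, ∑ τ ∈ t, u τ z ^ 2 ≤ C := by
  obtain ⟨N, hN⟩ := exists_setLIntegral_le hΓ hF (hK.cthickening (r := 2))
  obtain ⟨s, r, hr, hr2, -⟩ := exists_isMeanRadius (L := 5 / 4) (by norm_num)
  have hrpos : 0 < r := (hr 0 (by norm_num)).pos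
  have hV := volume_real_ball_pos hrpos
  refine ⟨9 / 4 * N / volume.real (Metric.ball I r), fun t u hu z hz => ?_⟩
  have hrad : ∀ τ ∈ t, IsMeanRadius (1 / 4 + τ ^ 2) s r := fun τ hτ => by
    obtain ⟨h0, h1, -⟩ := hu τ hτ
    exact hr _ (by nlinarith)
  have hΛ0 : ∀ τ : ℝ, 0 ≤ 1 / 4 + τ ^ 2 := fun τ => by positivity
  have hint : ∀ τ ∈ t, ∀ τ' ∈ t, Integrable (fun w => u τ w * u τ' w) (volume.restrict F) :=
    fun τ hτ τ' hτ' => (hu τ hτ).2.2.memLp.integrable_mul (hu τ' hτ').2.2.memLp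
  have horth : ∀ τ ∈ t, ∀ τ' ∈ t, ∫ w in F, u τ w * u τ' w = if τ = τ' then 1 else 0 := by
    intro τ hτ τ' hτ'
    rcases lt_trichotomy τ τ' with h | h | h
    · rw [if_neg h.ne]
      exact (hu τ hτ).2.2.integral_mul_eq_zero hΓ hF (hu τ' hτ').2.2 (hΛ0 _)
        (by nlinarith [(hu τ hτ).1]) (hrad τ hτ) (hrad τ' hτ')
    · subst h
      rw [if_pos rfl]
      exact (hu τ hτ).2.2.integral_sq
    · rw [if_neg h.ne']
      simp_rw [mul_comm (u τ _)]
      exact (hu τ' hτ').2.2.integral_mul_eq_zero hΓ hF (hu τ hτ).2.2 (hΛ0 _)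
        (by nlinarith [(hu τ' hτ').1]) (hrad τ' hτ') (hrad τ hτ)
  set f : ℍ → ℝ := fun w => ∑ τ ∈ t, u τ z * u τ w with hf
  set S := ∑ τ ∈ t, u τ z ^ 2 with hS
  have hS0 : 0 ≤ S := Finset.sum_nonneg fun _ _ => sq_nonneg _
  have hfc : Continuous f :=
    continuous_finsetSum _ fun τ hτ => continuous_const.mul (hu τ hτ).2.2.continuous
  have hfinv : IsInvariant Γ f := fun γ hγ w =>
    Finset.sum_congr rfl fun τ hτ => by rw [(hu τ hτ).2.2.isInvariant γ hγ]
  have hfsq : ∀ w, f w ^ 2 = ∑ τ ∈ t, ∑ τ' ∈ t, (u τ z * u τ' z) * (u τ w * u τ' w) := fun w => by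
    rw [hf, sq, Finset.sum_mul_sum]
    exact Finset.sum_congr rfl fun τ _ => Finset.sum_congr rfl fun τ' _ => by ring
  have hfint : Integrable (fun w => f w ^ 2) (volume.restrict F) := by
    simp_rw [hfsq]
    exact integrable_finsetSum _ fun τ hτ => integrable_finsetSum _ fun τ' hτ' =>
      (hint τ hτ τ' hτ').const_mul _
  have hfS : ∫ w in F, f w ^ 2 = S := by
    simp_rw [hfsq]
    rw [integral_finsetSum _ fun τ hτ => integrable_finsetSum _ fun τ' hτ' =>
      (hint τ hτ τ' hτ').const_mul _]
    refine Finset.sum_congr rfl fun τ hτ => ?_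
    rw [integral_finsetSum _ fun τ' hτ' => (hint τ hτ τ' hτ').const_mul _]
    simp_rw [integral_const_mul]
    rw [Finset.sum_congr rfl fun τ' hτ' => by rw [horth τ hτ τ' hτ']]
    simp [hτ, sq]
  have hle := sq_setIntegral_ball_le hN hfc hfinv hS0
    (by rw [← hfS, ofReal_integral_eq_lintegral_ofReal hfint (ae_of_all _ fun w => sq_nonneg _)])
    hrpos (z := z)
    ((Metric.ball_subset_ball hr2).trans (Metric.ball_subset_closedBall.trans
      (Metric.closedBall_subset_cthickening hz 2)))
  have hlow : 2 / 3 * volume.real (Metric.ball I r) * S ≤ ∫ w in Metric.ball z r, f w := by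
    rw [hf, integral_finsetSum _ fun τ hτ =>
      (integrableOn_ball (hu τ hτ).2.2.continuous z r).const_mul _, hS, Finset.mul_sum]
    refine Finset.sum_le_sum fun τ hτ => ?_
    obtain ⟨H, hH, hHu⟩ := (hu τ hτ).2.2.exists_multiplier (hΛ0 τ) (hrad τ hτ)
    rw [integral_const_mul, hHu]
    nlinarith [sq_nonneg (u τ z)]
  set V := volume.real (Metric.ball I r)
  rw [le_div_iff₀ hV]
  rcases hS0.eq_or_lt with h | h
  · rw [← h, zero_mul]
    positivity
  · have h1 : (2 / 3 * V * S) ^ 2 ≤ V * (N * S) :=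
      le_trans (by gcongr) hle
    have h2 : (V * S) * (S * V) ≤ (V * S) * (9 / 4 * N) := by nlinarith
    exact le_of_mul_le_mul_left h2 (by positivity)

end

section

/-! ### Geodesic circles and closed horocycles as horizontal lines -/

/-- `P` is a holomorphic map from the upper half-plane to `ℍ` in whose coordinate the lifts of
eigenfunctions on `Γ \ ℍ` have period `1`, the hyperbolic metric having density `V` at height `y`
(see `IsStripEigen`). -/
structure IsPeriodicCoord (Γ : Subgroup SL(2, ℝ)) (P : ℂ → ℍ) (V : ℝ → ℝ) : Prop where
  differentiableOn : DifferentiableOn ℂ (fun w => (P w : ℂ)) {w : ℂ | 0 < w.im}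
  continuousOn_density : ContinuousOn V (Set.Ioi 0)
  isStripEigen : ∀ (u : ℍ → ℝ) (Λ : ℝ), IsLaplaceEigen u Λ → IsInvariant Γ u →
    IsStripEigen (fun w => u (P w)) Λ V

variable {Γ : Subgroup SL(2, ℝ)} {P : ℂ → ℍ} {V : ℝ → ℝ} {s : ℝ} {α : ℝ → ℍ}

lemma differentiableOn_smul_ofComplex (g : SL(2, ℝ)) {Ψ : ℂ → ℂ}
    (hΨ : DifferentiableOn ℂ Ψ {w : ℂ | 0 < w.im}) (hpos : ∀ w : ℂ, 0 < w.im → 0 < (Ψ w).im) :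
    DifferentiableOn ℂ (fun w => ((g • ofComplex (Ψ w) : ℍ) : ℂ)) {w : ℂ | 0 < w.im} := by
  have h1 : DifferentiableOn ℂ (fun w => ((g 0 0 : ℂ) * Ψ w + g 0 1) / ((g 1 0 : ℂ) * Ψ w + g 1 1))
      {w : ℂ | 0 < w.im} :=
    DifferentiableOn.div ((hΨ.const_mul _).add_const _) ((hΨ.const_mul _).add_const _)
      fun w hw => SL_denom_ne_zero g (hpos w hw)
  refine h1.congr fun w hw => ?_
  rw [coe_SL_smul, ofComplex_apply_of_im_pos (hpos w hw)]

lemma neg_SL_smul (g : SL(2, ℝ)) (z : ℍ) : -g • z = g • z := by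
  ext
  rw [coe_SL_smul, coe_SL_smul, ← neg_div_neg_eq]
  simp [add_comm]

lemma isPeriodicCoord_disk (Γ : Subgroup SL(2, ℝ)) (g : SL(2, ℝ)) :
    IsPeriodicCoord Γ (fun w => g • ofComplex (diskParam w)) diskDensity := by
  refine ⟨differentiableOn_smul_ofComplex g
    (fun w hw => (hasDerivAt_diskParam hw).differentiableAt.differentiableWithinAt)
    fun w hw => diskParam_im_pos hw, ?_, fun u Λ hu _ => (hu.comp_smul g).isStripEigen_disk⟩
  refine ContinuousOn.pow (ContinuousOn.div (by fun_prop) (by fun_prop) fun y hy => ?_) 2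
  have h1 : Real.exp (-(2 * Real.pi * y)) < 1 := by
    rw [Real.exp_lt_one_iff]
    have : 0 < 2 * Real.pi * y := by
      have := Real.pi_pos
      have : 0 < y := hy
      positivity
    linarith
  have h2 := Real.exp_pos (-(2 * Real.pi * y))
  nlinarith

lemma isPeriodicCoord_cusp {σ : SL(2, ℝ)} (hσ : IsReducedAtInfty Γ σ) :
    IsPeriodicCoord Γ (fun w => σ • ofComplex w) (fun y => (1 / y) ^ 2) := by
  refine ⟨differentiableOn_smul_ofComplex σ differentiableOn_id fun w hw => hw, ?_,
    fun u Λ hu hinv => (hu.comp_smul σ).isStripEigen_id fun z => ?_⟩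
  · exact ContinuousOn.pow (ContinuousOn.div continuousOn_const continuousOn_id
      fun y hy => (Set.mem_Ioi.1 hy).ne') 2
  have h1 : σ • ((1 : ℝ) +ᵥ z) = (σ * translation 1 * σ⁻¹) • σ • z := by
    rw [smul_smul, inv_mul_cancel_right, mul_smul]
    congr 1
    ext
    rw [coe_SL_smul]
    simp [translation, add_comm]
  rw [h1]
  rcases (hσ (translation 1) (by simp [translation])).2 ⟨1, Or.inl rfl⟩ with h | h
  · exact hinv _ h _
  · have h2 := hinv _ h (σ • z)
    rwa [neg_SL_smul] at h2

lemma toSL2R_smul_ofComplex (z₀ : ℍ) {w : ℂ} (hw : 0 < w.im) :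
    ((z₀.toSL2R • ofComplex w : ℍ) : ℂ) = z₀.re + z₀.im * w := by
  rw [coe_SL_smul, ofComplex_apply_of_im_pos hw]
  have h1 : ((√z₀.im : ℝ) : ℂ) ≠ 0 := by
    exact_mod_cast (Real.sqrt_pos.2 z₀.im_pos).ne'
  have h2 : ((√z₀.im : ℝ) : ℂ) ^ 2 = z₀.im := by
    exact_mod_cast Real.sq_sqrt z₀.im_pos.le
  simp only [coe_toSL2R, Matrix.cons_val', Matrix.cons_val_zero, Matrix.cons_val_fin_one,
    Matrix.cons_val_one, Matrix.of_apply, Complex.ofReal_zero, zero_mul, zero_add,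
    Complex.ofReal_div, Complex.ofReal_one]
  field_simp
  rw [h2]
  ring

/-- Geodesic circles and closed horocycles are horizontal lines in a suitable coordinate. -/
lemma exists_isPeriodicCoord (hα : IsGeodesicCircle α ∨ IsClosedHorocycle Γ α) :
    ∃ (P : ℂ → ℍ) (V : ℝ → ℝ) (s : ℝ), IsPeriodicCoord Γ P V ∧ 0 < s ∧
      ∀ t : ℝ, α t = P (t + s * Complex.I) := by
  rcases hα with ⟨z₀, r₀, hr₀, hα⟩ | ⟨σ, y₀, hy₀, hσ, hα⟩
  · have h0 : 0 < Real.tanh (r₀ / 2) := by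
      simpa using strictMono_tanh (half_pos hr₀)
    have h1 : Real.tanh (r₀ / 2) < 1 := Real.tanh_lt_one _
    have hpi := Real.pi_pos
    set s := -Real.log (Real.tanh (r₀ / 2)) / (2 * Real.pi) with hs
    have hs0 : 0 < s := div_pos (neg_pos.2 (Real.log_neg h0 h1)) (by positivity)
    have hexp : Real.exp (-(2 * Real.pi * s)) = Real.tanh (r₀ / 2) := by
      rw [hs, mul_div_cancel₀ _ (by positivity), neg_neg, Real.exp_log h0]
    refine ⟨_, _, s, isPeriodicCoord_disk Γ z₀.toSL2R, hs0, fun t => ?_⟩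
    have him : 0 < ((t : ℂ) + s * Complex.I).im := by simpa using hs0
    have hnome : nome (t + s * Complex.I) =
        ((Real.tanh (r₀ / 2) : ℝ) : ℂ) * Complex.exp ((2 * Real.pi * t : ℝ) * Complex.I) := by
      rw [← hexp, nome, Complex.ofReal_exp, ← Complex.exp_add]
      congr 1
      push_cast
      linear_combination 2 * Real.pi * s * Complex.I_mul_I
    rw [hα]
    ext
    rw [toSL2R_smul_ofComplex z₀ (diskParam_im_pos him), diskParam, hnome]
    rfl
  · refine ⟨_, _, y₀, isPeriodicCoord_cusp hσ, hy₀, fun t => ?_⟩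
    rw [hα, ofComplex_apply_of_im_pos]

lemma IsPeriodicCoord.continuousOn (hP : IsPeriodicCoord Γ P V) :
    ContinuousOn P {w : ℂ | 0 < w.im} := by
  rw [continuousOn_iff_continuous_domRestrict]
  exact isEmbedding_coe.continuous_iff.2
    (continuousOn_iff_continuous_domRestrict.1 hP.differentiableOn.continuousOn)

/-- The region in `ℍ` that corresponds to the heights between `s / 2` and `3 s / 2`. -/
def stripRegion (P : ℂ → ℍ) (s : ℝ) : Set ℍ :=
  (fun p : ℝ × ℝ => P (p.1 + p.2 * Complex.I)) '' (Set.Icc 0 1 ×ˢ Set.Icc (s / 2) (3 * s / 2))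

lemma IsPeriodicCoord.isCompact_stripRegion (hP : IsPeriodicCoord Γ P V) (hs : 0 < s) :
    IsCompact (stripRegion P s) := by
  refine (isCompact_Icc.prod isCompact_Icc).image_of_continuousOn ?_
  refine hP.continuousOn.comp (by fun_prop) fun p hp => ?_
  have : 0 < p.2 := by linarith [hp.2.1]
  simpa using this

lemma mem_stripRegion {t y : ℝ} (ht : t ∈ Set.Icc (0 : ℝ) 1)
    (hy : y ∈ Set.Icc (s / 2) (3 * s / 2)) : P (t + y * Complex.I) ∈ stripRegion P s :=
  ⟨(t, y), ⟨ht, hy⟩, rfl⟩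

lemma IsPeriodicCoord.exists_density_le (hP : IsPeriodicCoord Γ P V) (hs : 0 < s) :
    ∃ V₀ : ℝ, 1 ≤ V₀ ∧ ∀ y ∈ Set.Icc (s / 2) (3 * s / 2), V y ≤ V₀ := by
  obtain ⟨M, hM⟩ := (isCompact_Icc (a := s / 2) (b := 3 * s / 2)).exists_bound_of_continuousOn
    (hP.continuousOn_density.mono fun y hy => lt_of_lt_of_le (half_pos hs) hy.1)
  exact ⟨max M 1, le_max_right _ _, fun y hy =>
    (le_abs_self _).trans ((hM y hy).trans (le_max_left _ _))⟩

lemma IsPeriodicCoord.continuous_curve (hP : IsPeriodicCoord Γ P V) (hs : 0 < s) :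
    Continuous fun t : ℝ => P (t + s * Complex.I) :=
  hP.continuousOn.comp_continuous (by fun_prop) fun t => by simpa using hs

lemma IsPeriodicCoord.continuous_hypSpeed (hP : IsPeriodicCoord Γ P V) (hs : 0 < s) :
    Continuous (hypSpeed fun t : ℝ => P (t + s * Complex.I)) := by
  have hmem : ∀ t : ℝ, 0 < ((t : ℂ) + s * Complex.I).im := fun t => by simpa using hs
  have hd : ∀ t : ℝ, deriv (fun t : ℝ => (P (t + s * Complex.I) : ℂ)) t =
      deriv (fun w => (P w : ℂ)) (t + s * Complex.I) := fun t => by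
    have h1 := (hP.differentiableOn.differentiableAt (isOpen_im_pos.mem_nhds (hmem t))).hasDerivAt
    have h2 := (h1.comp_of_eq t (hasDerivAt_horizontal t s) rfl).deriv
    rwa [mul_one] at h2
  have hc : Continuous fun t : ℝ => deriv (fun w => (P w : ℂ)) (t + s * Complex.I) :=
    (hP.differentiableOn.deriv isOpen_im_pos).continuousOn.comp_continuous (by fun_prop) hmem
  unfold hypSpeed
  simp_rw [hd]
  exact hc.norm.div (UpperHalfPlane.continuous_im.comp (hP.continuous_curve hs))
    fun t => (P _).im_pos.ne'

lemma hypSpeed_nonneg (α : ℝ → ℍ) (t : ℝ) : 0 ≤ hypSpeed α t :=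
  div_nonneg (norm_nonneg _) (α t).im_pos.le

end

section

/-! ### Zeros of holomorphic functions in a strip -/

/-- Jensen's inequality as a bound for the number of distinct zeros. -/
lemma card_zeros_le_of_ball {g : ℂ → ℂ} {r R M : ℝ} (hr : 0 < r) (hrR : r < R)
    (hg : AnalyticOnNhd ℂ g (Metric.closedBall 0 R)) (h0 : g 0 ≠ 0)
    (hM : ∀ z ∈ Metric.closedBall (0 : ℂ) R, ‖g z‖ ≤ M) (Z : Finset ℂ)
    (hZ : ∀ z ∈ Z, ‖z‖ ≤ r ∧ g z = 0) :
    (Z.card : ℝ) ≤ Real.log (M / ‖g 0‖) / Real.log (R / r) := by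
  have hR : 0 < R := hr.trans hrR
  have hg0 : 0 < ‖g 0‖ := norm_pos_iff.2 h0
  set f : ℂ → ℂ := fun z => g z / g 0 with hf
  have hfa : AnalyticOnNhd ℂ f (Metric.closedBall 0 R) := fun z hz =>
    (hg z hz).div analyticAt_const h0
  have hf0 : f 0 = 1 := div_self h0
  have hsub : Metric.closedBall (0 : ℂ) r ⊆ Metric.closedBall 0 R :=
    Metric.closedBall_subset_closedBall hrR.le
  have key := AnalyticOnNhd.sum_divisor_le (c := 0) (r := r) (R := R) (M := M / ‖g 0‖) (f := f)
    (by rwa [abs_of_pos hr]) (by rwa [abs_of_pos hr, abs_of_pos hR])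
    ((one_le_div hg0).2 (hM 0 (by simp [hR.le]))) (by rwa [abs_of_pos hR])
    (by rw [hf0]; exact one_ne_zero) (fun z hz => by
      rw [abs_of_pos hR] at hz
      rw [hf, norm_div]
      exact div_le_div_of_nonneg_right (hM z (Metric.sphere_subset_closedBall hz)) hg0.le)
  rw [hf0, norm_one, div_one, abs_of_pos hr] at key
  refine le_trans ?_ key
  set D := MeromorphicOn.divisor f (Metric.closedBall 0 r) with hD
  have hfin : (Function.support D).Finite := D.finiteSupport (isCompact_closedBall _ _)
  have hfr : AnalyticOnNhd ℂ f (Metric.closedBall 0 r) := hfa.mono hsub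
  have hnn : ∀ z, 0 ≤ D z := fun z => MeromorphicOn.AnalyticOnNhd.divisor_nonneg hfr z
  have hone : ∀ z ∈ Z, 1 ≤ D z := by
    intro z hz
    have hzr : z ∈ Metric.closedBall (0 : ℂ) r := by simpa using (hZ z hz).1
    have h1 : analyticOrderAt f z ≠ ⊤ := by
      refine hfr.analyticOrderAt_ne_top_of_isPreconnected (x := 0)
        (convex_closedBall _ _).isPreconnected (by simp [hr.le]) hzr ?_
      rw [(hfr 0 (by simp [hr.le])).analyticOrderAt_eq_zero.2 (by rw [hf0]; exact one_ne_zero)]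
      simp
    have h2 : analyticOrderAt f z ≠ 0 := by
      rw [Ne, (hfr z hzr).analyticOrderAt_eq_zero, not_not, hf]
      simp [(hZ z hz).2]
    obtain ⟨n, hn⟩ := ENat.ne_top_iff_exists.1 h1
    rw [hD, MeromorphicOn.AnalyticOnNhd.divisor_apply hfr hzr]
    rw [← hn] at h2 ⊢
    have h3 : n ≠ 0 := by exact_mod_cast h2
    change (1 : ℤ) ≤ (n : ℤ)
    omega
  rw [finsum_eq_sum_of_support_subset D (s := hfin.toFinset) (by simp)]
  have hZs : Z ⊆ hfin.toFinset := fun z hz => by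
    have := hone z hz
    simp only [Set.Finite.mem_toFinset, Function.mem_support]
    omega
  have h4 : (Z.card : ℤ) ≤ ∑ z ∈ hfin.toFinset, D z := by
    calc (Z.card : ℤ) = ∑ z ∈ Z, 1 := by simp
      _ ≤ ∑ z ∈ Z, D z := Finset.sum_le_sum hone
      _ ≤ _ := Finset.sum_le_sum_of_subset_of_nonneg hZs fun z _ _ => hnn z
  exact_mod_cast h4

/-- The Riemann map from the unit disc to the strip `|Im w| < δ` that maps `0` to `t₀`. -/
def stripMap (δ t₀ : ℝ) (w : ℂ) : ℂ :=
  t₀ + (2 * δ / Real.pi : ℝ) * Complex.log ((1 + w) / (1 - w))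

lemma re_cayley_pos {w : ℂ} (hw : ‖w‖ < 1) : 0 < ((1 + w) / (1 - w)).re := by
  have h1 : (1 - w) ≠ 0 := by
    intro h
    rw [← sub_eq_zero.mp h] at hw
    simp at hw
  have h2 : 0 < Complex.normSq (1 - w) := Complex.normSq_pos.mpr h1
  have h3 : Complex.normSq w < 1 := by
    rw [Complex.normSq_eq_norm_sq]
    nlinarith [norm_nonneg w]
  have h4 : ((1 + w) / (1 - w)).re = (1 - Complex.normSq w) / Complex.normSq (1 - w) := by
    simp only [Complex.div_re, Complex.add_re, Complex.add_im, Complex.sub_re, Complex.sub_im,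
      Complex.one_re, Complex.one_im, Complex.normSq_apply w]
    ring
  rw [h4]
  exact div_pos (by linarith) h2

lemma abs_im_stripMap_lt {δ : ℝ} (hδ : 0 < δ) (t₀ : ℝ) {w : ℂ} (hw : ‖w‖ < 1) :
    |(stripMap δ t₀ w).im| < δ := by
  have hpi := Real.pi_pos
  have h1 : |Complex.arg ((1 + w) / (1 - w))| < Real.pi / 2 :=
    Complex.abs_arg_lt_pi_div_two_iff.2 (Or.inl (re_cayley_pos hw))
  have h2 : (stripMap δ t₀ w).im = 2 * δ / Real.pi * Complex.arg ((1 + w) / (1 - w)) := by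
    rw [stripMap, Complex.add_im, Complex.ofReal_im, Complex.im_ofReal_mul, Complex.log_im,
      zero_add]
  rw [h2, abs_mul, abs_of_pos (by positivity)]
  calc 2 * δ / Real.pi * |Complex.arg ((1 + w) / (1 - w))|
      < 2 * δ / Real.pi * (Real.pi / 2) := by gcongr
    _ = δ := by field_simp

lemma analyticAt_stripMap (δ t₀ : ℝ) {w : ℂ} (hw : ‖w‖ < 1) : AnalyticAt ℂ (stripMap δ t₀) w := by
  have h1 : (1 - w) ≠ 0 := by
    intro h
    rw [← sub_eq_zero.mp h] at hw
    simp at hw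
  have h2 : AnalyticAt ℂ (fun w : ℂ => (1 + w) / (1 - w)) w :=
    (analyticAt_const.add analyticAt_id).div (analyticAt_const.sub analyticAt_id) h1
  exact analyticAt_const.add (analyticAt_const.mul (h2.clog (Or.inl (re_cayley_pos hw))))

lemma stripMap_tanh {δ : ℝ} (hδ : 0 < δ) (t₀ t : ℝ) :
    stripMap δ t₀ (Real.tanh (Real.pi * (t - t₀) / (4 * δ)) : ℝ) = t := by
  have hpi := Real.pi_pos
  set x := Real.pi * (t - t₀) / (4 * δ) with hx
  have h1 : (1 + Real.tanh x) / (1 - Real.tanh x) = Real.exp (2 * x) := by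
    have hc := (Real.cosh_pos x).ne'
    have h2 : Real.cosh x - Real.sinh x ≠ 0 := by
      rw [Real.cosh_sub_sinh]; exact (Real.exp_pos _).ne'
    have h3 : 1 - Real.tanh x ≠ 0 := by
      have := Real.tanh_lt_one x
      linarith
    rw [div_eq_iff h3, Real.tanh_eq_sinh_div_cosh]
    have e1 : Real.exp (2 * x) * (Real.cosh x - Real.sinh x) = Real.cosh x + Real.sinh x := by
      rw [Real.cosh_sub_sinh, Real.cosh_add_sinh, ← Real.exp_add]
      congr 1
      ring
    field_simp
    linarith
  have h2 : (1 + ((Real.tanh x : ℝ) : ℂ)) / (1 - ((Real.tanh x : ℝ) : ℂ)) =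
      ((Real.exp (2 * x) : ℝ) : ℂ) := by
    rw [← h1]
    push_cast
    rfl
  rw [stripMap, h2, ← Complex.ofReal_log (Real.exp_pos _).le, Real.log_exp, ← Complex.ofReal_mul,
    ← Complex.ofReal_add]
  congr 1
  rw [hx]
  field_simp
  ring

/-- The number of zeros in `[0, 1]` of a bounded holomorphic function on a strip is at most
logarithmic in the ratio of the bound to any one value on `[0, 1]`. -/
lemma exists_card_zeros_le {δ : ℝ} (hδ : 0 < δ) : ∃ κ : ℝ, 0 < κ ∧
    ∀ (f : ℂ → ℂ) (M : ℝ), DifferentiableOn ℂ f {w : ℂ | |w.im| < δ} →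
      (∀ w : ℂ, |w.im| < δ → ‖f w‖ ≤ M) → ∀ t₀ ∈ Set.Icc (0 : ℝ) 1, f t₀ ≠ 0 →
        ∀ Z : Finset ℝ, (∀ t ∈ Z, t ∈ Set.Icc (0 : ℝ) 1 ∧ f t = 0) →
          (Z.card : ℝ) ≤ κ * Real.log (M / ‖f t₀‖) := by
  have hpi := Real.pi_pos
  set r := Real.tanh (Real.pi / (4 * δ)) with hr
  have hr0 : 0 < r := by
    simpa using strictMono_tanh (show 0 < Real.pi / (4 * δ) by positivity)
  have hr1 : r < 1 := Real.tanh_lt_one _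
  set R := (1 + r) / 2 with hR
  have hrR : r < R := by rw [hR]; linarith
  have hR1 : R < 1 := by rw [hR]; linarith
  refine ⟨1 / Real.log (R / r), one_div_pos.2 (Real.log_pos ((one_lt_div hr0).2 hrR)),
    fun f M hf hM t₀ ht₀ hft₀ Z hZ => ?_⟩
  have hopen : IsOpen {w : ℂ | |w.im| < δ} :=
    isOpen_lt (continuous_abs.comp Complex.continuous_im) continuous_const
  have hball : ∀ w ∈ Metric.closedBall (0 : ℂ) R, ‖w‖ < 1 := fun w hw => by
    rw [mem_closedBall_zero_iff] at hw
    linarith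
  set p : ℝ → ℂ := fun t => (Real.tanh (Real.pi * (t - t₀) / (4 * δ)) : ℝ) with hp
  have hpt : ∀ t, stripMap δ t₀ (p t) = t := fun t => stripMap_tanh hδ t₀ t
  have hinj : Function.Injective p := fun t t' h => by
    have h1 := hpt t
    rw [h, hpt] at h1
    exact_mod_cast h1.symm
  have h00 : stripMap δ t₀ 0 = t₀ := by
    have h1 := hpt t₀
    simpa [hp] using h1
  have key := card_zeros_le_of_ball (g := fun w => f (stripMap δ t₀ w)) (M := M) hr0 hrR
    (fun w hw => (hf.analyticAt (hopen.mem_nhds (abs_im_stripMap_lt hδ t₀ (hball w hw)))).comp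
      (analyticAt_stripMap δ t₀ (hball w hw))) (by rwa [h00])
    (fun w hw => hM _ (abs_im_stripMap_lt hδ t₀ (hball w hw))) (Z.image p) (by
      intro z hz
      obtain ⟨t, ht, rfl⟩ := Finset.mem_image.1 hz
      refine ⟨?_, by rw [hpt]; exact (hZ t ht).2⟩
      rw [hp, Complex.norm_real, Real.norm_eq_abs, hr, abs_le, ← Real.tanh_neg,
        strictMono_tanh.le_iff_le, strictMono_tanh.le_iff_le, ← neg_div]
      have h1 := (hZ t ht).1
      constructor <;> gcongr
      · nlinarith [h1.1, ht₀.2]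
      · nlinarith [h1.2, ht₀.1])
  rw [Finset.card_image_of_injective _ hinj, h00] at key
  rw [one_div_mul_eq_div]
  exact key

end

section

/-! ### Holomorphic continuation of the restriction to a horizontal line -/

variable {G : ℂ → ℝ} {Λ s V₀ B : ℝ} {V : ℝ → ℝ}

lemma abs_horizontalMean_le {h : ℝ → ℝ} {y : ℝ} (hh1 : ∀ x, |h x| ≤ 1)
    (hB : ∀ x ∈ Set.Icc (0 : ℝ) 1, |G (x + y * Complex.I)| ≤ B) : |horizontalMean G h y| ≤ B := by
  have h1 := intervalIntegral.norm_integral_le_of_norm_le_const (a := (0 : ℝ)) (b := 1) (C := B)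
    (f := fun x => G (x + y * Complex.I) * h x) (fun x hx => by
      rw [Set.uIoc_of_le zero_le_one] at hx
      have h2 := hB x ⟨hx.1.le, hx.2⟩
      rw [Real.norm_eq_abs, abs_mul]
      calc |G (x + y * Complex.I)| * |h x| ≤ |G (x + y * Complex.I)| * 1 := by
            gcongr
            exact hh1 x
        _ ≤ B := by rwa [mul_one])
  simpa [horizontalMean] using h1

/-- A Fourier mode of frequency `ω` on the line of height `s` is exponentially small in the
frequency, because it is convex in the height as soon as `ω²` exceeds `Λ V`; for smaller
frequencies the right hand side exceeds the trivial bound. -/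
lemma IsStripEigen.abs_horizontalMean_le_exp (hG : IsStripEigen G Λ V) (hs : 0 < s) (hΛ : 0 ≤ Λ)
    (hV : ∀ y ∈ Set.Icc (s / 2) (3 * s / 2), V y ≤ V₀) (hB0 : 0 < B)
    (hB : ∀ x ∈ Set.Icc (0 : ℝ) 1, ∀ y ∈ Set.Icc (s / 2) (3 * s / 2), |G (x + y * Complex.I)| ≤ B)
    {h h1 : ℝ → ℝ} {ω k : ℝ} (hh : ∀ x, HasDerivAt h (h1 x) x)
    (hh1 : ∀ x, HasDerivAt h1 (-ω ^ 2 * h x) x) (h01 : h 1 = h 0) (h101 : h1 1 = h1 0)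
    (hle : ∀ x, |h x| ≤ 1) (hω : 2 * k ^ 2 ≤ ω ^ 2) :
    |horizontalMean G h s| ≤
      2 * B * Real.exp (Real.sqrt (Λ * V₀) * (s / 2)) * Real.exp (-(k * (s / 2))) := by
  have htriv : ∀ y ∈ Set.Icc (s / 2) (3 * s / 2), |horizontalMean G h y| ≤ B := fun y hy =>
    abs_horizontalMean_le hle fun x hx => hB x hx y hy
  have hhc : Continuous h := continuous_iff_continuousAt.2 fun x => (hh x).continuousAt
  by_cases hcase : k ≤ Real.sqrt (Λ * V₀)
  · have h2 : 1 ≤ Real.exp (Real.sqrt (Λ * V₀) * (s / 2)) * Real.exp (-(k * (s / 2))) := by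
      rw [← Real.exp_add, Real.one_le_exp_iff]
      nlinarith
    have h3 := htriv s ⟨by linarith, by linarith⟩
    nlinarith
  · push Not at hcase
    have hk0 : 0 < k := (Real.sqrt_nonneg _).trans_lt hcase
    have hkV : Λ * V₀ < k ^ 2 := (Real.sqrt_lt' hk0).1 hcase
    have e1 : s - s / 2 = s / 2 := by ring
    have e2 : s + s / 2 = 3 * s / 2 := by ring
    have hpos : ∀ y ∈ Set.Icc (s / 2) (3 * s / 2), 0 < y := fun y hy => by linarith [hy.1]
    have h2 : |horizontalMean G h s| ≤ 2 * B * Real.exp (-(k * (s / 2))) := by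
      refine abs_le_exp_of_deriv2 (η := s / 2) (half_pos hs) hk0
        (a1 := horizontalMean (fun z => fderiv ℝ G z Complex.I) h) (q := fun y => ω ^ 2 - Λ * V y)
        ?_ ?_ ?_ hB0 ?_ ?_
      · rw [e1, e2]
        exact fun y hy => hG.hasDerivAt_mean hhc (hpos y hy)
      · rw [e1, e2]
        exact fun y hy => hG.hasDerivAt_mean_deriv hh hh1 h01 h101 (hpos y hy)
      · rw [e1, e2]
        intro y hy
        have := mul_le_mul_of_nonneg_left (hV y hy) hΛ
        linarith
      · rw [e1]
        exact htriv _ ⟨le_rfl, by linarith⟩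
      · rw [e2]
        exact htriv _ ⟨by linarith, le_rfl⟩
    have h3 : 1 ≤ Real.exp (Real.sqrt (Λ * V₀) * (s / 2)) := by
      rw [Real.one_le_exp_iff]
      positivity
    calc |horizontalMean G h s| ≤ 2 * B * 1 * Real.exp (-(k * (s / 2))) := by rwa [mul_one]
      _ ≤ _ := by gcongr

/-- The Fourier coefficients of `x ↦ G (x + i s)`. -/
def lineCoeff (G : ℂ → ℝ) (s : ℝ) (n : ℤ) : ℂ :=
  ∫ x in (0 : ℝ)..1, Complex.exp (-(2 * Real.pi * n * x * Complex.I)) * G (x + s * Complex.I)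

lemma IsStripEigen.lineCoeff_eq (hG : IsStripEigen G Λ V) (hs : 0 < s) (n : ℤ) : lineCoeff G s n =
    (horizontalMean G (fun x => Real.cos (2 * Real.pi * n * x)) s : ℝ) -
      (horizontalMean G (fun x => Real.sin (2 * Real.pi * n * x)) s : ℝ) * Complex.I := by
  have hc := continuousOn_horizontal hG.contDiffOn.continuousOn hs
  rw [horizontalMean, horizontalMean, ← intervalIntegral.integral_ofReal,
    ← intervalIntegral.integral_ofReal, ← intervalIntegral.integral_mul_const,
    ← intervalIntegral.integral_sub]
  · refine intervalIntegral.integral_congr fun x _ => ?_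
    have h1 : Complex.exp (-(2 * Real.pi * n * x * Complex.I)) =
        Complex.cos (2 * Real.pi * n * x) - Complex.sin (2 * Real.pi * n * x) * Complex.I := by
      rw [← neg_mul, Complex.exp_mul_I, Complex.cos_neg, Complex.sin_neg]
      ring
    rw [h1]
    push_cast
    ring
  · exact (Complex.continuous_ofReal.comp (hc.mul (by fun_prop))).intervalIntegrable _ _
  · exact ((Complex.continuous_ofReal.comp (hc.mul (by fun_prop))).mul
      continuous_const).intervalIntegrable _ _

lemma IsStripEigen.norm_lineCoeff_le (hG : IsStripEigen G Λ V) (hs : 0 < s) (hΛ : 0 ≤ Λ)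
    (hV : ∀ y ∈ Set.Icc (s / 2) (3 * s / 2), V y ≤ V₀) (hB0 : 0 < B)
    (hB : ∀ x ∈ Set.Icc (0 : ℝ) 1, ∀ y ∈ Set.Icc (s / 2) (3 * s / 2), |G (x + y * Complex.I)| ≤ B)
    (n : ℤ) : ‖lineCoeff G s n‖ ≤
      4 * B * Real.exp (Real.sqrt (Λ * V₀) * (s / 2)) * Real.exp (-(|(n : ℝ)| * (s / 2))) := by
  have hω : 2 * |(n : ℝ)| ^ 2 ≤ (2 * Real.pi * n) ^ 2 := by
    rw [sq_abs]
    have := Real.pi_gt_three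
    have h1 : 2 ≤ (2 * Real.pi) ^ 2 := by nlinarith
    rw [mul_pow]
    exact mul_le_mul_of_nonneg_right h1 (sq_nonneg _)
  have hlin : ∀ x : ℝ, HasDerivAt (fun x : ℝ => 2 * Real.pi * n * x) (2 * Real.pi * n) x :=
    fun x => by simpa using (hasDerivAt_id x).const_mul (2 * Real.pi * n)
  have hcos1 : Real.cos (2 * Real.pi * n * 1) = 1 := by
    rw [mul_one, mul_comm]
    exact Real.cos_int_mul_two_pi n
  have hsin1 : Real.sin (2 * Real.pi * n * 1) = 0 := by
    rw [mul_one, show 2 * Real.pi * (n : ℝ) = ((2 * n : ℤ) : ℝ) * Real.pi by push_cast; ring]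
    exact Real.sin_int_mul_pi _
  have hdc : ∀ x : ℝ, HasDerivAt (fun x : ℝ => Real.cos (2 * Real.pi * n * x))
      (-(2 * Real.pi * n) * Real.sin (2 * Real.pi * n * x)) x := fun x =>
    (hlin x).cos.congr_deriv (by ring)
  have hds : ∀ x : ℝ, HasDerivAt (fun x : ℝ => Real.sin (2 * Real.pi * n * x))
      ((2 * Real.pi * n) * Real.cos (2 * Real.pi * n * x)) x := fun x =>
    (hlin x).sin.congr_deriv (by ring)
  have h1 := hG.abs_horizontalMean_le_exp hs hΛ hV hB0 hB hdc
    (fun x => ((hds x).const_mul _).congr_deriv (by ring)) (ω := 2 * Real.pi * n)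
    (by simp only [hcos1, mul_zero, Real.cos_zero]) (by simp only [hsin1, mul_zero, Real.sin_zero])
    (fun x => Real.abs_cos_le_one _) hω
  have h2 := hG.abs_horizontalMean_le_exp hs hΛ hV hB0 hB hds
    (fun x => ((hdc x).const_mul _).congr_deriv (by ring)) (ω := 2 * Real.pi * n)
    (by simp only [hsin1, mul_zero, Real.sin_zero]) (by simp only [hcos1, mul_zero, Real.cos_zero])
    (fun x => Real.abs_sin_le_one _) hω
  rw [hG.lineCoeff_eq hs]
  refine (norm_sub_le _ _).trans ?_
  rw [norm_mul, Complex.norm_I, mul_one, Complex.norm_real, Complex.norm_real, Real.norm_eq_abs,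
    Real.norm_eq_abs]
  linarith

/-- A continuous function on a horizontal line is the sum of its Fourier series if the latter
converges absolutely. -/
lemma IsStripEigen.hasSum_lineCoeff (hG : IsStripEigen G Λ V) (hs : 0 < s)
    (hsum : Summable (lineCoeff G s)) (t : ℝ) :
    HasSum (fun n : ℤ => lineCoeff G s n * Complex.exp (2 * Real.pi * n * t * Complex.I))
      (G (t + s * Complex.I)) := by
  have hc : Continuous fun x : ℝ => (G (x + s * Complex.I) : ℂ) :=
    Complex.continuous_ofReal.comp (continuousOn_horizontal hG.contDiffOn.continuousOn hs)
  have hper : Function.Periodic (fun x : ℝ => (G (x + s * Complex.I) : ℂ)) 1 := fun x => by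
    simp only
    rw [← hG.periodic (x + s * Complex.I) (by simpa using hs),
      show ((x + 1 : ℝ) : ℂ) + s * Complex.I = x + s * Complex.I + 1 by push_cast; ring]
  set f : C(AddCircle (1 : ℝ), ℂ) := ⟨hper.lift, continuous_coinduced_dom.2 hc⟩ with hf
  have hfx : ∀ x : ℝ, f (x : AddCircle (1 : ℝ)) = G (x + s * Complex.I) := fun x => rfl
  have hcoeff : ∀ n, fourierCoeff f n = lineCoeff G s n := fun n => by
    rw [fourierCoeff_eq_intervalIntegral f n 0, lineCoeff]
    simp only [zero_add, div_one, one_smul]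
    refine intervalIntegral.integral_congr fun x _ => ?_
    rw [fourier_coe_apply, hfx, smul_eq_mul]
    congr 2
    push_cast
    ring
  have key := has_pointwise_sum_fourier_series_of_summable (f := f)
    (by rw [show fourierCoeff f = lineCoeff G s from funext hcoeff]; exact hsum)
    (t : AddCircle (1 : ℝ))
  rw [hfx] at key
  convert key using 2 with n
  rw [hcoeff, fourier_coe_apply, smul_eq_mul]
  congr 2
  push_cast
  ring

lemma summable_exp_neg_abs {a : ℝ} (ha : 0 < a) :
    Summable fun n : ℤ => Real.exp (-(|(n : ℝ)| * a)) := by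
  have h1 : Summable fun n : ℕ => Real.exp (-((n : ℝ) * a)) := by
    have := Real.summable_exp_nat_mul_iff.2 (neg_neg_of_pos ha)
    refine this.congr fun n => ?_
    rw [mul_neg]
  refine Summable.of_nat_of_neg ?_ ?_ <;> simpa using h1

/-- The restriction of a strip eigenfunction to a horizontal line extends holomorphically to a
strip of fixed width, with a bound that is exponential in `√Λ`. -/
lemma exists_continuation (hs : 0 < s) : ∃ S : ℝ, 0 < S ∧
    ∀ (G : ℂ → ℝ) (Λ V₀ B : ℝ) (V : ℝ → ℝ), IsStripEigen G Λ V → 0 ≤ Λ →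
      (∀ y ∈ Set.Icc (s / 2) (3 * s / 2), V y ≤ V₀) → 0 < B →
      (∀ x ∈ Set.Icc (0 : ℝ) 1, ∀ y ∈ Set.Icc (s / 2) (3 * s / 2),
        |G (x + y * Complex.I)| ≤ B) →
      ∃ f : ℂ → ℂ, DifferentiableOn ℂ f {w : ℂ | |w.im| < s / (8 * Real.pi)} ∧
        (∀ w : ℂ, |w.im| < s / (8 * Real.pi) →
          ‖f w‖ ≤ S * B * Real.exp (Real.sqrt (Λ * V₀) * (s / 2))) ∧
        ∀ t : ℝ, f t = G (t + s * Complex.I) := by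
  have hpi := Real.pi_pos
  have hsum4 := summable_exp_neg_abs (show 0 < s / 4 by positivity)
  refine ⟨4 * ∑' n : ℤ, Real.exp (-(|(n : ℝ)| * (s / 4))),
    mul_pos four_pos (hsum4.tsum_pos (fun n => (Real.exp_pos _).le) 0 (Real.exp_pos _)), ?_⟩
  intro G Λ V₀ B V hG hΛ hV hB0 hB
  set E := 4 * B * Real.exp (Real.sqrt (Λ * V₀) * (s / 2)) with hE
  have hcoeff := hG.norm_lineCoeff_le hs hΛ hV hB0 hB
  have hsum : Summable (lineCoeff G s) :=
    .of_norm_bounded ((summable_exp_neg_abs (half_pos hs)).mul_left E) hcoeff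
  set T : ℤ → ℂ → ℂ := fun n w =>
    lineCoeff G s n * Complex.exp (2 * Real.pi * n * w * Complex.I) with hT
  have hTle : ∀ (n : ℤ) (w : ℂ), w ∈ {w : ℂ | |w.im| < s / (8 * Real.pi)} →
      ‖T n w‖ ≤ E * Real.exp (-(|(n : ℝ)| * (s / 4))) := by
    intro n w hw
    have hw' : |w.im| < s / (8 * Real.pi) := hw
    have h1 : ‖Complex.exp (2 * Real.pi * n * w * Complex.I)‖ ≤
        Real.exp (|(n : ℝ)| * (s / 4)) := by
      rw [Complex.norm_exp, Real.exp_le_exp]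
      have h2 : (2 * Real.pi * n * w * Complex.I).re = 2 * Real.pi * (-(n * w.im)) := by
        simp
        ring
      rw [h2]
      calc 2 * Real.pi * (-(n * w.im)) ≤ 2 * Real.pi * (|(n : ℝ)| * (s / (8 * Real.pi))) := by
            gcongr
            refine (neg_le_abs _).trans ?_
            rw [abs_mul]
            gcongr
        _ = |(n : ℝ)| * (s / 4) := by field_simp; ring
    rw [hT, norm_mul]
    calc ‖lineCoeff G s n‖ * ‖Complex.exp (2 * Real.pi * n * w * Complex.I)‖
        ≤ (E * Real.exp (-(|(n : ℝ)| * (s / 2)))) * Real.exp (|(n : ℝ)| * (s / 4)) := by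
          gcongr
          exact hcoeff n
      _ = E * Real.exp (-(|(n : ℝ)| * (s / 4))) := by
          rw [mul_assoc, ← Real.exp_add]
          congr 2
          ring
  have hopen : IsOpen {w : ℂ | |w.im| < s / (8 * Real.pi)} :=
    isOpen_lt (continuous_abs.comp Complex.continuous_im) continuous_const
  refine ⟨fun w => ∑' n, T n w, ?_, fun w hw => ?_, fun t => ?_⟩
  · exact Complex.differentiableOn_tsum_of_summable_norm (hsum4.mul_left E)
      (fun n => by rw [hT]; fun_prop) hopen hTle
  · refine (tsum_of_norm_bounded (hsum4.mul_left E).hasSum fun n => hTle n w hw).trans ?_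
    rw [tsum_mul_left, hE]
    exact le_of_eq (by ring)
  · exact (hG.hasSum_lineCoeff hs hsum t).tsum_eq

end

section

/-! ### Counting the zeros on a curve -/

variable {Γ : Subgroup SL(2, ℝ)} {F : Set ℍ} {P : ℂ → ℍ} {V : ℝ → ℝ} {s : ℝ} {u : ℍ → ℝ} {Λ : ℝ}

/-- The square of the `L²` norm of `u` along the curve `α`. -/
def curveEnergy (α : ℝ → ℍ) (u : ℍ → ℝ) : ℝ :=
  ∫ t in (0 : ℝ)..1, u (α t) ^ 2 * hypSpeed α t

lemma IsPeriodicCoord.exists_hypSpeed_le (hP : IsPeriodicCoord Γ P V) (hs : 0 < s) :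
    ∃ v : ℝ, 0 < v ∧ ∀ t ∈ Set.Icc (0 : ℝ) 1,
      hypSpeed (fun t : ℝ => P (t + s * Complex.I)) t ≤ v := by
  obtain ⟨M, hM⟩ := (isCompact_Icc (a := (0 : ℝ)) (b := 1)).exists_bound_of_continuousOn
    (hP.continuous_hypSpeed hs).continuousOn
  exact ⟨max M 1, by positivity, fun t ht =>
    (le_abs_self _).trans ((hM t ht).trans (le_max_left _ _))⟩

lemma IsPeriodicCoord.continuous_energy_density (hP : IsPeriodicCoord Γ P V) (hs : 0 < s)
    (hu : Continuous u) : Continuous fun t : ℝ => u (P (t + s * Complex.I)) ^ 2 *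
      hypSpeed (fun t : ℝ => P (t + s * Complex.I)) t :=
  ((hu.comp (hP.continuous_curve hs)).pow 2).mul (hP.continuous_hypSpeed hs)

/-- Below a certain spectral parameter, the normalized eigenfunctions are small on the curve: those
that are not are finitely many in view of Bessel's inequality. -/
lemma IsPeriodicCoord.exists_curveEnergy_lt (hΓ : DiscreteTopology Γ) (hF : IsFundDomain Γ F)
    (hP : IsPeriodicCoord Γ P V) (hs : 0 < s) : ∃ τ₁ : ℝ, 0 < τ₁ ∧ τ₁ ≤ 1 ∧
      ∀ (u : ℍ → ℝ) (τ : ℝ), 0 < τ → τ < τ₁ → IsUnitEigen Γ F u (1 / 4 + τ ^ 2) →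
        curveEnergy (fun t : ℝ => P (t + s * Complex.I)) u < 1 / 4 := by
  obtain ⟨C, hC⟩ := exists_sum_sq_le hΓ hF (hP.isCompact_stripRegion hs)
  obtain ⟨v, hv0, hv⟩ := hP.exists_hypSpeed_le hs
  set α : ℝ → ℍ := fun t : ℝ => P (t + s * Complex.I) with hα
  set T : Set ℝ := {τ | 0 < τ ∧ τ < 1 ∧ ∃ u : ℍ → ℝ, IsUnitEigen Γ F u (1 / 4 + τ ^ 2) ∧
    1 / 4 ≤ curveEnergy α u} with hT
  have hex : ∀ τ : ℝ, ∃ u : ℍ → ℝ, τ ∈ T →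
      IsUnitEigen Γ F u (1 / 4 + τ ^ 2) ∧ 1 / 4 ≤ curveEnergy α u := fun τ => by
    by_cases h : τ ∈ T
    · obtain ⟨-, -, u, hu⟩ := h
      exact ⟨u, fun _ => hu⟩
    · exact ⟨0, fun h' => absurd h' h⟩
  choose U hU using hex
  have hfin : T.Finite := by
    by_contra hinf
    obtain ⟨N, hN⟩ := exists_nat_gt (4 * (C * v))
    obtain ⟨t, htT, htN⟩ := Set.Infinite.exists_subset_card_eq hinf N
    have h1 : (N : ℝ) * (1 / 4) ≤ ∑ τ ∈ t, curveEnergy α (U τ) := by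
      rw [← htN, ← nsmul_eq_mul]
      exact Finset.card_nsmul_le_sum _ _ _ fun τ hτ => (hU τ (htT hτ)).2
    have hcont : ∀ τ ∈ t, Continuous fun x => U τ (α x) ^ 2 * hypSpeed α x := fun τ hτ =>
      hP.continuous_energy_density hs (hU τ (htT hτ)).1.continuous
    have h2 : ∑ τ ∈ t, curveEnergy α (U τ) ≤ C * v := by
      unfold curveEnergy
      rw [← intervalIntegral.integral_finsetSum fun τ hτ => (hcont τ hτ).intervalIntegrable _ _]
      calc ∫ x in (0 : ℝ)..1, ∑ τ ∈ t, U τ (α x) ^ 2 * hypSpeed α x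
          ≤ ∫ _ in (0 : ℝ)..1, C * v := by
            refine intervalIntegral.integral_mono_on zero_le_one
              ((continuous_finsetSum _ hcont).intervalIntegrable _ _)
              (continuous_const.intervalIntegrable _ _) fun x hx => ?_
            rw [← Finset.sum_mul]
            have h3 := hC t U (fun τ hτ => ⟨(htT hτ).1, (htT hτ).2.1, (hU τ (htT hτ)).1⟩) (α x)
              (mem_stripRegion hx ⟨by linarith, by linarith⟩)
            exact mul_le_mul h3 (hv x hx) (hypSpeed_nonneg α x)
              ((Finset.sum_nonneg fun _ _ => sq_nonneg _).trans h3)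
        _ = C * v := by simp
    linarith
  obtain ⟨τ₁, hτ₁, hmin⟩ := Set.exists_min_image (T ∪ {1}) id (hfin.union (Set.finite_singleton 1))
    ⟨1, Or.inr rfl⟩
  have h1 : τ₁ ≤ 1 := hmin 1 (Or.inr rfl)
  refine ⟨τ₁, ?_, h1, fun u τ hτ hlt hu => ?_⟩
  · rcases hτ₁ with h | h
    · exact h.1
    · rw [Set.mem_singleton_iff.1 h]
      exact one_pos
  · by_contra hcon
    push Not at hcon
    have : τ₁ ≤ τ := hmin τ (Or.inl ⟨hτ, hlt.trans_le h1, u, hu, hcon⟩)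
    linarith

/-- Jensen's inequality for the holomorphic continuation of the restriction of an eigenfunction. -/
lemma IsPeriodicCoord.exists_card_zeros_le (hΓ : DiscreteTopology Γ) (hF : IsFundDomain Γ F)
    (hP : IsPeriodicCoord Γ P V) (hs : 0 < s) : ∃ κ c₁ c₂ : ℝ, 0 < κ ∧ 0 < c₁ ∧ 0 < c₂ ∧
      ∀ (u : ℍ → ℝ) (τ : ℝ), 0 < τ → IsUnitEigen Γ F u (1 / 4 + τ ^ 2) →
        0 < curveEnergy (fun t : ℝ => P (t + s * Complex.I)) u →
        ∀ Z : Finset ℝ, (∀ t ∈ Z, t ∈ Set.Icc (0 : ℝ) 1 ∧ u (P (t + s * Complex.I)) = 0) →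
          (Z.card : ℝ) ≤ κ * (c₁ + c₂ * τ - Real.log
            (Real.sqrt (curveEnergy (fun t : ℝ => P (t + s * Complex.I)) u))) := by
  obtain ⟨A, hA0, hA⟩ := exists_abs_le_exp hΓ hF (hP.isCompact_stripRegion hs)
  obtain ⟨v, hv0, hv⟩ := hP.exists_hypSpeed_le hs
  obtain ⟨V₀, hV1, hV⟩ := hP.exists_density_le hs
  obtain ⟨S, hS0, hS⟩ := exists_continuation hs
  obtain ⟨κ, hκ0, hκ⟩ := HypSurface.exists_card_zeros_le
    (show 0 < s / (8 * Real.pi) by have := Real.pi_pos; positivity)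
  refine ⟨κ, |Real.log (S * A * Real.sqrt v)| + V₀ * s / 4, 1 + V₀ * s / 2, hκ0, by positivity,
    by positivity, fun u τ hτ hu hE Z hZ => ?_⟩
  set α : ℝ → ℍ := fun t : ℝ => P (t + s * Complex.I) with hα
  obtain ⟨f, hf, hfle, hfu⟩ := hS (fun w => u (P w)) (1 / 4 + τ ^ 2) V₀ (A * Real.exp τ) V
    (hP.isStripEigen u _ hu.isLaplaceEigen hu.isInvariant) (by positivity) hV (by positivity)
    (fun x hx y hy => hA u τ hτ hu _ (mem_stripRegion hx hy))
  have hcont : Continuous fun t => |u (α t)| :=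
    (hu.continuous.comp (hP.continuous_curve hs)).abs
  obtain ⟨t₀, ht₀, hmax⟩ := (isCompact_Icc (a := (0 : ℝ)) (b := 1)).exists_isMaxOn
    ⟨0, by simp⟩ hcont.continuousOn
  -- The value at `t₀` controls the norm on the curve.
  have hEle : curveEnergy α u ≤ v * u (α t₀) ^ 2 := by
    calc curveEnergy α u ≤ ∫ _ in (0 : ℝ)..1, v * u (α t₀) ^ 2 := by
          refine intervalIntegral.integral_mono_on zero_le_one
            ((hP.continuous_energy_density hs hu.continuous).intervalIntegrable _ _)
            (continuous_const.intervalIntegrable _ _) fun x hx => ?_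
          rw [mul_comm]
          exact mul_le_mul (hv x hx) (sq_le_sq.2 (hmax hx)) (sq_nonneg _) hv0.le
      _ = _ := by simp
  set m := |u (α t₀)| with hm
  have hm0 : 0 < m := by
    refine abs_pos.2 fun h => ?_
    rw [h] at hEle
    simp at hEle
    linarith
  have hnorm : ‖f t₀‖ = m := by
    rw [hfu, Complex.norm_real, Real.norm_eq_abs]
  have hft₀ : f t₀ ≠ 0 := norm_pos_iff.1 (by rwa [hnorm])
  have key := hκ f _ hf hfle t₀ ht₀ hft₀ Z (fun t ht => ⟨(hZ t ht).1, by
    rw [hfu, (hZ t ht).2, Complex.ofReal_zero]⟩)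
  refine key.trans (mul_le_mul_of_nonneg_left ?_ hκ0.le)
  rw [hnorm]
  have hsqrt0 : 0 < Real.sqrt (curveEnergy α u) := Real.sqrt_pos.2 hE
  have hsqrt : Real.sqrt (curveEnergy α u) ≤ Real.sqrt v * m := by
    rw [hm, ← Real.sqrt_sq_eq_abs, ← Real.sqrt_mul hv0.le]
    exact Real.sqrt_le_sqrt hEle
  have hlogm : Real.log (Real.sqrt (curveEnergy α u)) ≤ Real.log (Real.sqrt v) + Real.log m := by
    rw [← Real.log_mul (Real.sqrt_pos.2 hv0).ne' hm0.ne']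
    exact Real.log_le_log hsqrt0 hsqrt
  have hroot : Real.sqrt ((1 / 4 + τ ^ 2) * V₀) ≤ V₀ * (1 / 2 + τ) := by
    refine Real.sqrt_le_iff.2 ⟨by positivity, ?_⟩
    have h1 : 1 / 4 + τ ^ 2 ≤ (1 / 2 + τ) ^ 2 := by nlinarith
    calc (1 / 4 + τ ^ 2) * V₀ ≤ (1 / 2 + τ) ^ 2 * (V₀ * V₀) := by
          refine mul_le_mul h1 (by nlinarith) (by linarith) (by positivity)
      _ = _ := by ring
  rw [Real.log_div (by positivity) hm0.ne', Real.log_mul (by positivity) (Real.exp_pos _).ne',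
    Real.log_exp, ← mul_assoc S, Real.log_mul (by positivity) (Real.exp_pos _).ne', Real.log_exp]
  have h1 : Real.log (S * A * Real.sqrt v) = Real.log (S * A) + Real.log (Real.sqrt v) :=
    Real.log_mul (by positivity) (Real.sqrt_pos.2 hv0).ne'
  have h2 := le_abs_self (Real.log (S * A * Real.sqrt v))
  have h3 : Real.sqrt ((1 / 4 + τ ^ 2) * V₀) * (s / 2) ≤ V₀ * (1 / 2 + τ) * (s / 2) := by gcongr
  linarith

/-- A bound that is linear in `c₁ + c₂ τ + ℓ` is one that is linear in `c τ + ℓ`, provided that `ℓ`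
is bounded below by a positive constant for small `τ`. -/
lemma exists_absorbing_constants {κ c₁ c₂ τ₁ : ℝ} (hκ : 0 < κ) (hc₁ : 0 < c₁) (hc₂ : 0 < c₂)
    (hτ₁ : 0 < τ₁) (hτ₁' : τ₁ ≤ 1) : ∃ c : ℝ, 1 < c ∧ ∃ C : ℝ, 0 < C ∧ ∀ τ ℓ N : ℝ, 0 < τ →
      0 ≤ N → N ≤ κ * (c₁ + c₂ * τ + ℓ) → (τ < τ₁ → Real.log 2 ≤ ℓ) → N < C * (c * τ + ℓ) := by
  have hlog : 0 < Real.log 2 := Real.log_pos one_lt_two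
  set c := 1 + c₂ + (c₁ + 1) / τ₁ with hc
  set D := (c₁ + 1 + c₂) / Real.log 2 + 1 with hD
  have hD1 : 1 ≤ D := by
    rw [hD]
    have : 0 ≤ (c₁ + 1 + c₂) / Real.log 2 := by positivity
    linarith
  refine ⟨c, ?_, κ * D, by positivity, fun τ ℓ N hτ hN hle hsmall => ?_⟩
  · rw [hc]
    have : 0 < (c₁ + 1) / τ₁ := by positivity
    linarith
  have hX : N < κ * (c₁ + 1 + c₂ * τ + ℓ) := by nlinarith
  refine hX.trans_le ?_
  rw [mul_assoc]
  refine mul_le_mul_of_nonneg_left ?_ hκ.le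
  rcases lt_or_ge τ τ₁ with h | h
  · have hℓ := hsmall h
    have h1 : c₁ + 1 + c₂ ≤ (c₁ + 1 + c₂) / Real.log 2 * ℓ := by
      rw [div_mul_eq_mul_div, le_div_iff₀ hlog]
      gcongr
    have h2 : c₂ * τ ≤ c₂ := by nlinarith
    have h3 : D * ℓ = (c₁ + 1 + c₂) / Real.log 2 * ℓ + ℓ := by rw [hD]; ring
    have h4 : 0 ≤ D * (c * τ) := by positivity
    linarith
  · have h1 : c₁ + 1 ≤ (c₁ + 1) / τ₁ * τ := by
      rw [div_mul_eq_mul_div, le_div_iff₀ hτ₁]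
      gcongr
    have h2 : c * τ = τ + c₂ * τ + (c₁ + 1) / τ₁ * τ := by rw [hc]; ring
    have h3 : 0 ≤ c₁ + 1 + c₂ * τ + ℓ := by
      by_contra hcon
      push Not at hcon
      nlinarith
    nlinarith

lemma finite_of_card_le {T : Set ℝ} {b : ℝ}
    (h : ∀ Z : Finset ℝ, (∀ t ∈ Z, t ∈ T) → (Z.card : ℝ) ≤ b) : T.Finite := by
  by_contra hinf
  obtain ⟨N, hN⟩ := exists_nat_gt b
  obtain ⟨Z, hZT, hZN⟩ := Set.Infinite.exists_subset_card_eq hinf N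
  have h1 := h Z fun t ht => hZT ht
  rw [hZN] at h1
  linarith

lemma zeroSet_inter_trace (φ : Surface Γ → ℝ) (α : ℝ → ℍ) : zeroSet φ ∩ trace Γ α =
    (fun t => proj Γ (α t)) '' {t | t ∈ Set.Icc (0 : ℝ) 1 ∧ pullback φ (α t) = 0} := by
  ext p
  constructor
  · rintro ⟨hp, t, ht, rfl⟩
    exact ⟨t, ⟨ht, hp⟩, rfl⟩
  · rintro ⟨t, ⟨ht, h0⟩, rfl⟩
    exact ⟨h0, t, ht, rfl⟩

end

end HypSurface

end

open HypSurface in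
theorem mainTheorem2 (Γ : Subgroup SL(2, ℝ)) (hΓ : DiscreteTopology Γ)
    (F : Set UpperHalfPlane) (hF : IsFundDomain Γ F)
    (hY : CompactSpace (Surface Γ) ∨ MeasureTheory.volume F < ⊤)
    (α : ℝ → UpperHalfPlane) (hα : IsGeodesicCircle α ∨ IsClosedHorocycle Γ α) :
    ∃ c : ℝ, 1 < c ∧ ∃ C : ℝ, 0 < C ∧
      ∀ (τ : ℝ) (φ : Surface Γ → ℝ), 0 < τ → IsEigenfunction φ τ → l2Norm F φ = 1 →
        curveL2Norm α φ ≠ 0 →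
          (zeroSet φ ∩ trace Γ α).Finite ∧
            ((zeroSet φ ∩ trace Γ α).ncard : ℝ) <
              C * Real.log (Real.exp (c * τ) / curveL2Norm α φ) := by
  obtain ⟨P, V, s, hP, hs, hαP⟩ := exists_isPeriodicCoord hα
  obtain rfl : α = fun t : ℝ => P (t + s * Complex.I) := funext hαP
  obtain ⟨κ, c₁, c₂, hκ, hc₁, hc₂, hcard⟩ := hP.exists_card_zeros_le hΓ hF hs
  obtain ⟨τ₁, hτ₁, hτ₁', hsmall⟩ := hP.exists_curveEnergy_lt hΓ hF hs
  obtain ⟨c, hc, C, hC, hfinal⟩ := exists_absorbing_constants hκ hc₁ hc₂ hτ₁ hτ₁'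
  refine ⟨c, hc, C, hC, fun τ φ hτ hφ hφ1 hne => ?_⟩
  set α : ℝ → UpperHalfPlane := fun t : ℝ => P (t + s * Complex.I)
  have hu := hφ.isUnitEigen hφ1
  have hnorm : curveL2Norm α φ = Real.sqrt (curveEnergy α (pullback φ)) := rfl
  have hpos : 0 < curveL2Norm α φ := lt_of_le_of_ne (Real.sqrt_nonneg _) hne.symm
  have hbound := hcard (pullback φ) τ hτ hu (Real.sqrt_pos.1 hpos)
  rw [← hnorm, sub_eq_add_neg] at hbound
  have hfin := finite_of_card_le
    (T := {t | t ∈ Set.Icc (0 : ℝ) 1 ∧ pullback φ (α t) = 0}) hbound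
  have hncard : ((zeroSet φ ∩ trace Γ α).ncard : ℝ) ≤ hfin.toFinset.card := by
    rw [zeroSet_inter_trace, ← Set.ncard_eq_toFinset_card _ hfin]
    exact_mod_cast Set.ncard_image_le hfin
  refine ⟨zeroSet_inter_trace φ α ▸ hfin.image _, ?_⟩
  rw [Real.log_div (Real.exp_pos _).ne' hne, Real.log_exp, sub_eq_add_neg]
  refine hfinal τ _ _ hτ (Nat.cast_nonneg _) (hncard.trans (hbound _ fun t ht => by simpa using ht))
    fun hlt => ?_
  have h1 : curveL2Norm α φ ≤ 1 / 2 := by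
    rw [hnorm]
    exact Real.sqrt_le_iff.2 ⟨by norm_num, by
      have := hsmall (pullback φ) τ hτ hlt hu
      norm_num at this ⊢
      exact this.le⟩
  have h2 := Real.log_le_log hpos h1
  rw [one_div, Real.log_inv] at h2
  linarith
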